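/- \textbf{Setting.} Let $q$ be a prime power, $k=\mathbb F_q$, $A=\mathbb F_q[t]$, $F$ a finite separable extension of $\mathbb F_q(t)$, and $K/F$ a finite abelian Galois extension with group $G$, such that $\mathbb F_q$ is algebraically closed in $K$. Put $R=\mathbb F_q[G]$ and $K_\infty=\mathbb F_q((t^{-1}))\otimes_{\mathbb F_q(t)}K=\prod_{w\mid\infty}K_w$, with its natural topology, its $G$-action, and the sup $\|\cdot\|$ of the absolute values of the $K_w$ which extend the one of $\mathbb F_q((t^{-1}))$ with $\|t\|=q$; let $\mathcal O_{K_\infty}$ be the closed unit ball. \textbf{Lattices and the class $\mathcal C$.} An $A[G]$-lattice in $K_\infty$ is an $A[G]$-submodule which is free over $A$ of rank $\dim_{\mathbb F_q((t^{-1}))}K_\infty$ and spans $K_\infty$ over $\mathbb F_q((t^{-1}))$; it is projective if it is so over $A[G]$. The class $\mathcal C$ consists of the compact (Hausdorff) topological $A[G]$-modules $M$ which are $G$-cohomologically trivial and are given with an exact sequence of topological $A[G]$-modules $$0\to K_\infty/\Lambda\xrightarrow{\iota}M\xrightarrow{\pi}H\to0,$$ with $\Lambda$ an $A[G]$-lattice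 and $H$ finite and discrete. For a projective lattice $\Lambda$, the module $K_\infty/\Lambda$ is in $\mathcal C$ with $H=0$. \textbf{Volume.} An element $x$ of $\mathbb F_q((t^{-1}))[G]=R((t^{-1}))$ is monic if on each indecomposable factor $eR$ of $R$ ($e$ a primitive idempotent) $ex$ has the form $t^n(e+t^{-1}y)$ with $n\in\mathbb Z$ and $y\in eR[[t^{-1}]]$. For a finite $G$-cohomologically trivial $A[G]$-module $N$ let $|N|_G$ be the monic generator of $\mathrm{Fitt}^0_{A[G]}(N)$. For free lattices $\mathcal F,\mathcal F'$ with bases $e,e'$, $e'=Xe$, let $[\mathcal F:\mathcal F']_G$ be the monic representative of $\det X$ modulo $A[G]^\times$. For projective lattices $\Lambda,\Lambda'$ put $[\Lambda:\Lambda']_G=[\mathcal F:\mathcal F']_G\,|\mathcal F'/\Lambda'|_G/|\mathcal F/\Lambda|_G$, where $\mathcal F\supseteq\Lambda$, $\mathcal F'\supseteq\Lambda'$ are free lattices. Fix a projective lattice $\Lambda_0$. For $M\in\mathcal C$ as above let $$\mathrm{Vol}(M)=\frac{|\Lambda'/\Lambda\times s(H)|_G}{[\Lambda':\Lambda_0]_G},$$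 where $s$ is an $A$-linear section of $\pi$ and $\Lambda'\supseteq\Lambda$ is a projective lattice such that $\Lambda'/\Lambda\times s(H)$ is an $A[G]$-submodule of $M$. (These data exist, and nothing depends on the choices.) \textbf{Nuclear determinants.} Let $\mathcal O_{F,\infty}$, $\mathcal O_{K,\infty}$ be the integral closures in $F$, $K$ of the valuation ring of $\infty$ in $\mathbb F_q(t)$. Let $\mathcal W\subseteq\mathcal O_{K,\infty}$ be an $\infty$-taming module: an $\mathcal O_{F,\infty}[G]$-submodule stable under $x\mapsto x^q$, projective over $\mathcal O_{F,\infty}[G]$ of constant local rank $1$, with $\mathcal O_{K,\infty}/\mathcal W$ finite and supported only at primes of $F$ which are not tamely ramified in $K/F$. Put $U_i=t^{-i}\prod_{v\mid\infty}\mathcal W_v\subseteq K_\infty$, where $\mathcal W_v$ is the completion of $\mathcal W$ at $v$. For $M\in\mathcal C$, the image in $M$ of some $U_i$ with $U_i\cap\Lambda=0$ is called a nucleus of a continuous $R$-endomorphism $\varphi$ of $M$ if $\varphi$ maps the image of $U_j$ into the image of $U_{j+1}$ for all $j\ge i$; $\varphi$ is locally contracting if it has a nucleus. An endomorphism $\Phi=\sum_{n\ge0}\varphi_nT^{-n}$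 of $M[[T^{-1}]]$ is nuclear if all $\varphi_n$ are continuous and locally contracting; $\det_{R[[T^{-1}]]}(1+\Phi\mid M)\in R[[T^{-1}]]$ is then the element which for each $N$ reduces modulo $T^{-N}$ to the determinant of $1+\Phi$ on the finitely generated projective $R[[T^{-1}]]/T^{-N}$-module $(M/U)[[T^{-1}]]/T^{-N}$, for any common nucleus $U$ of the $\varphi_n$, $n<N$. \textbf{Tangency.} Let $M_1,M_2\in\mathcal C$, with lattices $\Lambda_1,\Lambda_2$ and maps $\iota_1,\iota_2$. A continuous $R$-linear isomorphism $\gamma:M_1\to M_2$ is infinitely tangent to the identity if for every $N\ge0$ there are an $i>0$ with $t^{-i}\mathcal O_{K_\infty}\cap\Lambda_1=t^{-i}\mathcal O_{K_\infty}\cap\Lambda_2=0$ and a bijective isometry $\gamma_i$ of $t^{-i}\mathcal O_{K_\infty}$ onto itself such that $\gamma\circ\iota_1=\iota_2\circ\gamma_i$ on $t^{-i}\mathcal O_{K_\infty}$ and $\|\gamma_i(x)-x\|\le\|t\|^{-N}\|x\|$ for all $x\in t^{-i}\mathcal O_{K_\infty}$. \textbf{Theorem.} Let $M_1,M_2$ be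 in $\mathcal C$ with $M_2=K_\infty/\Lambda_2$ for a projective $A[G]$-lattice $\Lambda_2$, and let $\gamma:M_1\to M_2$ be an $\mathbb F_q[G]$-linear continuous isomorphism which is infinitely tangent to the identity. Put $$\Delta_\gamma=\frac{1-\gamma^{-1}t\gamma\,T^{-1}}{1-tT^{-1}}-1=\sum_{n\ge1}\delta_nT^{-n},\qquad \delta_n=(t-\gamma^{-1}t\gamma)\,t^{n-1}.$$ Then $\Delta_\gamma$ is nuclear on $M_1$, $\mathrm{Vol}(M_1)$ is a unit of $\mathbb F_q((t^{-1}))[G]$, and $$\det\nolimits_{R[[T^{-1}]]}(1+\Delta_\gamma\mid M_1)\big|_{T=t}=\frac{\mathrm{Vol}(M_2)}{\mathrm{Vol}(M_1)}\qquad\text{in }\mathbb F_q((t^{-1}))[G].$$ -/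

import Mathlib

set_option maxSynthPendingDepth 3

universe u

open scoped Polynomial PowerSeries TensorProduct

noncomputable section

namespace EqVol

/-! ## The local field `𝔽_q((t⁻¹))` -/

/-- The field `k((t⁻¹))`: formal Laurent series over `k` whose variable is read as `t⁻¹`.
(A type synonym: the embedding of `k(t)` used here sends `t` to the inverse of the variable.) -/
def KInf (k : Type u) [Field k] : Type u := LaurentSeries k

section LocalField

variable (k : Type u) [Field k]

/-- The absolute value on `k((t⁻¹))` normalised by `|t| = #k`. -/
def laurentAbs [Finite k] : AbsoluteValue (LaurentSeries k) ℝ where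
  toFun f := by
    classical
    exact if f = 0 then 0 else (Nat.card k : ℝ) ^ (-f.order)
  map_mul' f g := by
    have hq : (Nat.card k : ℝ) ≠ 0 := by exact_mod_cast Nat.card_pos.ne'
    by_cases hf : f = 0
    · simp [hf]
    by_cases hg : g = 0
    · simp [hg]
    simp only [hf, hg, mul_eq_zero, or_self, if_false]
    rw [HahnSeries.order_mul hf hg, neg_add, zpow_add₀ hq]
  nonneg' f := by
    split_ifs
    · exact le_rfl
    · positivity
  eq_zero' f := by
    have hq : (Nat.card k : ℝ) ≠ 0 := by exact_mod_cast Nat.card_pos.ne'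
    split_ifs with h
    · simp [h]
    · simp [h, zpow_ne_zero _ hq]
  add_le' f g := by
    have hq : (1 : ℝ) ≤ (Nat.card k : ℝ) := by exact_mod_cast Nat.card_pos
    by_cases hf : f = 0
    · subst hf; rw [zero_add]; simp
    by_cases hg : g = 0
    · subst hg; rw [add_zero]; simp
    have h0 : ∀ n : ℤ, (0 : ℝ) ≤ (Nat.card k : ℝ) ^ n := fun n => by positivity
    by_cases hfg : f + g = 0
    · simp only [hfg, hf, hg, if_true, if_false]
      exact add_nonneg (h0 _) (h0 _)
    simp only [hf, hg, hfg, if_false]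
    have hmin := HahnSeries.min_order_le_order_add hfg
    rcases min_le_iff.1 hmin with h | h
    · have := zpow_le_zpow_right₀ hq (neg_le_neg h)
      linarith [h0 (-g.order)]
    · have := zpow_le_zpow_right₀ hq (neg_le_neg h)
      linarith [h0 (-f.order)]

instance [Finite k] : NormedField (KInf k) := (laurentAbs k).toNormedField


variable [Finite k]

/-- The `i`-th coefficient of an element of `k((t⁻¹))`, i.e. the coefficient of `t⁻ⁱ`. -/
def lcoeff {k : Type u} [Field k] (f : KInf k) (i : ℤ) : k := HahnSeries.coeff (Γ := ℤ) f i

/-- The element `t` of `k((t⁻¹))`. -/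
def tInf : KInf k := (HahnSeries.single (-1 : ℤ) (1 : k) : LaurentSeries k)

instance : Algebra k (KInf k) := (HahnSeries.C : k →+* LaurentSeries k).toAlgebra

/-- The subring `k[[t⁻¹]]` of `k((t⁻¹))`. -/
def powerSeriesSubring : Subring (KInf k) := (HahnSeries.ofPowerSeries ℤ k).range

/-- `k[t] → k((t⁻¹))`, with values in the type of Laurent series. -/
def polyToLaurentAux (k : Type u) [Field k] : k[X] →+* LaurentSeries k :=
  Polynomial.eval₂RingHom HahnSeries.C (HahnSeries.single (-1 : ℤ) (1 : k))

lemma coeff_polyToLaurentAux (k : Type u) [Field k] (p : k[X]) (n : ℕ) :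
    (polyToLaurentAux k p).coeff (-(n : ℤ)) = p.coeff n := by
  have h : polyToLaurentAux k p =
      (∑ i ∈ Finset.range (p.natDegree + 1),
        HahnSeries.single (-(i : ℤ)) (p.coeff i) : LaurentSeries k) := by
    rw [polyToLaurentAux, Polynomial.coe_eval₂RingHom, Polynomial.eval₂_eq_sum_range]
    refine Finset.sum_congr rfl fun i _ => ?_
    rw [HahnSeries.single_pow]
    rw [HahnSeries.C_apply, HahnSeries.single_mul_single]
    simp
  rw [h, HahnSeries.coeff_sum]
  simp only [HahnSeries.coeff_single, neg_inj, Nat.cast_inj]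
  rw [Finset.sum_ite_eq]
  split_ifs with hn
  · rfl
  · rw [Polynomial.coeff_eq_zero_of_natDegree_lt]
    simpa using hn

/-- `k[t] → k((t⁻¹))`. -/
def polyToLaurent : k[X] →+* KInf k := polyToLaurentAux k

lemma polyToLaurent_injective : Function.Injective (polyToLaurent k) := by
  intro p q h
  ext n
  rw [← coeff_polyToLaurentAux, ← coeff_polyToLaurentAux]
  exact congrArg (fun f : LaurentSeries k => f.coeff (-(n : ℤ))) h

/-- The embedding `k(t) → k((t⁻¹))`. -/
instance : Algebra (RatFunc k) (KInf k) :=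
  (IsFractionRing.lift (A := k[X]) (K := RatFunc k) (g := (polyToLaurent k))
    (polyToLaurent_injective k)).toAlgebra

/-- `k((t⁻¹))` as a `k[t]`-algebra. -/
instance : Algebra k[X] (KInf k) := (polyToLaurent k).toAlgebra

end LocalField

/-! ## The `G`-ring `K_∞` -/

section Global

variable (k : Type u) [Field k] [Finite k]
variable (F : Type u) [Field F] [Algebra (RatFunc k) F]
variable (K : Type u) [Field K] [Algebra (RatFunc k) K] [Algebra F K]
  [IsScalarTower (RatFunc k) F K]
variable (G : Type u) [CommGroup G] [MulSemiringAction G K] [IsGaloisGroup G F K]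

/-- `K_∞ = k((t⁻¹)) ⊗_{k(t)} K`. The base field `F` is recorded in the type because the
Galois group of `K/F` acts on `K_∞`. -/
@[nolint unusedArguments]
def KInfty (k : Type u) [Field k] [Finite k]
    (F : Type u) [Field F] [Algebra (RatFunc k) F]
    (K : Type u) [Field K] [Algebra (RatFunc k) K] [Algebra F K]
    [IsScalarTower (RatFunc k) F K] : Type u := KInf k ⊗[RatFunc k] K

instance : CommRing (KInfty k F K) := inferInstanceAs (CommRing (KInf k ⊗[RatFunc k] K))

instance : Algebra (KInf k) (KInfty k F K) :=
  inferInstanceAs (Algebra (KInf k) (KInf k ⊗[RatFunc k] K))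

/-- `K_∞` as a `k[t]`-module. -/
instance : Module k[X] (KInfty k F K) := Module.compHom _ (algebraMap k[X] (KInf k))

/-- The pure tensor `c ⊗ x` in `K_∞`. -/
def KInfty.tmul (c : KInf k) (x : K) : KInfty k F K := (c ⊗ₜ[RatFunc k] x : KInf k ⊗[RatFunc k] K)

/-- The topology of `K_∞`: the canonical topology of a finite-dimensional vector space over the
local field `k((t⁻¹))`, which is the product topology of the completions of `K` above `∞`. -/
instance : TopologicalSpace (KInfty k F K) := moduleTopology (KInf k) (KInfty k F K)

/-- The sup norm on `K_∞`. The completions of `K` at the primes above `∞` are the residue fields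
`K_w` of `K_∞` at its finitely many maximal ideals, and the local norm on `K_w` is the unique
extension of the absolute value of `k((t⁻¹))`, which is its spectral norm. -/
def normInf (x : KInfty k F K) : ℝ :=
  ⨆ w : MaximalSpectrum (KInfty k F K),
    letI : Field (KInfty k F K ⧸ w.asIdeal) := Ideal.Quotient.field w.asIdeal
    spectralNorm (KInf k) (KInfty k F K ⧸ w.asIdeal) (Ideal.Quotient.mk w.asIdeal x)

/-- The ball `t⁻ⁱ 𝒪_{K_∞}`, where `𝒪_{K_∞}` is the closed unit ball. -/
def ball (i : ℕ) : Set (KInfty k F K) := {x | normInf k F K x ≤ (Nat.card k : ℝ) ^ (-(i : ℤ))}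

/-- The action of `G` on `K_∞`, through the factor `K`. -/
def rhoInf : Representation (KInf k) G (KInfty k F K) where
  toFun g := (Algebra.TensorProduct.map (AlgHom.id (KInf k) (KInf k))
    ((MulSemiringAction.toAlgHom F K g).restrictScalars (RatFunc k))).toLinearMap
  map_one' := by
    refine TensorProduct.AlgebraTensorModule.ext fun c x => ?_
    change c ⊗ₜ[RatFunc k] ((1 : G) • x) = c ⊗ₜ[RatFunc k] x
    rw [one_smul]
  map_mul' g h := by
    refine TensorProduct.AlgebraTensorModule.ext fun c x => ?_
    change c ⊗ₜ[RatFunc k] ((g * h) • x) = c ⊗ₜ[RatFunc k] (g • h • x)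
    rw [mul_smul]

/-- `R = k[G]`. -/
abbrev GrpRing (k : Type u) [Field k] (G : Type u) : Type u := MonoidAlgebra k G

/-- `k((t⁻¹))[G]`. -/
abbrev BigRing (k : Type u) [Field k] [Finite k] (G : Type u) : Type u := MonoidAlgebra (KInf k) G

/-- `R[t] = A[G] → k((t⁻¹))[G]`. -/
def toBig : (GrpRing k G)[X] →+* BigRing k G :=
  Polynomial.eval₂RingHom (MonoidAlgebra.mapRingHom G (algebraMap k (KInf k)))
    (algebraMap (KInf k) (BigRing k G) (tInf k))

instance : Module (BigRing k G) (KInfty k F K) :=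
  Module.compHom (KInfty k F K) (rhoInf k F K G).asAlgebraHom.toRingHom

instance : Module (GrpRing k G)[X] (KInfty k F K) := Module.compHom (KInfty k F K) (toBig k G)

instance : Module (GrpRing k G) (KInfty k F K) :=
  Module.compHom (KInfty k F K) ((toBig k G).comp Polynomial.C)

instance : IsScalarTower (GrpRing k G) (GrpRing k G)[X] (KInfty k F K) where
  smul_assoc r p x := by
    change toBig k G (r • p) • x = toBig k G (Polynomial.C r) • toBig k G p • x
    rw [Polynomial.smul_eq_C_mul, map_mul, mul_smul]

/-! ## Lattices -/

variable {k F K G}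

/-- `A[G]`-lattices in `K_∞`, with `A = k[t]`: an `A[G]`-submodule which is free over `A` of rank
`dim K_∞` and spans `K_∞` over `k((t⁻¹))`. -/
def IsLattice (Λ : Submodule (GrpRing k G)[X] (KInfty k F K)) : Prop :=
  (∃ b : Fin (Module.finrank (KInf k) (KInfty k F K)) → KInfty k F K,
    LinearIndependent k[X] b ∧
      (Submodule.span k[X] (Set.range b) : Set (KInfty k F K)) = Λ) ∧
  Submodule.span (KInf k) (Λ : Set (KInfty k F K)) = ⊤

/-- Projective `A[G]`-lattices. -/
def IsProjLattice (Λ : Submodule (GrpRing k G)[X] (KInfty k F K)) : Prop :=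
  IsLattice Λ ∧ Module.Projective (GrpRing k G)[X] Λ

/-! ## Monic elements, Fitting ideals, sizes -/

/-- The coefficient in `k[G]` of `t⁻ⁱ` of an element of `k((t⁻¹))[G] = k[G]((t⁻¹))`. -/
def coeffBig [Fintype G] (x : BigRing k G) (i : ℤ) : GrpRing k G :=
  ∑ g : G, MonoidAlgebra.single g (lcoeff (x.coeff g) i)

/-- Irreducible (primitive) idempotents of a commutative ring. -/
def IsPrimIdem {S : Type*} [CommRing S] (e : S) : Prop :=
  IsIdempotentElem e ∧ e ≠ 0 ∧ ∀ f : S, IsIdempotentElem f → f * e = f → f = 0 ∨ f = e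

/-- Monic elements of `k((t⁻¹))[G]`: on each indecomposable component `e k[G]` of `k[G]` the
element has the form `tⁿ (1 + t⁻¹ e k[G][[t⁻¹]])`, where `n` may depend on the component. -/
def IsMonic [Fintype G] (x : BigRing k G) : Prop :=
  ∀ e : GrpRing k G, IsPrimIdem e →
    ∃ n : ℤ, e * coeffBig x (-n) = e ∧ ∀ i : ℤ, i < -n → e * coeffBig x i = 0

/-- The zeroth Fitting ideal of a finitely generated module `N` over `S`: generated by the
determinants of the `n × n` matrices whose rows are relations between `n` generators of `N`.
(This ideal does not depend on the generators; the supremum is over all systems of generators.) -/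
def fitt {S : Type*} [CommRing S] (N : Type*) [AddCommGroup N] [Module S N] : Ideal S :=
  ⨆ (n : ℕ) (x : Fin n → N) (_ : Submodule.span S (Set.range x) = ⊤),
    Ideal.span {d | ∃ a : Matrix (Fin n) (Fin n) S, (∀ i, ∑ j, a i j • x j = 0) ∧ d = a.det}

/-- `|N|_G`, the monic generator of the Fitting ideal of a finite `G`-cohomologically trivial
`A[G]`-module `N`. -/
def gsize [Fintype G] (N : Type*) [AddCommGroup N] [Module (GrpRing k G)[X] N] : (GrpRing k G)[X] :=
  Classical.epsilon fun f => IsMonic (toBig k G f) ∧ Ideal.span {f} = fitt (S := (GrpRing k G)[X]) N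

/-! ## Indices of lattices -/

/-- `z` is the index `[Λ : Λ']_G` of two free `A[G]`-lattices: if `e' = X e` for `A[G]`-bases `e`
of `Λ` and `e'` of `Λ'`, then `z` is the monic representative of `det X` modulo `A[G]ˣ`. -/
def IsFreeIndex [Fintype G] (Λ Λ' : Submodule (GrpRing k G)[X] (KInfty k F K))
    (z : BigRing k G) : Prop :=
  ∃ (e : Module.Basis (Fin (Module.finrank (RatFunc k) F)) (GrpRing k G)[X] Λ)
    (e' : Module.Basis (Fin (Module.finrank (RatFunc k) F)) (GrpRing k G)[X] Λ')
    (X : Matrix (Fin (Module.finrank (RatFunc k) F)) (Fin (Module.finrank (RatFunc k) F))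
      (BigRing k G)) (v : ((GrpRing k G)[X])ˣ),
    (∀ i, (e' i : KInfty k F K) = ∑ j, X i j • (e j : KInfty k F K)) ∧
    IsMonic z ∧ X.det = z * toBig k G v

/-- `z` is the index `[Λ : Λ']_G = [ℱ : ℱ']_G · |ℱ'/Λ'|_G / |ℱ/Λ|_G` of two projective
`A[G]`-lattices, for some free `A[G]`-lattices `ℱ ⊇ Λ` and `ℱ' ⊇ Λ'`. -/
def IsIndex [Fintype G] (Λ Λ' : Submodule (GrpRing k G)[X] (KInfty k F K))
    (z : BigRing k G) : Prop :=
  ∃ (E E' : Submodule (GrpRing k G)[X] (KInfty k F K)) (z₀ : BigRing k G),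
    IsLattice E ∧ IsLattice E' ∧ Λ ≤ E ∧ Λ' ≤ E' ∧ IsFreeIndex E E' z₀ ∧
    z = z₀ * toBig k G (gsize (E' ⧸ Λ'.submoduleOf E')) *
      Ring.inverse (toBig k G (gsize (E ⧸ Λ.submoduleOf E)))

/-- The index `[Λ : Λ']_G` of two projective `A[G]`-lattices. -/
def latticeIndex [Fintype G] (Λ Λ' : Submodule (GrpRing k G)[X] (KInfty k F K)) : BigRing k G :=
  Classical.epsilon (IsIndex Λ Λ')

/-! ## The class `𝒞` and the volume -/

variable (k F K G)

/-- A structural exact sequence `0 → K_∞/Λ → M → H → 0` of topological `A[G]`-modules, where `Λ` is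
an `A[G]`-lattice and `H` (which is finite in all uses) is discrete. -/
structure StructSeq (M H : Type u) [AddCommGroup M] [Module (GrpRing k G)[X] M]
    [TopologicalSpace M] [AddCommGroup H] [Module (GrpRing k G)[X] H] where
  /-- the lattice -/
  Λ : Submodule (GrpRing k G)[X] (KInfty k F K)
  isLattice : IsLattice Λ
  /-- the inclusion -/
  ι : (KInfty k F K ⧸ Λ) →ₗ[(GrpRing k G)[X]] M
  /-- the projection -/
  π : M →ₗ[(GrpRing k G)[X]] H
  continuous_ι : Continuous ι
  isOpen_preimage_π : ∀ s : Set H, IsOpen (π ⁻¹' s)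
  injective_ι : Function.Injective ι
  exact : Function.Exact ι π
  surjective_π : Function.Surjective π

/-- The structural exact sequence `0 → K_∞/Λ → K_∞/Λ → 0 → 0`. -/
def StructSeq.ofLattice (Λ : Submodule (GrpRing k G)[X] (KInfty k F K)) (hΛ : IsLattice Λ) :
    StructSeq k F K G (KInfty k F K ⧸ Λ) PUnit.{u + 1} where
  Λ := Λ
  isLattice := hΛ
  ι := LinearMap.id
  π := 0
  continuous_ι := continuous_id
  isOpen_preimage_π s := by
    by_cases h : (0 : PUnit.{u + 1}) ∈ s
    · convert isOpen_univ
      ext x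
      simpa using h
    · convert isOpen_empty
      ext x
      simpa using h
  injective_ι := Function.injective_id
  exact := fun x => ⟨fun _ => ⟨x, rfl⟩, fun _ => rfl⟩
  surjective_π := fun x => ⟨0, Subsingleton.elim _ _⟩

/-- An `R`-module, `R = k[G]`, is `G`-cohomologically trivial if all Tate cohomology groups of all
subgroups of `G` vanish on it. -/
def IsCohTrivial [Fintype G] (M : Type u) [AddCommGroup M] [Module (GrpRing k G) M] : Prop := by
  classical
  letI : Module k M := Module.compHom M (algebraMap k (GrpRing k G))
  haveI : IsScalarTower k (GrpRing k G) M := ⟨fun a r m => by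
    change (a • r) • m = algebraMap k (GrpRing k G) a • r • m
    rw [Algebra.smul_def, mul_smul]⟩
  exact ∀ (S : Subgroup G) (n : ℤ), Subsingleton
    (tateCohomology (Rep.res S.subtype (Rep.of (Representation.ofModule' (k := k) (G := G) M))) n)

variable {k F K G}

section Volume

variable {M H : Type u} [AddCommGroup M] [Module (GrpRing k G)[X] M] [TopologicalSpace M]
  [AddCommGroup H] [Module (GrpRing k G)[X] H]

/-- `s` is an `A`-linear section of `π`. -/
def IsSection (D : StructSeq k F K G M H) (s : H →+ M) : Prop :=
  (∀ h, D.π (s h) = h) ∧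
  ∀ (p : k[X]) (h : H), s (p.map (algebraMap k (GrpRing k G)) • h) =
    p.map (algebraMap k (GrpRing k G)) • s h

/-- The lattice `Λ'` is `(M, s)`-admissible, and `N` is the `A[G]`-submodule `Λ'/Λ × s(H)` of `M`. -/
def IsAdmissible (D : StructSeq k F K G M H) (s : H →+ M)
    (Λ' : Submodule (GrpRing k G)[X] (KInfty k F K)) (N : Submodule (GrpRing k G)[X] M) : Prop :=
  IsProjLattice Λ' ∧ D.Λ ≤ Λ' ∧
  (N : Set M) = {m | ∃ x ∈ Λ', ∃ h : H, m = D.ι (D.Λ.mkQ x) + s h}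

/-- `v` is the volume of `M`, normalised by `Λ₀` and computed with some section `s` and some
`(M, s)`-admissible lattice `Λ'`: `v = |Λ'/Λ × s(H)|_G / [Λ' : Λ₀]_G`. -/
def IsVol [Fintype G] (Λ₀ : Submodule (GrpRing k G)[X] (KInfty k F K))
    (D : StructSeq k F K G M H) (v : BigRing k G) : Prop :=
  ∃ (s : H →+ M) (Λ' : Submodule (GrpRing k G)[X] (KInfty k F K))
    (N : Submodule (GrpRing k G)[X] M), IsSection D s ∧ IsAdmissible D s Λ' N ∧
    v = toBig k G (gsize N) * Ring.inverse (latticeIndex Λ' Λ₀)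

/-- The volume `Vol(M)`, normalised by the projective lattice `Λ₀`. -/
def vol [Fintype G] (Λ₀ : Submodule (GrpRing k G)[X] (KInfty k F K))
    (D : StructSeq k F K G M H) : BigRing k G :=
  Classical.epsilon (IsVol Λ₀ D)

end Volume

end Global

/-! ## `∞`-taming modules -/

section Taming

variable (k : Type u) [Field k]
variable (F : Type u) [Field F] [Algebra (RatFunc k) F]
variable (K : Type u) [Field K] [Algebra F K]
variable (G : Type u) [CommGroup G] [MulSemiringAction G K] [IsGaloisGroup G F K]

/-- The valuation ring of `∞` in `k(t)`. -/
def ratInt : Subring (RatFunc k) := by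
  classical
  exact (RatFunc.inftyValuation k).integer

/-- `𝒪_{F,∞}`: the intersection of the valuation rings of the infinite primes of `F`, i.e. the
integral closure in `F` of the valuation ring of `∞` in `k(t)`. -/
abbrev OF : Subalgebra (ratInt k) F := integralClosure (ratInt k) F

/-- `𝒪_{K,∞}`: the integral closure of `𝒪_{F,∞}` in `K`. -/
abbrev OK : Subalgebra (OF k F) K := integralClosure (OF k F) K

/-- `K` as a representation of `G` over `𝒪_{F,∞}`. -/
def rhoK : Representation (OF k F) G K :=
  haveI : SMulCommClass G F K := IsGaloisGroup.commutes
  haveI : SMulCommClass G (OF k F) K := ⟨fun g a x => smul_comm g (a : F) x⟩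
  Representation.ofDistribMulAction (OF k F) G K

variable {k F K G}

/-- The intersection of `W` and `𝒪_{K,∞}` as an `𝒪_{F,∞}`-submodule of `𝒪_{K,∞}`. -/
def tamingSub (W : Submodule (MonoidAlgebra (OF k F) G) (rhoK k F K G).asModule) :
    Submodule (OF k F) (OK k F K) where
  carrier := {x | (rhoK k F K G).asModuleEquiv.symm (x : K) ∈ W}
  add_mem' := fun {a b} ha hb => by
    simpa using W.add_mem ha hb
  zero_mem' := by simp
  smul_mem' := fun c x hx => by
    have := W.smul_mem (algebraMap (OF k F) (MonoidAlgebra (OF k F) G) c) hx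
    rwa [algebraMap_smul, ← map_smul] at this

/-- A maximal ideal `v` of `𝒪_{F,∞}` is tamely ramified in `K/F` if the ramification indices of
the primes above `v` are not divisible by the characteristic. (Residue fields are finite.) -/
def IsTameAt (K : Type u) [Field K] [Algebra F K] (v : MaximalSpectrum (OF k F)) : Prop :=
  ∀ w : Ideal (OK k F K), w.IsMaximal → w.LiesOver v.asIdeal →
    ¬ ringChar k ∣ w.ramificationIdx (OF k F)

/-- `∞`-taming modules for `K/F`: the `𝒪_{F,∞}{τ}[G]`-submodules `W` of `𝒪_{K,∞}` which are
projective of constant local rank `1` over `𝒪_{F,∞}[G]`, and for which `𝒪_{K,∞}/W` is finite and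
supported only at primes that are not tamely ramified in `K/F`. -/
structure IsInftyTaming (W : Submodule (MonoidAlgebra (OF k F) G) (rhoK k F K G).asModule) :
    Prop where
  le : ∀ x ∈ W, (rhoK k F K G).asModuleEquiv x ∈ OK k F K
  frobenius : ∀ x ∈ W, (rhoK k F K G).asModuleEquiv.symm
    ((rhoK k F K G).asModuleEquiv x ^ Nat.card k) ∈ W
  projective : Module.Projective (MonoidAlgebra (OF k F) G) W
  rank : ∀ 𝔭 : PrimeSpectrum (MonoidAlgebra (OF k F) G), Module.rankAtStalk W 𝔭 = 1
  finite : Finite (OK k F K ⧸ tamingSub W)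
  support : ∀ v : MaximalSpectrum (OF k F), IsTameAt K v →
    v.toPrimeSpectrum ∉ Module.support (OF k F) (OK k F K ⧸ tamingSub W)

end Taming

/-! ## Nuclear determinants -/

section Det

/-- The determinant of an endomorphism `f` of a finitely generated projective `S`-module `P`:
embed `P` as a direct summand of some `Sⁿ` and extend `f` by the identity of the complement. -/
def detProj {S P : Type*} [CommRing S] [AddCommGroup P] [Module S P] (f : P →ₗ[S] P) : S := by
  classical
  exact Classical.epsilon fun d => ∃ (n : ℕ) (i : P →ₗ[S] (Fin n → S)) (r : (Fin n → S) →ₗ[S] P),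
    r ∘ₗ i = LinearMap.id ∧ d = LinearMap.det (i ∘ₗ f ∘ₗ r + (LinearMap.id - i ∘ₗ r))

end Det

section Nuclear

variable {k : Type u} [Field k] [Finite k]
variable {F : Type u} [Field F] [Algebra (RatFunc k) F]
variable {K : Type u} [Field K] [Algebra (RatFunc k) K] [Algebra F K]
  [IsScalarTower (RatFunc k) F K]
variable {G : Type u} [CommGroup G] [MulSemiringAction G K] [IsGaloisGroup G F K]

/-- The `R`-submodule `U_{i,∞} = ∏_{v ∣ ∞} t⁻ⁱ W_v` of `K_∞`, where `W_v` is the `v`-adic completion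
of `W`: since `∏_v W_v` is the `t⁻¹`-adic completion of `W`, this is `t⁻ⁱ k[[t⁻¹]] W`. -/
def nbhd (W : Submodule (MonoidAlgebra (OF k F) G) (rhoK k F K G).asModule) (i : ℕ) :
    Submodule (GrpRing k G) (KInfty k F K) :=
  Submodule.span (GrpRing k G) {x | ∃ c ∈ powerSeriesSubring k, ∃ w ∈ W,
    x = KInfty.tmul k F K ((tInf k)⁻¹ ^ i * c) ((rhoK k F K G).asModuleEquiv w)}

variable {M H : Type u} [AddCommGroup M] [Module (GrpRing k G)[X] M] [Module (GrpRing k G) M]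
  [IsScalarTower (GrpRing k G) (GrpRing k G)[X] M] [TopologicalSpace M]
  [AddCommGroup H] [Module (GrpRing k G)[X] H]

/-- The image of `U_{i,∞}` in `M`. -/
def nbhdM (W : Submodule (MonoidAlgebra (OF k F) G) (rhoK k F K G).asModule)
    (D : StructSeq k F K G M H) (i : ℕ) : Submodule (GrpRing k G) M :=
  (nbhd W i).map ((D.ι ∘ₗ D.Λ.mkQ).restrictScalars (GrpRing k G))

/-- The image of `U_{i,∞}` (where `U_{i,∞} ∩ Λ = 0`) is a nucleus for the endomorphism `φ` of `M`. -/
def IsNucleus (W : Submodule (MonoidAlgebra (OF k F) G) (rhoK k F K G).asModule)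
    (D : StructSeq k F K G M H) (φ : Module.End (GrpRing k G) M) (i : ℕ) : Prop :=
  (∀ x ∈ nbhd W i, x ∈ D.Λ → x = 0) ∧
  ∀ j, i ≤ j → (nbhdM W D j).map φ ≤ nbhdM W D (j + 1)

/-- The endomorphism `Φ = ∑ φₙ Zⁿ` of `M[[Z]]`, given by its coefficients `φₙ`, is nuclear: each
`φₙ` is a locally contracting continuous endomorphism of `M`. -/
def IsNuclear (W : Submodule (MonoidAlgebra (OF k F) G) (rhoK k F K G).asModule)
    (D : StructSeq k F K G M H) (φ : ℕ → Module.End (GrpRing k G) M) : Prop :=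
  ∀ n, Continuous (φ n) ∧ ∃ i, IsNucleus W D (φ n) i

lemma nbhdM_succ_le (W : Submodule (MonoidAlgebra (OF k F) G) (rhoK k F K G).asModule)
    (D : StructSeq k F K G M H) (i : ℕ) : nbhdM W D (i + 1) ≤ nbhdM W D i := by
  refine Submodule.map_mono (Submodule.span_mono ?_)
  rintro x ⟨c, hc, w, hw, rfl⟩
  refine ⟨(tInf k)⁻¹ * c, (powerSeriesSubring k).mul_mem ?_ hc, w, hw, ?_⟩
  · refine ⟨PowerSeries.X, ?_⟩
    rw [HahnSeries.ofPowerSeries_X]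
    refine eq_inv_of_mul_eq_one_left ?_
    change (HahnSeries.single (1 : ℤ) (1 : k) : LaurentSeries k) * HahnSeries.single (-1 : ℤ) (1 : k)
      = 1
    rw [HahnSeries.single_mul_single]
    simp
  · rw [pow_succ, mul_assoc]

lemma IsNucleus.le_comap {W : Submodule (MonoidAlgebra (OF k F) G) (rhoK k F K G).asModule}
    {D : StructSeq k F K G M H} {φ : Module.End (GrpRing k G) M} {i : ℕ} (h : IsNucleus W D φ i) :
    nbhdM W D i ≤ (nbhdM W D i).comap φ :=
  Submodule.map_le_iff_le_comap.1 ((h.2 i le_rfl).trans (nbhdM_succ_le W D i))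

/-- `det (1 + Φ | (M/U)[[Z]]/Z^N)`, where `U`, the image of `U_{i,∞}`, is a common nucleus for the
coefficients `φₙ`, `n < N`, of `Φ`, and `(M/U)[[Z]]/Z^N = R[[Z]]/Z^N ⊗_R M/U`. -/
def detMod (W : Submodule (MonoidAlgebra (OF k F) G) (rhoK k F K G).asModule)
    (D : StructSeq k F K G M H) (φ : ℕ → Module.End (GrpRing k G) M) (N i : ℕ)
    (h : ∀ n < N, IsNucleus W D (φ n) i) :
    (GrpRing k G)⟦X⟧ ⧸ Ideal.span {(PowerSeries.X : (GrpRing k G)⟦X⟧) ^ N} :=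
  detProj (P := ((GrpRing k G)⟦X⟧ ⧸ Ideal.span {(PowerSeries.X : (GrpRing k G)⟦X⟧) ^ N})
      ⊗[GrpRing k G] (M ⧸ nbhdM W D i))
    (LinearMap.id + ∑ n : Fin N, (Ideal.Quotient.mk (Ideal.span
        {(PowerSeries.X : (GrpRing k G)⟦X⟧) ^ N}) PowerSeries.X) ^ (n : ℕ) •
      LinearMap.baseChange ((GrpRing k G)⟦X⟧ ⧸ Ideal.span {(PowerSeries.X : (GrpRing k G)⟦X⟧) ^ N})
        ((nbhdM W D i).mapQ (nbhdM W D i) (φ n) (h n n.2).le_comap))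

/-- `f ∈ R[[Z]]` is the nuclear determinant `det (1 + Φ | M) = lim_N det (1 + Φ | M[[Z]]/Z^N)`. -/
def IsNuclearDet (W : Submodule (MonoidAlgebra (OF k F) G) (rhoK k F K G).asModule)
    (D : StructSeq k F K G M H) (φ : ℕ → Module.End (GrpRing k G) M)
    (f : (GrpRing k G)⟦X⟧) : Prop :=
  ∀ (N i : ℕ) (h : ∀ n < N, IsNucleus W D (φ n) i), Ideal.Quotient.mk _ f = detMod W D φ N i h

/-- The nuclear determinant of `1 + Φ` on `M`. -/
def nuclearDet (W : Submodule (MonoidAlgebra (OF k F) G) (rhoK k F K G).asModule)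
    (D : StructSeq k F K G M H) (φ : ℕ → Module.End (GrpRing k G) M) : (GrpRing k G)⟦X⟧ :=
  Classical.epsilon (IsNuclearDet W D φ)

/-- Evaluation at `T = t` of a power series in `T⁻¹` over `R = k[G]`, with values in
`k((t⁻¹))[G]`. -/
def evalT [Fintype G] (f : (GrpRing k G)⟦X⟧) : BigRing k G :=
  ∑ g : G, MonoidAlgebra.single g
    (HahnSeries.ofPowerSeries ℤ k (PowerSeries.mk fun n => (PowerSeries.coeff n f).coeff g) : KInf k)

variable (k G M) in
/-- Multiplication by `t` as an `R`-endomorphism of `M`. -/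
def tEnd : Module.End (GrpRing k G) M :=
  haveI : SMulCommClass (GrpRing k G) (GrpRing k G)[X] M := IsScalarTower.to_smulCommClass
  { toFun := fun m => (Polynomial.X : (GrpRing k G)[X]) • m
    map_add' := smul_add _
    map_smul' := fun r m => smul_comm _ r m }

variable {M' H' : Type u} [AddCommGroup M'] [Module (GrpRing k G)[X] M'] [Module (GrpRing k G) M']
  [IsScalarTower (GrpRing k G) (GrpRing k G)[X] M'] [TopologicalSpace M']
  [AddCommGroup H'] [Module (GrpRing k G)[X] H']

/-- The coefficients `δₙ` of `Δ_γ = (1 - γ⁻¹tγ T⁻¹) / (1 - t T⁻¹) - 1 = ∑_{n ≥ 1} δₙ T⁻ⁿ`, namely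
`δₙ = (t - γ⁻¹ t γ) tⁿ⁻¹` for `n ≥ 1`. -/
def delta (γ : M ≃ₗ[GrpRing k G] M') (n : ℕ) : Module.End (GrpRing k G) M :=
  if n = 0 then 0 else
    (tEnd k G M - γ.symm.toLinearMap ∘ₗ tEnd k G M' ∘ₗ γ.toLinearMap) * tEnd k G M ^ (n - 1)

/-- On some ball `t⁻ⁱ 𝒪_{K_∞}` that meets both lattices trivially, `γ` is a bijective isometry
`γᵢ` onto `t⁻ⁱ 𝒪_{K_∞}` with `‖γᵢ x - x‖ ≤ ‖t‖^{-N} ‖x‖`. -/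
def IsTangent (D : StructSeq k F K G M H) (D' : StructSeq k F K G M' H') (γ : M → M') (N : ℕ) :
    Prop :=
  ∃ i : ℕ, 0 < i ∧ (∀ x ∈ ball k F K i, x ∈ D.Λ → x = 0) ∧
    (∀ x ∈ ball k F K i, x ∈ D'.Λ → x = 0) ∧
    ∃ g : ball k F K i ≃ ball k F K i,
      (∀ x : ball k F K i, γ (D.ι (D.Λ.mkQ (x : KInfty k F K))) = D'.ι (D'.Λ.mkQ (g x : KInfty k F K))) ∧
      (∀ x y : ball k F K i, normInf k F K ((g x : KInfty k F K) - (g y : KInfty k F K)) =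
        normInf k F K ((x : KInfty k F K) - (y : KInfty k F K))) ∧
      ∀ x : ball k F K i, normInf k F K ((g x : KInfty k F K) - (x : KInfty k F K)) ≤
        (Nat.card k : ℝ) ^ (-(N : ℤ)) * normInf k F K (x : KInfty k F K)

/-- `γ` is infinitely tangent to the identity. (A shift of `N` by a constant does not matter.) -/
def IsInfTangent (D : StructSeq k F K G M H) (D' : StructSeq k F K G M' H') (γ : M → M') : Prop :=
  ∀ N : ℕ, IsTangent D D' γ N

end Nuclear

end EqVol

end

/-!
Write `R = k[G]`, `A = k[t]`, `Z = T⁻¹` and let `V = K_∞`, which is free over `R((t⁻¹))`: a basis of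
`F` over `k(t)` and a normal basis of `K/F` give coordinates on `V`, hence a filtration `filt b j`
(`j ∈ ℤ`) by the order in `t⁻¹`. All data of the theorem are compared with this filtration: the
balls of the sup norm (`exists_normInf_le`, `exists_mem_filt`; `V` is reduced because `K/k(t)` is
separable, so the sup norm is a norm) and the neighbourhoods `U_i` defined by the taming module
(`exists_nbhd_le`, `exists_le_nbhd`).

**Good overlattices.** Every lattice `Λ` lies, for all large `j`, in a free lattice `E` with a basis
whose matrix is `t^{1-j}(1 + O(t^{-N}))` (`exists_isGood`), and then `V = E ⊕ filt b j`. For `M` in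
the class `𝒞` this produces a decomposition `M = P ⊕ filtM b D j` over `R`, in which `P` is a finite
`A[G]`-submodule, projective over `R`, that contains the image of `E`. The size of a finite module
is multiplicative in exact sequences, so `Vol(M)` is, up to a factor that only depends on `Λ₀`, the
size of `P` times the determinant of the basis of `E` (`IsVol.exists_isCompl`), which is
`t^{n(1-j)}` modulo relative order `t^{-N}` (`IsGood.det_mod`).

**Sizes as characteristic polynomials.** If a finite `A[G]`-module `Q` is a direct summand of `Rᵐ`
over `R`, with projection matrix `π`, and `B` is the matrix of the multiplication by `t`, then `Q` is
the cokernel of `X π - B + 1 - π` over `R[X]`, so that its size is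
`det (X π + 1 - π) · det (1 - X⁻¹ B)` (`polyL_gsize`): the first factor depends only on the
underlying `R`-module, the second is a characteristic polynomial.

**The nuclear determinant.** Modulo `Z^N` it can be computed on `M/U` for `U = filtM b D j` with `j`
large (`exists_detMod_eq`), by the Weinstein–Aronszajn identity `det (1 + XY) = det (1 + YX)`. Let
`t' = γ⁻¹ t γ`. With the section of `M → M/U` given by the complement `P₁` of `U`, on which `t`
acts, the identity `(1 + Δ_γ)(1 - t Z) = 1 - t' Z` gives
`det (1 + Δ_γ) · det (1 - t Z | P₁) = det (1 - t' Z | M/U)` (`quotDet_mul`), where the last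
determinant is formed with the section of `P₁`. For `M₂` the relevant section is that of `γ⁻¹ P₂`.
Since `γ` is tangent to the identity and the lattices are in good position, the two sections differ
by elements of `filtM b D (j + 1)` on `filtM b D (j - N + 1)` (`TangentAt.sub_mem`), and this does
not change the determinant modulo `Z^N`
(`detProj_section_eq`). Hence `det (1 + Δ_γ)` is the ratio of the two characteristic polynomials,
which modulo `Z^N` is the ratio of the volumes.
-/

set_option linter.unusedSectionVars false

noncomputable section

namespace EqVol

/-! ### Determinants of endomorphisms of projective modules -/

section DetProj

variable {S : Type*} [CommRing S]

/-- The Weinstein–Aronszajn identity for linear maps between finite free modules. -/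
lemma det_id_add_comp_comm {m n : ℕ} (A : (Fin m → S) →ₗ[S] (Fin n → S))
    (B : (Fin n → S) →ₗ[S] (Fin m → S)) :
    LinearMap.det (LinearMap.id + A ∘ₗ B) = LinearMap.det (LinearMap.id + B ∘ₗ A) := by
  rw [← LinearMap.det_toMatrix', ← LinearMap.det_toMatrix', map_add, map_add,
    LinearMap.toMatrix'_comp, LinearMap.toMatrix'_comp, LinearMap.toMatrix'_id,
    LinearMap.toMatrix'_id, Matrix.det_one_add_mul_comm]

variable {P Q : Type*} [AddCommGroup P] [Module S P] [AddCommGroup Q] [Module S Q]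

lemma exists_presentation (S P : Type*) [CommRing S] [AddCommGroup P] [Module S P]
    [Module.Finite S P] [Module.Projective S P] :
    ∃ (n : ℕ) (i : P →ₗ[S] (Fin n → S)) (r : (Fin n → S) →ₗ[S] P), r ∘ₗ i = LinearMap.id := by
  obtain ⟨n, r, hr⟩ := Module.Finite.exists_fin' S P
  obtain ⟨i, hi⟩ := Module.projective_lifting_property r LinearMap.id hr
  exact ⟨n, i, r, hi⟩

/-- The determinant of an endomorphism of a projective module may be computed on any presentation
of the module as a direct summand of a finite free module. -/
lemma detProj_eq {n : ℕ} {i : P →ₗ[S] (Fin n → S)} {r : (Fin n → S) →ₗ[S] P}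
    (h : r ∘ₗ i = LinearMap.id) (f : P →ₗ[S] P) :
    detProj f = LinearMap.det (LinearMap.id + i ∘ₗ (f - LinearMap.id) ∘ₗ r) := by
  classical
  have key : ∀ {n : ℕ} (i : P →ₗ[S] (Fin n → S)) (r : (Fin n → S) →ₗ[S] P),
      i ∘ₗ f ∘ₗ r + (LinearMap.id - i ∘ₗ r) = LinearMap.id + i ∘ₗ (f - LinearMap.id) ∘ₗ r := by
    intro n i r
    ext x
    simp [LinearMap.sub_apply]
    ring
  have hex : ∃ d : S, ∃ (n : ℕ) (i : P →ₗ[S] (Fin n → S)) (r : (Fin n → S) →ₗ[S] P),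
    r ∘ₗ i = LinearMap.id ∧ d = LinearMap.det (i ∘ₗ f ∘ₗ r + (LinearMap.id - i ∘ₗ r)) :=
    ⟨_, n, i, r, h, rfl⟩
  obtain ⟨n', i', r', h', hd⟩ := Classical.epsilon_spec hex
  unfold detProj
  rw [hd, key]
  have h1 : i' ∘ₗ (f - LinearMap.id) ∘ₗ r' =
      (i' ∘ₗ r) ∘ₗ (i ∘ₗ (f - LinearMap.id) ∘ₗ r') := by
    ext x j
    have := fun y => LinearMap.congr_fun h y
    simp only [LinearMap.comp_apply, LinearMap.id_apply] at this ⊢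
    rw [this]
  have h2 : i ∘ₗ (f - LinearMap.id) ∘ₗ r =
      (i ∘ₗ (f - LinearMap.id) ∘ₗ r') ∘ₗ (i' ∘ₗ r) := by
    ext x j
    have := fun y => LinearMap.congr_fun h' y
    simp only [LinearMap.comp_apply, LinearMap.id_apply] at this ⊢
    rw [this]
  rw [h1, h2, det_id_add_comp_comm]

/-- The Weinstein–Aronszajn identity between a projective and a free module. -/
lemma detProj_id_add_comp_of_free [Module.Finite S P] [Module.Projective S P] {n : ℕ}
    (Y : (Fin n → S) →ₗ[S] P) (X : P →ₗ[S] (Fin n → S)) :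
    detProj (LinearMap.id + Y ∘ₗ X) = LinearMap.det (LinearMap.id + X ∘ₗ Y) := by
  obtain ⟨m, i, r, h⟩ := exists_presentation S P
  rw [detProj_eq h, add_sub_cancel_left]
  have h1 : i ∘ₗ (Y ∘ₗ X) ∘ₗ r = (i ∘ₗ Y) ∘ₗ (X ∘ₗ r) := rfl
  rw [h1, det_id_add_comp_comm]
  congr 2
  rw [LinearMap.comp_assoc, ← LinearMap.comp_assoc Y i r, h, LinearMap.id_comp]

/-- The Weinstein–Aronszajn identity for linear maps between projective modules. -/
lemma detProj_id_add_comp_comm [Module.Finite S P] [Module.Projective S P]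
    [Module.Finite S Q] [Module.Projective S Q] (Y : Q →ₗ[S] P) (X : P →ₗ[S] Q) :
    detProj (LinearMap.id + Y ∘ₗ X) = detProj (LinearMap.id + X ∘ₗ Y) := by
  obtain ⟨m, i, r, h⟩ := exists_presentation S Q
  have h1 : Y ∘ₗ X = (Y ∘ₗ r) ∘ₗ (i ∘ₗ X) := by
    rw [LinearMap.comp_assoc, ← LinearMap.comp_assoc X i r, h, LinearMap.id_comp]
  rw [h1, detProj_id_add_comp_of_free, detProj_eq h, add_sub_cancel_left]
  rfl

lemma detProj_mul [Module.Finite S P] [Module.Projective S P] (f g : P →ₗ[S] P) :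
    detProj (f ∘ₗ g) = detProj f * detProj g := by
  obtain ⟨m, i, r, h⟩ := exists_presentation S P
  rw [detProj_eq h, detProj_eq h, detProj_eq h, ← LinearMap.det_comp]
  congr 1
  ext x j
  have := fun y => LinearMap.congr_fun h y
  simp only [LinearMap.comp_apply, LinearMap.id_apply] at this
  simp [this]
  ring

lemma detProj_id [Module.Finite S P] [Module.Projective S P] :
    detProj (LinearMap.id : P →ₗ[S] P) = 1 := by
  obtain ⟨m, i, r, h⟩ := exists_presentation S P
  rw [detProj_eq h, sub_self, LinearMap.zero_comp, LinearMap.comp_zero, add_zero, LinearMap.det_id]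

/-- The determinant is multiplicative along a split exact sequence `0 → P' → P → P'' → 0`. -/
lemma detProj_of_exact {P' P'' : Type*} [AddCommGroup P'] [Module S P'] [AddCommGroup P'']
    [Module S P''] [Module.Finite S P] [Module.Projective S P] [Module.Finite S P']
    [Module.Projective S P'] [Module.Finite S P''] [Module.Projective S P'']
    {a : P' →ₗ[S] P} {p : P →ₗ[S] P'} (hpa : p ∘ₗ a = LinearMap.id)
    {b : P →ₗ[S] P''} {s : P'' →ₗ[S] P} (hbs : b ∘ₗ s = LinearMap.id)
    (hadd : a ∘ₗ p + s ∘ₗ b = LinearMap.id)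
    {f : P →ₗ[S] P} {f' : P' →ₗ[S] P'} {f'' : P'' →ₗ[S] P''}
    (h' : f ∘ₗ a = a ∘ₗ f') (h'' : b ∘ₗ f = f'' ∘ₗ b) :
    detProj f = detProj f' * detProj f'' := by
  have e1 : ∀ x, p (a x) = x := fun x => LinearMap.congr_fun hpa x
  have e2 : ∀ x, b (s x) = x := fun x => LinearMap.congr_fun hbs x
  have e3 : ∀ x, a (p x) + s (b x) = x := fun x => LinearMap.congr_fun hadd x
  have e4 : ∀ x, f (a x) = a (f' x) := fun x => LinearMap.congr_fun h' x
  have e5 : ∀ x, b (f x) = f'' (b x) := fun x => LinearMap.congr_fun h'' x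
  have e6 : ∀ x, b (a x) = 0 := fun x => by
    have := congrArg b (e3 (a x))
    rw [map_add, e2, e1] at this
    exact left_eq_add.1 this.symm |>.trans rfl
  have hf : f = (LinearMap.id + (f ∘ₗ s - s) ∘ₗ b) ∘ₗ
      (LinearMap.id + a ∘ₗ ((f' - LinearMap.id) ∘ₗ p)) := by
    ext x
    have h1 : f x = f (a (p x)) + f (s (b x)) := by rw [← map_add, e3]
    have h2 : b (x + a (f' (p x) - p x)) = b x := by rw [map_add, e6, add_zero]
    have h3 : s (b x) = x - a (p x) := eq_sub_of_add_eq' (e3 x)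
    simp only [LinearMap.comp_apply, LinearMap.add_apply, LinearMap.id_apply, LinearMap.sub_apply]
    rw [h2, h1, e4, map_sub]
    generalize f (s (b x)) = u
    rw [h3]
    abel
  have g1 : LinearMap.id + ((f' - LinearMap.id) ∘ₗ p) ∘ₗ a = f' := by
    ext x
    simp [e1]
  have g2 : LinearMap.id + b ∘ₗ (f ∘ₗ s - s) = f'' := by
    ext x
    simp [e2, e5]
  rw [hf, detProj_mul, detProj_id_add_comp_comm, g2, detProj_id_add_comp_comm a, g1, mul_comm]

end DetProj

/-! ### Fitting ideals of cokernels of square matrices -/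

section Fitting

open Matrix

/-- The Fitting ideal of the cokernel of a square matrix (whose rows are the relations) is
generated by its determinant. -/
lemma fitt_eq_span_det {S : Type*} [CommRing S] {N : Type*} [AddCommGroup N] [Module S N] {m : ℕ}
    (A : Matrix (Fin m) (Fin m) S) (ρ : (Fin m → S) →ₗ[S] N) (hρ : Function.Surjective ρ)
    (hker : ∀ v, ρ v = 0 ↔ ∃ w, v = w ᵥ* A) :
    fitt (S := S) N = Ideal.span {A.det} := by
  classical
  have hexp : ∀ v : Fin m → S, ρ v = ∑ j, v j • ρ (Pi.single j 1) := by
    intro v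
    conv_lhs => rw [pi_eq_sum_univ' v]
    simp [map_sum]
  apply le_antisymm
  · refine iSup_le fun n => iSup_le fun x => iSup_le fun hx => ?_
    rw [Ideal.span_le]
    rintro d ⟨a, ha, rfl⟩
    choose C hC using fun j => hρ (x j)
    -- expressions of the generators of the presentation in the generators `x`
    have hE : ∀ l : Fin m, ∃ c : Fin n → S, ∑ j, c j • x j = ρ (Pi.single l 1) := fun l => by
      have : ρ (Pi.single l 1) ∈ Submodule.span S (Set.range x) := hx ▸ Submodule.mem_top
      rwa [Submodule.mem_span_range_iff_exists_fun] at this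
    choose E hE using hE
    have hD : ∀ i : Fin n, ∃ w, (∑ j, a i j • C j) = w ᵥ* A := fun i => by
      rw [← hker, map_sum, ← ha i]
      simp [hC]
    choose D hD using hD
    have hF : ∀ l : Fin m, ∃ w, Pi.single l 1 - ∑ j, E l j • C j = w ᵥ* A := fun l => by
      rw [← hker, map_sub, map_sum, ← hE l]
      simp [hC]
    choose F hF using hF
    have h1 : a * of C = of D * A := by
      ext i l
      have := congrFun (hD i) l
      simpa [Matrix.mul_apply, Matrix.vecMul, dotProduct] using this
    have h2 : 1 - of E * of C = of F * A := by
      ext i l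
      have := congrFun (hF i) l
      simpa [Matrix.mul_apply, Matrix.vecMul, dotProduct, Matrix.one_apply, Pi.single_apply,
        eq_comm] using this
    have h3 : Matrix.fromBlocks a 0 (-(of E)) 1 * Matrix.fromBlocks 1 (of C) 0 1 =
        Matrix.fromBlocks a (of D) (-(of E)) (of F) * Matrix.fromBlocks 1 0 0 A := by
      rw [Matrix.fromBlocks_multiply, Matrix.fromBlocks_multiply]
      congr 1
      · simp
      · simpa using h1
      · simp
      · rw [Matrix.mul_one, Matrix.mul_zero, zero_add, ← h2, Matrix.neg_mul]
        simp [sub_eq_neg_add]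
    have h4 := congrArg Matrix.det h3
    rw [Matrix.det_mul, Matrix.det_mul, Matrix.det_fromBlocks_zero₁₂,
      Matrix.det_fromBlocks_zero₂₁, Matrix.det_fromBlocks_zero₂₁] at h4
    simp only [Matrix.det_one, mul_one, one_mul] at h4
    rw [SetLike.mem_coe, Ideal.mem_span_singleton, h4]
    exact dvd_mul_left _ _
  · rw [Ideal.span_singleton_le_iff_mem]
    refine Submodule.mem_iSup_of_mem m (Submodule.mem_iSup_of_mem (fun j => ρ (Pi.single j 1))
      (Submodule.mem_iSup_of_mem ?_ (Ideal.subset_span ⟨A, fun i => ?_, rfl⟩)))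
    · rw [eq_top_iff]
      rintro y -
      obtain ⟨v, rfl⟩ := hρ y
      rw [hexp]
      exact Submodule.sum_mem _ fun j _ => Submodule.smul_mem _ _ (Submodule.subset_span ⟨j, rfl⟩)
    · rw [← hexp (fun j => A i j), hker]
      exact ⟨Pi.single i 1, by ext; simp⟩

end Fitting

/-! ### Projective modules over the group ring of a finite group -/

section GroupRing

variable {k : Type u} [Field k] {G : Type u} [CommGroup G] [Fintype G]
variable {M N : Type*} [AddCommGroup M] [Module (GrpRing k G) M]
  [AddCommGroup N] [Module (GrpRing k G) N]

/-- Higman's criterion: a module over `k[G]` is projective if its identity is the sum of the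
conjugates of some `k`-linear endomorphism. -/
lemma projective_of_sum_conj (f : M →+ M)
    (hf : ∀ (c : k) m, f (algebraMap k (GrpRing k G) c • m) = algebraMap k (GrpRing k G) c • f m)
    (h : ∀ m, ∑ g : G, (MonoidAlgebra.single g⁻¹ 1 : GrpRing k G) •
      f ((MonoidAlgebra.single g 1 : GrpRing k G) • m) = m) :
    Module.Projective (GrpRing k G) M := by
  let : Module k M := Module.compHom M (algebraMap k (GrpRing k G))
  have : IsScalarTower k (GrpRing k G) M := ⟨fun a r m => by
    change (a • r) • m = algebraMap k (GrpRing k G) a • r • m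
    rw [Algebra.smul_def, mul_smul]⟩
  let f' : M →ₗ[k] M := { f with map_smul' := hf }
  let q : (M →₀ GrpRing k G) →ₗ[GrpRing k G] M := Finsupp.linearCombination _ id
  have hq : Function.Surjective q := fun m => ⟨Finsupp.single m 1, by simp [q]⟩
  obtain ⟨s, hs⟩ := (q.restrictScalars k).exists_rightInverse_of_surjective
    (LinearMap.range_eq_top.2 hq)
  refine Module.Projective.of_split (LinearMap.sumOfConjugatesEquivariant G (s ∘ₗ f')) q ?_
  ext m
  have hs' : ∀ x, q (s x) = x := fun x => LinearMap.congr_fun hs x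
  simp only [LinearMap.comp_apply, LinearMap.sumOfConjugatesEquivariant_apply,
    map_sum, LinearMap.conjugate_apply, map_smul, hs',
    LinearMap.id_apply]
  exact h m

/-- A projective module over the group ring of a finite group is relatively injective: it is a
direct summand of every module that contains it. -/
lemma exists_retraction [Module.Projective (GrpRing k G) N] (i : N →ₗ[GrpRing k G] M)
    (hi : Function.Injective i) : ∃ r : M →ₗ[GrpRing k G] N, r ∘ₗ i = LinearMap.id := by
  let : Module k M := Module.compHom M (algebraMap k (GrpRing k G))
  have : IsScalarTower k (GrpRing k G) M := ⟨fun a r m => by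
    change (a • r) • m = algebraMap k (GrpRing k G) a • r • m
    rw [Algebra.smul_def, mul_smul]⟩
  let : Module k N := Module.compHom N (algebraMap k (GrpRing k G))
  have : IsScalarTower k (GrpRing k G) N := ⟨fun a r m => by
    change (a • r) • m = algebraMap k (GrpRing k G) a • r • m
    rw [Algebra.smul_def, mul_smul]⟩
  -- on a free module the projection to the coefficient of `1` has the identity as sum of conjugates
  obtain ⟨s, hs⟩ := (Module.projective_def (R := GrpRing k G) (P := N)).1 inferInstance
  let c : GrpRing k G →ₗ[k] GrpRing k G :=
    { toFun := fun x => MonoidAlgebra.single 1 (x.coeff 1)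
      map_add' := fun x y => by simp [MonoidAlgebra.single_add]
      map_smul' := fun a x => by simp }
  obtain ⟨p, hp⟩ := (i.restrictScalars k).exists_leftInverse_of_injective
    (LinearMap.ker_eq_bot.2 hi)
  let q : (N →₀ GrpRing k G) →ₗ[GrpRing k G] N := Finsupp.linearCombination _ id
  let f : N →ₗ[k] N := q.restrictScalars k ∘ₗ Finsupp.mapRange.linearMap c ∘ₗ s.restrictScalars k
  refine ⟨LinearMap.sumOfConjugatesEquivariant G (f ∘ₗ p), ?_⟩
  ext n
  have hp' : ∀ x, p (i x) = x := fun x => LinearMap.congr_fun hp x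
  simp only [LinearMap.comp_apply, LinearMap.sumOfConjugatesEquivariant_apply,
    LinearMap.conjugate_apply, ← map_smul i, hp',
    LinearMap.id_apply, f, LinearMap.restrictScalars_apply]
  simp only [← map_smul q, ← map_sum]
  conv_rhs => rw [← hs n]
  congr 1
  simp only [map_smul s]
  have key : ∀ x : GrpRing k G, ∑ g : G, (MonoidAlgebra.single g⁻¹ 1 : GrpRing k G) *
      c ((MonoidAlgebra.single g 1 : GrpRing k G) * x) = x := by
    intro x
    change ∑ g : G, (MonoidAlgebra.single g⁻¹ 1 : GrpRing k G) *
      MonoidAlgebra.single 1 (((MonoidAlgebra.single g 1 : GrpRing k G) * x).coeff 1) = x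
    rw [← Equiv.sum_comp (Equiv.inv G)]
    ext g
    simp [MonoidAlgebra.coeff_sum, MonoidAlgebra.single_mul_single, MonoidAlgebra.coeff_single]
  ext n' : 1
  simpa [Finsupp.finsetSum_apply] using key (s n n')

lemma projective_quotient (P : Submodule (GrpRing k G) M) [Module.Projective (GrpRing k G) M]
    [Module.Projective (GrpRing k G) P] : Module.Projective (GrpRing k G) (M ⧸ P) := by
  obtain ⟨r, hr⟩ := exists_retraction P.subtype P.injective_subtype
  have hr' : ∀ x : P, r x = x := fun x => LinearMap.congr_fun hr x
  refine Module.Projective.of_split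
    (P.liftQ (LinearMap.id - P.subtype ∘ₗ r) fun x hx => ?_) P.mkQ ?_
  · simp [hr' ⟨x, hx⟩]
  · ext x
    simp

lemma projective_of_quotient {S M : Type*} [Ring S] [AddCommGroup M] [Module S M]
    (P : Submodule S M) [Module.Projective S M]
    [Module.Projective S (M ⧸ P)] : Module.Projective S P := by
  obtain ⟨s, hs⟩ := P.mkQ.exists_rightInverse_of_surjective P.range_mkQ
  have hs' : ∀ x, P.mkQ (s x) = x := fun x => LinearMap.congr_fun hs x
  refine Module.Projective.of_split P.subtype
    (LinearMap.codRestrict P (LinearMap.id - s ∘ₗ P.mkQ) fun x => ?_) ?_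
  · rw [← Submodule.Quotient.mk_eq_zero, ← Submodule.mkQ_apply]
    simp only [LinearMap.sub_apply, map_sub, LinearMap.comp_apply, hs', LinearMap.id_apply, sub_self]
  · ext x
    simp [(Submodule.Quotient.mk_eq_zero P).2 x.2]

end GroupRing

/-! ### Laurent series over the group ring and monic elements -/

section Laurent

/-- Laurent series over `R = k[G]` in the variable `t⁻¹`. -/
abbrev LRing (k : Type u) [Field k] (G : Type u) [CommGroup G] : Type u :=
  LaurentSeries (GrpRing k G)

variable (k : Type u) [Field k] (G : Type u) [CommGroup G]

/-- The embedding `k((t⁻¹)) → R((t⁻¹))`. -/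
def kinfToL [Finite k] : KInf k →+* LRing k G where
  toFun f := HahnSeries.map (Γ := ℤ) (R := k) f (algebraMap k (GrpRing k G))
  map_one' := HahnSeries.map_one (algebraMap k (GrpRing k G)).toMonoidWithZeroHom
  map_zero' := HahnSeries.ext (funext fun _ => map_zero (algebraMap k (GrpRing k G)))
  map_mul' _ _ := HahnSeries.map_mul ((algebraMap k (GrpRing k G)) : k →ₙ+* GrpRing k G)
  map_add' _ _ := HahnSeries.map_add (algebraMap k (GrpRing k G)).toAddMonoidHom

/-- The identification of `k((t⁻¹))[G]` with a subring of `R((t⁻¹))`, as a ring homomorphism. -/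
def bigToLHom [Finite k] : BigRing k G →+* LRing k G :=
  MonoidAlgebra.liftNCRingHom (kinfToL k G)
    ((HahnSeries.C : GrpRing k G →+* LRing k G).toMonoidHom.comp (MonoidAlgebra.of k G))
    fun _ _ => Commute.all _ _

variable {k G}

lemma lcoeff_add (f g : KInf k) (i : ℤ) [Finite k] : lcoeff (f + g) i = lcoeff f i + lcoeff g i :=
  HahnSeries.coeff_add (x := (f : LaurentSeries k)) (y := g) (a := i)

lemma lcoeff_zero (i : ℤ) [Finite k] : lcoeff (0 : KInf k) i = 0 := rfl

lemma lcoeff_sum [Finite k] {ι : Type*} (s : Finset ι) (f : ι → KInf k) (i : ℤ) :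
    lcoeff (∑ j ∈ s, f j) i = ∑ j ∈ s, lcoeff (f j) i :=
  map_sum (⟨⟨fun f => lcoeff f i, lcoeff_zero i⟩, fun f g => lcoeff_add f g i⟩ : KInf k →+ k) f s

lemma KInf.ext {f g : KInf k} (h : ∀ i, lcoeff f i = lcoeff g i) : f = g :=
  HahnSeries.ext (funext h)

variable [Fintype G]

omit [CommGroup G] in
lemma coeff_sum_single {B : Type*} [Semiring B] (c : G → B) (g : G) :
    (∑ h, MonoidAlgebra.single h (c h) : MonoidAlgebra B G).coeff g = c g := by
  classical
  simp [MonoidAlgebra.coeff_sum, MonoidAlgebra.coeff_single, Finsupp.finsetSum_apply,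
    Finsupp.single_apply]

omit [CommGroup G] in
lemma coeff_coeffBig [Finite k] (x : BigRing k G) (i : ℤ) (g : G) :
    (coeffBig x i).coeff g = lcoeff (x.coeff g) i :=
  coeff_sum_single (fun g => lcoeff (x.coeff g) i) g

lemma coeff_bigToLHom [Finite k] (x : BigRing k G) (i : ℤ) :
    (bigToLHom k G x).coeff i = coeffBig x i := by
  induction x using MonoidAlgebra.induction_linear with
  | zero =>
    ext g
    rw [coeff_coeffBig, map_zero]
    rfl
  | add x y hx hy =>
    ext g
    rw [map_add, HahnSeries.coeff_add, hx, hy, coeff_coeffBig, MonoidAlgebra.coeff_add,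
      MonoidAlgebra.coeff_add, Finsupp.add_apply, Finsupp.add_apply, lcoeff_add, coeff_coeffBig,
      coeff_coeffBig]
  | single g c =>
    classical
    ext h
    rw [coeff_coeffBig, bigToLHom, MonoidAlgebra.liftNCRingHom_single]
    change ((kinfToL k G c * HahnSeries.C (MonoidAlgebra.single g (1 : k)) : LRing k G).coeff i).coeff h
      = _
    rw [HahnSeries.C_apply, HahnSeries.coeff_mul_single_zero]
    change (algebraMap k (GrpRing k G) (lcoeff c i) * MonoidAlgebra.of k G g).coeff h = _
    rw [← MonoidAlgebra.single_eq_algebraMap_mul_of, MonoidAlgebra.coeff_single,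
      MonoidAlgebra.coeff_single]
    by_cases hg : h = g
    · rw [hg, Finsupp.single_eq_same, Finsupp.single_eq_same]
    · rw [Finsupp.single_eq_of_ne hg, Finsupp.single_eq_of_ne hg, lcoeff_zero]

/-- The identification `k((t⁻¹))[G] = R((t⁻¹))`. -/
def bigToL (k : Type u) [Field k] [Finite k] (G : Type u) [CommGroup G] [Fintype G] :
    BigRing k G ≃+* LRing k G :=
  RingEquiv.ofBijective (bigToLHom k G) <| by
    constructor
    · intro x y h
      ext g
      refine KInf.ext fun i => ?_
      rw [← coeff_coeffBig, ← coeff_coeffBig, ← coeff_bigToLHom, ← coeff_bigToLHom, h]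
    · intro f
      let c : G → (GrpRing k G →+ k) := fun g => ⟨⟨fun x => x.coeff g, rfl⟩, fun _ _ => rfl⟩
      let d : G → KInf k := fun g => (HahnSeries.map f (c g) : LaurentSeries k)
      refine ⟨∑ g, MonoidAlgebra.single g (d g), ?_⟩
      ext i g
      rw [coeff_bigToLHom, coeff_coeffBig, coeff_sum_single d]
      rfl

lemma coeff_bigToL [Finite k] (x : BigRing k G) (i : ℤ) : (bigToL k G x).coeff i = coeffBig x i :=
  coeff_bigToLHom x i

lemma bigToL_evalT [Finite k] (f : (GrpRing k G)⟦X⟧) :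
    bigToL k G (evalT f) = HahnSeries.ofPowerSeries ℤ _ f := by
  ext i g
  rw [coeff_bigToL, coeff_coeffBig]
  let d : G → KInf k := fun g => (HahnSeries.ofPowerSeries ℤ k
    (PowerSeries.mk fun n => (PowerSeries.coeff n f).coeff g) : LaurentSeries k)
  have h : (evalT f).coeff g = d g := coeff_sum_single d g
  rw [h]
  change (HahnSeries.ofPowerSeries ℤ k _).coeff i = _
  rw [PowerSeries.coeff_coe, PowerSeries.coeff_coe]
  split_ifs <;> simp

end Laurent

section MonicLaurent

variable {R : Type*} [CommRing R]

/-- The embedding `R[t] → R((t⁻¹))`. -/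
def polyL (R : Type*) [CommRing R] : R[X] →+* LaurentSeries R :=
  Polynomial.eval₂RingHom HahnSeries.C (HahnSeries.single (-1 : ℤ) 1)

/-- The embedding `R[[t⁻¹]] → R((t⁻¹))`. -/
abbrev psL (R : Type*) [CommRing R] : R⟦X⟧ →+* LaurentSeries R := HahnSeries.ofPowerSeries ℤ R

/-- The power `t⁻ᵐ` in `R((t⁻¹))`. -/
abbrev uPow (R : Type*) [CommRing R] (m : ℤ) : LaurentSeries R := HahnSeries.single m 1

lemma uPow_add (m n : ℤ) : uPow R (m + n) = uPow R m * uPow R n := by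
  rw [uPow, uPow, uPow, HahnSeries.single_mul_single, one_mul]

lemma uPow_zero : uPow R 0 = 1 := rfl

lemma uPow_natCast (n : ℕ) : uPow R n = psL R (PowerSeries.X ^ n) := by
  rw [HahnSeries.ofPowerSeries_X_pow]

lemma uPow_mul_neg (m : ℤ) : uPow R m * uPow R (-m) = 1 := by
  rw [← uPow_add, add_neg_cancel, uPow_zero]

lemma uPow_pow (m : ℤ) (n : ℕ) : uPow R m ^ n = uPow R (n * m) := by
  rw [uPow, HahnSeries.single_pow, one_pow, nsmul_eq_mul]

lemma coeff_uPow_mul (m l : ℤ) (x : LaurentSeries R) :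
    (uPow R m * x).coeff l = x.coeff (l - m) := by
  rw [HahnSeries.coeff_single_mul, one_mul]

lemma coeff_C_mul (a : R) (x : LaurentSeries R) (l : ℤ) :
    ((HahnSeries.C a : LaurentSeries R) * x).coeff l = a * x.coeff l := by
  rw [HahnSeries.C_mul_eq_smul, HahnSeries.coeff_smul, smul_eq_mul]

lemma coeff_psL_natCast (p : R⟦X⟧) (n : ℕ) : (psL R p).coeff n = PowerSeries.coeff n p :=
  HahnSeries.ofPowerSeries_apply_coeff p n

lemma coeff_psL_of_neg (p : R⟦X⟧) {l : ℤ} (hl : l < 0) : (psL R p).coeff l = 0 := by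
  rw [PowerSeries.coeff_coe, if_pos hl]

lemma exists_eq_uPow_mul_psL {x : LaurentSeries R} {d : ℤ} (h : ∀ l < d, x.coeff l = 0) :
    ∃ p, x = uPow R d * psL R p := by
  refine ⟨PowerSeries.mk fun n => x.coeff (d + n), ?_⟩
  ext l
  rw [coeff_uPow_mul]
  obtain hl | hl := lt_or_ge l d
  · rw [h l hl, coeff_psL_of_neg _ (by omega)]
  · obtain ⟨n, hn⟩ := Int.eq_ofNat_of_zero_le (sub_nonneg.2 hl)
    rw [hn, coeff_psL_natCast, PowerSeries.coeff_mk]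
    congr 1
    omega

lemma polyL_C (a : R) : polyL R (Polynomial.C a) = HahnSeries.C a := by
  simp [polyL]

lemma polyL_X : polyL R Polynomial.X = uPow R (-1) := by
  simp [polyL]

lemma polyL_C_mul_X_pow (a : R) (n : ℕ) :
    polyL R (Polynomial.C a * Polynomial.X ^ n) = HahnSeries.single (-(n : ℤ)) a := by
  rw [map_mul, map_pow, polyL_C, polyL_X, uPow_pow, HahnSeries.C_apply,
    HahnSeries.single_mul_single]
  simp

lemma coeff_polyL (p : R[X]) (n : ℕ) : (polyL R p).coeff (-(n : ℤ)) = p.coeff n := by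
  induction p using Polynomial.induction_on' with
  | add p q hp hq => rw [map_add, HahnSeries.coeff_add, hp, hq, Polynomial.coeff_add]
  | monomial m a =>
    rw [← Polynomial.C_mul_X_pow_eq_monomial, polyL_C_mul_X_pow, Polynomial.coeff_C_mul_X_pow,
      HahnSeries.coeff_single]
    simp

lemma coeff_polyL_of_pos (p : R[X]) {l : ℤ} (hl : 0 < l) : (polyL R p).coeff l = 0 := by
  induction p using Polynomial.induction_on' with
  | add p q hp hq => rw [map_add, HahnSeries.coeff_add, hp, hq, add_zero]
  | monomial m a =>
    rw [← Polynomial.C_mul_X_pow_eq_monomial, polyL_C_mul_X_pow, HahnSeries.coeff_single_of_ne]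
    omega

lemma polyL_injective : Function.Injective (polyL R) := fun p q h => by
  ext n
  rw [← coeff_polyL, ← coeff_polyL, h]

/-- Monic elements of `R((t⁻¹))`: on each component `eR`, with `e` a primitive idempotent, they have
the form `tⁿ (1 + t⁻¹ y)` with `y` a power series in `t⁻¹`. -/
def LMonic (x : LaurentSeries R) : Prop :=
  ∀ e : R, IsPrimIdem e → ∃ (n : ℤ) (p : R⟦X⟧), PowerSeries.constantCoeff p = 1 ∧
    HahnSeries.C e * x = uPow R (-n) * (HahnSeries.C e * psL R p)

lemma lMonic_iff {x : LaurentSeries R} : LMonic x ↔ ∀ e : R, IsPrimIdem e →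
    ∃ n : ℤ, e * x.coeff (-n) = e ∧ ∀ i : ℤ, i < -n → e * x.coeff i = 0 := by
  refine forall₂_congr fun e he => exists_congr fun n => ⟨?_, ?_⟩
  · rintro ⟨p, hp, h⟩
    have hc : ∀ l, e * x.coeff l = e * (psL R p).coeff (l + n) := fun l => by
      have := congrArg (fun z : LaurentSeries R => z.coeff l) h
      simpa only [coeff_C_mul, coeff_uPow_mul, sub_neg_eq_add] using this
    refine ⟨?_, fun i hi => ?_⟩
    · rw [hc, neg_add_cancel, ← Int.natCast_zero, coeff_psL_natCast,
        PowerSeries.coeff_zero_eq_constantCoeff_apply, hp, mul_one]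
    · rw [hc, coeff_psL_of_neg _ (by omega), mul_zero]
  · rintro ⟨h0, hneg⟩
    obtain ⟨p, hp⟩ := exists_eq_uPow_mul_psL (x := HahnSeries.C e * x) (d := -n)
      fun l hl => by rw [coeff_C_mul, hneg l hl]
    have hc : ∀ l, e * x.coeff l = (psL R p).coeff (l + n) := fun l => by
      have := congrArg (fun z : LaurentSeries R => z.coeff l) hp
      simpa only [coeff_C_mul, coeff_uPow_mul, sub_neg_eq_add] using this
    have hp0 : PowerSeries.constantCoeff p = e := by
      have := hc (-n)
      rwa [neg_add_cancel, ← Int.natCast_zero, coeff_psL_natCast,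
        PowerSeries.coeff_zero_eq_constantCoeff_apply, h0, eq_comm] at this
    refine ⟨p + PowerSeries.C (1 - e), by simp [hp0], ?_⟩
    have hee : (HahnSeries.C e : LaurentSeries R) * HahnSeries.C e = HahnSeries.C e := by
      rw [← map_mul, he.1.eq]
    have hee' : (HahnSeries.C e : LaurentSeries R) * HahnSeries.C (1 - e) = 0 := by
      rw [map_sub, map_one, mul_sub, mul_one, hee, sub_self]
    rw [map_add, HahnSeries.ofPowerSeries_C]
    linear_combination (-x) * hee + HahnSeries.C e * hp - uPow R (-n) * hee'

lemma isUnit_of_constantCoeff_eq_one {p : R⟦X⟧} (hp : PowerSeries.constantCoeff p = 1) :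
    IsUnit p := PowerSeries.isUnit_iff_constantCoeff.2 (hp ▸ isUnit_one)

lemma LMonic.mul {x y : LaurentSeries R} (hx : LMonic x) (hy : LMonic y) : LMonic (x * y) := by
  intro e he
  obtain ⟨n, p, hp, h⟩ := hx e he
  obtain ⟨m, q, hq, h'⟩ := hy e he
  refine ⟨n + m, p * q, by simp [hp, hq], ?_⟩
  have hee : (HahnSeries.C e : LaurentSeries R) * HahnSeries.C e = HahnSeries.C e := by
    rw [← map_mul, he.1.eq]
  rw [neg_add, uPow_add, map_mul, ← hee]
  linear_combination (HahnSeries.C e * y) * h + (uPow R (-n) * (HahnSeries.C e * psL R p)) * h'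

lemma LMonic.of_mul_eq_one {x y : LaurentSeries R} (hx : LMonic x) (hxy : x * y = 1) :
    LMonic y := by
  intro e he
  obtain ⟨n, p, hp, h⟩ := hx e he
  obtain ⟨u, rfl⟩ := isUnit_of_constantCoeff_eq_one hp
  refine ⟨-n, (u⁻¹ : R⟦X⟧ˣ), ?_, ?_⟩
  · have := congrArg PowerSeries.constantCoeff u.mul_inv
    rwa [map_mul, hp, one_mul, map_one] at this
  have hu : psL R u * psL R (u⁻¹ : R⟦X⟧ˣ) = 1 := by rw [← map_mul, u.mul_inv, map_one]
  have hn := uPow_mul_neg (R := R) n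
  rw [neg_neg]
  linear_combination (uPow R n * psL R (u⁻¹ : R⟦X⟧ˣ) * HahnSeries.C e) * hxy
    - (uPow R n * psL R (u⁻¹ : R⟦X⟧ˣ) * y) * h
    - (HahnSeries.C e * y) * hn - (HahnSeries.C e * y * (uPow R n * uPow R (-n))) * hu

lemma lMonic_uPow_mul_psL (m : ℤ) {p : R⟦X⟧} (hp : PowerSeries.constantCoeff p = 1) :
    LMonic (uPow R m * psL R p) := fun e _ => ⟨-m, p, hp, by rw [neg_neg]; ring⟩

/-- In a finite ring, an element killed by all primitive idempotents is zero. -/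
lemma eq_zero_of_isPrimIdem_mul [Finite R] {x : R} (h : ∀ e : R, IsPrimIdem e → e * x = 0) :
    x = 0 := by
  by_contra hx
  -- an idempotent `f` with `f x ≠ 0` for which the ideal `f R` is minimal is primitive
  let s : Set R := {f | IsIdempotentElem f ∧ f * x ≠ 0}
  have hs : s.Nonempty := ⟨1, IsIdempotentElem.one, by simpa using hx⟩
  obtain ⟨f, ⟨hf, hfx⟩, hmin⟩ := Set.exists_min_image s
    (fun f => Nat.card (Ideal.span {f})) (Set.toFinite s) hs
  refine hfx (h f ⟨hf, fun h0 => hfx (by rw [h0, zero_mul]), fun g hg hgf => ?_⟩)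
  -- a smaller idempotent `g` with `g x ≠ 0` equals `f`
  have key : ∀ g : R, IsIdempotentElem g → g * f = g → g * x ≠ 0 → g = f := by
    intro g hg hgf hgx
    have hle : Ideal.span {g} ≤ Ideal.span {f} := by
      rw [Ideal.span_singleton_le_iff_mem, Ideal.mem_span_singleton]
      exact ⟨g, by rw [mul_comm, hgf]⟩
    have heq : (Ideal.span {g} : Set R) = Ideal.span {f} :=
      Set.eq_of_subset_of_ncard_le hle (hmin g ⟨hg, hgx⟩) (Set.toFinite _)
    have hmem : f ∈ Ideal.span {g} := by
      have := Ideal.mem_span_singleton_self f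
      rwa [← SetLike.mem_coe, ← heq] at this
    obtain ⟨c, hc⟩ := Ideal.mem_span_singleton.1 hmem
    calc g = g * f := hgf.symm
      _ = g * g * c := by rw [hc, mul_assoc]
      _ = f := by rw [hg.eq, hc]
  by_cases hgx : g * x = 0
  · left
    have h2 := key (f - g) (by
      change (f - g) * (f - g) = f - g
      linear_combination hf.eq + hg.eq - 2 * hgf) (by linear_combination hf.eq - hgf) (by
      rw [sub_mul, hgx, sub_zero]; exact hfx)
    linear_combination -h2
  · exact Or.inr (key g hg hgf hgx)

/-- A monic unit of `R[t]` is trivial. -/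
lemma eq_one_of_lMonic_of_isUnit [Finite R] {v : R[X]} (hv : IsUnit v) (hm : LMonic (polyL R v)) :
    v = 1 := by
  obtain ⟨v, rfl⟩ := hv
  have hm' : LMonic (polyL R (v⁻¹ : R[X]ˣ)) :=
    hm.of_mul_eq_one (by rw [← map_mul, v.mul_inv, map_one])
  rw [lMonic_iff] at hm hm'
  rw [← sub_eq_zero]
  ext i
  refine eq_zero_of_isPrimIdem_mul fun e he => ?_
  obtain ⟨n, hn, hn'⟩ := hm e he
  obtain ⟨m, hm, hm'⟩ := hm' e he
  have hpos : ∀ (p : R[X]) (n : ℤ), e * (polyL R p).coeff (-n) = e → 0 ≤ n := by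
    intro p n h
    by_contra hlt
    rw [coeff_polyL_of_pos p (by omega), mul_zero] at h
    exact he.2.1 h.symm
  lift n to ℕ using hpos _ _ hn
  lift m to ℕ using hpos _ _ hm
  rw [coeff_polyL] at hn hm
  have hbig : ∀ (p : R[X]) (n : ℕ), (∀ i < -(n : ℤ), e * (polyL R p).coeff i = 0) →
      ∀ i, n < i → e * p.coeff i = 0 := fun p n h i hi => by
    rw [← coeff_polyL]
    exact h _ (by omega)
  replace hn' := hbig _ _ hn'
  replace hm' := hbig _ _ hm'
  -- compare the coefficients of degree `n + m` in `v v⁻¹ = 1`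
  have hnm : n + m = 0 := by
    by_contra hne
    have h1 := congrArg (fun p : R[X] => e * p.coeff (n + m)) v.mul_inv
    simp only [Polynomial.coeff_one, hne, if_false, mul_zero] at h1
    rw [Polynomial.coeff_mul, Finset.mul_sum, Finset.sum_eq_single (n, m)] at h1
    · simp only at h1
      rw [← mul_assoc, hn, hm] at h1
      exact he.2.1 h1
    · rintro ⟨a, b⟩ hab hne
      rw [Finset.HasAntidiagonal.mem_antidiagonal] at hab
      simp only at hab ⊢
      obtain h | h := lt_or_ge n a
      · rw [← mul_assoc, hn' a h, zero_mul]
      · have : m < b := by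
          rcases h.lt_or_eq with h | h
          · omega
          · exfalso
            exact hne (by ext <;> simp <;> omega)
        rw [mul_left_comm, hm' b this, mul_zero]
    · intro h
      exact absurd (Finset.HasAntidiagonal.mem_antidiagonal.2
        (show (n, m).1 + (n, m).2 = n + m from rfl)) h
  obtain ⟨rfl, rfl⟩ : n = 0 ∧ m = 0 := by omega
  rw [Polynomial.coeff_sub, Polynomial.coeff_one, mul_sub]
  split_ifs with h0
  · rw [h0, hn, mul_one, sub_self]
  · rw [hn' i (by omega), mul_zero, sub_zero]

/-- Two monic elements which differ by a unit of `R[t]` are equal. -/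
lemma LMonic.eq_of_eq_mul_unit [Finite R] {x y : LaurentSeries R} (hx : LMonic x) (hy : LMonic y)
    (hu : IsUnit y) {v : R[X]} (hv : IsUnit v) (h : x = y * polyL R v) : x = y := by
  obtain ⟨u, rfl⟩ := hu
  have h1 : polyL R v = (u⁻¹ : (LaurentSeries R)ˣ) * x := by
    rw [h, ← mul_assoc, u.inv_mul, one_mul]
  have : LMonic (polyL R v) := h1 ▸ (hy.of_mul_eq_one u.mul_inv).mul hx
  rw [h, eq_one_of_lMonic_of_isUnit hv this, map_one, mul_one]

end MonicLaurent

/-! ### Determinants after extension of scalars -/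

section BaseChange

variable {R : Type*} [CommRing R] {P : Type*} [AddCommGroup P] [Module R P] {m : ℕ}

/-- The matrix over `S` of an endomorphism of `S ⊗ P`, extended by zero to a free module of which
`P` is a direct summand. -/
def presMatrix (S : Type*) [CommRing S] [Algebra R S] (i : P →ₗ[R] (Fin m → R))
    (r : (Fin m → R) →ₗ[R] P) :
    Module.End S (S ⊗[R] P) →ₗ[S] Matrix (Fin m) (Fin m) S where
  toFun F := LinearMap.toMatrix' ((TensorProduct.piScalarRight R S S (Fin m)).toLinearMap ∘ₗ
    i.baseChange S ∘ₗ F ∘ₗ r.baseChange S ∘ₗ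
      (TensorProduct.piScalarRight R S S (Fin m)).symm.toLinearMap)
  map_add' F F' := by
    rw [LinearMap.add_comp, LinearMap.comp_add, LinearMap.comp_add, map_add]
  map_smul' c F := by
    rw [LinearMap.smul_comp, LinearMap.comp_smul, LinearMap.comp_smul, map_smul, RingHom.id_apply]

variable {S : Type*} [CommRing S] [Algebra R S]

lemma presMatrix_baseChange (i : P →ₗ[R] (Fin m → R)) (r : (Fin m → R) →ₗ[R] P)
    (φ : Module.End R P) : presMatrix S i r (φ.baseChange S) =
      (LinearMap.toMatrix' (i ∘ₗ φ ∘ₗ r)).map (algebraMap R S) := by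
  ext a b
  have : (TensorProduct.piScalarRight R S S (Fin m)).symm (Pi.single b 1) =
      (1 : S) ⊗ₜ[R] (Pi.single b 1 : Fin m → R) := by
    rw [LinearEquiv.symm_apply_eq]
    ext j
    by_cases h : j = b
    · subst h; simp
    · simp [h]
  simp only [presMatrix, LinearMap.coe_mk, AddHom.coe_mk, LinearMap.toMatrix'_apply,
    LinearMap.comp_apply, LinearEquiv.coe_coe, Matrix.map_apply]
  rw [this]
  simp [Algebra.smul_def]

lemma detProj_baseChange {i : P →ₗ[R] (Fin m → R)} {r : (Fin m → R) →ₗ[R] P}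
    (h : r ∘ₗ i = LinearMap.id) (F : Module.End S (S ⊗[R] P)) :
    detProj F = (1 + presMatrix S i r (F - LinearMap.id)).det := by
  rw [detProj_eq (i := (TensorProduct.piScalarRight R S S (Fin m)).toLinearMap ∘ₗ i.baseChange S)
    (r := r.baseChange S ∘ₗ (TensorProduct.piScalarRight R S S (Fin m)).symm.toLinearMap)]
  · rw [← LinearMap.det_toMatrix', map_add, LinearMap.toMatrix'_id]
    rfl
  · have h2 : r.baseChange S ∘ₗ i.baseChange S = LinearMap.id := by
      rw [← LinearMap.baseChange_comp, h, LinearMap.baseChange_id]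
    refine LinearMap.ext fun x => ?_
    simp only [LinearMap.comp_apply, LinearEquiv.coe_coe, LinearEquiv.symm_apply_apply]
    exact LinearMap.congr_fun h2 x

end BaseChange

/-! ### The rank polynomial of an idempotent matrix -/

section Idempotent

variable {R : Type*} [CommRing R] {m : ℕ}

open Matrix Polynomial

/-- The polynomial `det (X π + 1 - π)`, which is `X ^ n` where the idempotent matrix `π` has
rank `n`. -/
def rankPoly (π : Matrix (Fin m) (Fin m) R) : R[X] :=
  ((X : R[X]) • π.map C + (1 - π.map C)).det

lemma rankPoly_map_eq {S : Type*} [CommRing S] (f : R →+* S) (s : S)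
    (π : Matrix (Fin m) (Fin m) R) :
    (rankPoly π).eval₂ f s = (s • π.map f + (1 - π.map f)).det := by
  rw [← Polynomial.coe_eval₂RingHom, rankPoly, RingHom.map_det]
  congr 1
  ext a b
  simp [Matrix.one_apply, apply_ite (Polynomial.eval₂ f s), mul_comm s]

lemma smul_add_mul_smul_add {S : Type*} [CommRing S] {π : Matrix (Fin m) (Fin m) S}
    (hπ : π * π = π) (s s' : S) :
    (s • π + (1 - π)) * (s' • π + (1 - π)) = (s * s') • π + (1 - π) := by
  simp only [add_mul, mul_add, sub_mul, mul_sub, smul_mul_assoc, mul_smul_comm, hπ, one_mul, mul_one]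
  rw [sub_self, add_zero, smul_smul, mul_comm s' s]
  abel

variable {π : Matrix (Fin m) (Fin m) R}

/-- The coefficients of the rank polynomial are orthogonal idempotents. -/
lemma rankPoly_coeff_mul (hπ : π * π = π) (a b : ℕ) :
    (rankPoly π).coeff a * (rankPoly π).coeff b = if a = b then (rankPoly π).coeff b else 0 := by
  -- `det (X π + 1 - π) det (Y π + 1 - π) = det (X Y π + 1 - π)`
  have h : C (rankPoly π) * (rankPoly π).map C =
      (rankPoly π).eval₂ (C.comp C : R →+* R[X][X]) (C X * X) := by
    have h1 : C (rankPoly π) = (rankPoly π).eval₂ (C.comp C : R →+* R[X][X]) (C X) := by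
      conv_lhs => rw [← Polynomial.eval₂_C_X (p := rankPoly π)]
      rw [Polynomial.hom_eval₂]
    have h2 : (rankPoly π).map C = (rankPoly π).eval₂ (C.comp C : R →+* R[X][X]) X := rfl
    rw [h1, h2, rankPoly_map_eq, rankPoly_map_eq, rankPoly_map_eq, ← Matrix.det_mul,
      smul_add_mul_smul_add]
    rw [← Matrix.map_mul, hπ]
  have h2 := congrArg (fun p : R[X][X] => (p.coeff b).coeff a) h
  simp only [Polynomial.coeff_C_mul, Polynomial.coeff_map, Polynomial.coeff_mul_C] at h2
  rw [h2, Polynomial.eval₂_eq_sum_range, Polynomial.finsetSum_coeff, Polynomial.finsetSum_coeff]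
  have h3 : ∀ l, ((((C.comp C : R →+* R[X][X]) ((rankPoly π).coeff l) * (C X * X) ^ l).coeff b).coeff
      a) = if a = l ∧ b = l then (rankPoly π).coeff l else 0 := by
    intro l
    rw [RingHom.comp_apply, mul_pow, ← map_pow, ← mul_assoc, ← map_mul, Polynomial.coeff_C_mul,
      Polynomial.coeff_X_pow]
    split_ifs <;> simp_all [Polynomial.coeff_X_pow]
  rw [Finset.sum_congr rfl fun l _ => h3 l]
  split_ifs with hab
  · subst hab
    simp only [and_self, Finset.sum_ite_eq, Finset.mem_range]
    split_ifs with hlt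
    · rfl
    · rw [Polynomial.coeff_eq_zero_of_natDegree_lt (by omega)]
  · exact Finset.sum_eq_zero fun l _ => if_neg fun h => hab (h.1.trans h.2.symm)

lemma rankPoly_eval_one (π : Matrix (Fin m) (Fin m) R) : (rankPoly π).eval 1 = 1 := by
  have := rankPoly_map_eq (RingHom.id R) 1 π
  rw [Polynomial.eval, this]
  simp

/-- On a component `eR` exactly one coefficient of the rank polynomial is nonzero, and it equals
`e`. -/
lemma lMonic_rankPoly (hπ : π * π = π) : LMonic (polyL R (rankPoly π)) := by
  intro e he
  have hsum : ∑ l ∈ Finset.range ((rankPoly π).natDegree + 1), (rankPoly π).coeff l = 1 := by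
    rw [← rankPoly_eval_one π, Polynomial.eval_eq_sum_range]
    simp
  obtain ⟨n, hn⟩ : ∃ n, (rankPoly π).coeff n * e ≠ 0 := by
    by_contra! h
    apply he.2.1
    rw [← one_mul e, ← hsum, Finset.sum_mul]
    exact Finset.sum_eq_zero fun l _ => h l
  have hidem : (rankPoly π).coeff n * e = e := by
    refine (he.2.2 _ ?_ ?_).resolve_left hn
    · have := rankPoly_coeff_mul hπ n n
      rw [if_pos rfl] at this
      change _ * _ * (_ * _) = _
      rw [mul_mul_mul_comm, this, he.1.eq]
    · rw [mul_assoc, he.1.eq]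
  have hother : ∀ l, l ≠ n → (rankPoly π).coeff l * e = 0 := fun l hl => by
    rw [← hidem, ← mul_assoc, rankPoly_coeff_mul hπ, if_neg hl, zero_mul]
  refine ⟨n, 1, map_one _, ?_⟩
  have : C e * rankPoly π = C e * X ^ n := by
    ext l
    rw [Polynomial.coeff_C_mul, Polynomial.coeff_C_mul, Polynomial.coeff_X_pow, mul_comm]
    split_ifs with h
    · rw [h, hidem, mul_one]
    · rw [hother l h, mul_zero]
  rw [← polyL_C, ← map_mul, this, polyL_C_mul_X_pow, map_one, mul_one, polyL_C,
    HahnSeries.C_apply, HahnSeries.single_mul_single, one_mul, add_zero]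

/-- The inverse of `det (t π + 1 - π)` is `det (t⁻¹ π + 1 - π)`. -/
lemma isUnit_polyL_rankPoly (hπ : π * π = π) : IsUnit (polyL R (rankPoly π)) := by
  have hp : ∀ s, (s • π.map (HahnSeries.C : R →+* LaurentSeries R) + (1 - π.map HahnSeries.C)).det
    = (rankPoly π).eval₂ HahnSeries.C s := fun s => (rankPoly_map_eq _ _ _).symm
  refine IsUnit.of_mul_eq_one ((rankPoly π).eval₂ HahnSeries.C (uPow R 1)) ?_
  rw [polyL, Polynomial.coe_eval₂RingHom, ← hp, ← hp, ← Matrix.det_mul, smul_add_mul_smul_add,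
    ← uPow_add]
  · simp
  · rw [← Matrix.map_mul, hπ]

lemma constantCoeff_charpolyRev (A : Matrix (Fin m) (Fin m) R) :
    PowerSeries.constantCoeff (A.charpolyRev : R⟦X⟧) = 1 := by
  rw [Polynomial.constantCoeff_coe, Polynomial.coeff_zero_eq_eval_zero, Matrix.eval_charpolyRev]

/-- `det (X π - A + 1 - π) = det (X π + 1 - π) det (1 - X⁻¹ A)` if `A = π A`. -/
lemma polyL_det_eq {A : Matrix (Fin m) (Fin m) R} (hA : π * A = A) :
    polyL R (1 + ((X : R[X]) • π.map C - A.map C - π.map C)).det =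
      polyL R (rankPoly π) * psL R A.charpolyRev := by
  have h1 : psL R (A.charpolyRev : R⟦X⟧) = (1 - uPow R 1 • A.map (HahnSeries.C)).det := by
    have h : psL R (A.charpolyRev : R⟦X⟧) =
        ((psL R).comp Polynomial.coeToPowerSeries.ringHom) A.charpolyRev := rfl
    rw [h, Matrix.charpolyRev, RingHom.map_det]
    congr 1
    ext a b
    simp [Matrix.one_apply, apply_ite]
  rw [polyL, Polynomial.coe_eval₂RingHom, rankPoly_map_eq, h1, ← Matrix.det_mul,
    ← Polynomial.coe_eval₂RingHom, RingHom.map_det]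
  congr 1
  have h2 : π.map (HahnSeries.C : R →+* LaurentSeries R) * A.map HahnSeries.C =
      A.map HahnSeries.C := by rw [← Matrix.map_mul, hA]
  have h3 : (uPow R (-1) • π.map (HahnSeries.C : R →+* LaurentSeries R) +
      (1 - π.map HahnSeries.C)) * (1 - uPow R 1 • A.map HahnSeries.C) =
      1 + (uPow R (-1) • π.map HahnSeries.C - A.map HahnSeries.C - π.map HahnSeries.C) := by
    simp only [mul_sub, add_mul, sub_mul, mul_one, one_mul, smul_mul_assoc, mul_smul_comm, h2]
    rw [smul_add, smul_smul, uPow_mul_neg, one_smul, sub_self, smul_zero]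
    abel
  rw [h3]
  ext a b
  simp [Matrix.one_apply, apply_ite, RingHom.mapMatrix_apply]

end Idempotent

/-! ### Sizes of finite modules -/

section Size

variable {k : Type u} [Field k] {G : Type u} [CommGroup G]

instance [Finite k] [Finite G] : Finite (GrpRing k G) :=
  Finite.of_equiv _ ((MonoidAlgebra.coeffEquiv (R := k) (M := G)).trans
    Finsupp.equivFunOnFinite).symm

lemma bigToL_toBig [Finite k] [Fintype G] (p : (GrpRing k G)[X]) :
    bigToL k G (toBig k G p) = polyL _ p := by
  have h : ((bigToL k G).toRingHom.comp (toBig k G)) = polyL (GrpRing k G) := by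
    refine Polynomial.ringHom_ext (fun a => ?_) ?_
    · rw [polyL_C]
      have h1 : toBig k G (Polynomial.C a) =
          MonoidAlgebra.mapRingHom G (algebraMap k (KInf k)) a := by simp [toBig]
      change bigToL k G (toBig k G (Polynomial.C a)) = _
      rw [h1]
      ext i g
      rw [coeff_bigToL, coeff_coeffBig]
      change ((HahnSeries.single (0 : ℤ) (a.coeff g) : LaurentSeries k)).coeff i = _
      rw [HahnSeries.C_apply]
      by_cases hi : i = 0
      · rw [hi, HahnSeries.coeff_single_same, HahnSeries.coeff_single_same]
      · rw [HahnSeries.coeff_single_of_ne hi, HahnSeries.coeff_single_of_ne hi]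
        rfl
    · rw [polyL_X]
      have h1 : toBig k G Polynomial.X = algebraMap (KInf k) (BigRing k G) (tInf k) := by
        simp [toBig]
      change bigToL k G (toBig k G Polynomial.X) = _
      rw [h1]
      ext i g
      rw [coeff_bigToL, coeff_coeffBig, MonoidAlgebra.coe_algebraMap, Function.comp_apply,
        MonoidAlgebra.coeff_single]
      have h2 : ∀ x : LaurentSeries k, (algebraMap (KInf k) (KInf k)) x = x := fun _ => rfl
      by_cases hi : i = -1
      · subst hi
        rw [HahnSeries.coeff_single_same]
        by_cases hg : g = 1
        · subst hg
          rw [Finsupp.single_eq_same, MonoidAlgebra.one_def, MonoidAlgebra.coeff_single,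
            Finsupp.single_eq_same]
          exact HahnSeries.coeff_single_same (Γ := ℤ) (-1) (1 : k)
        · rw [Finsupp.single_eq_of_ne hg, MonoidAlgebra.one_def, MonoidAlgebra.coeff_single,
            Finsupp.single_eq_of_ne hg, lcoeff_zero]
      · rw [HahnSeries.coeff_single_of_ne hi, MonoidAlgebra.coeff_zero, Finsupp.zero_apply]
        by_cases hg : g = 1
        · subst hg
          rw [Finsupp.single_eq_same]
          exact HahnSeries.coeff_single_of_ne (Γ := ℤ) (R := k) hi
        · rw [Finsupp.single_eq_of_ne hg, lcoeff_zero]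
  exact congrArg (fun f => f p) (congrArg DFunLike.coe h)

lemma isMonic_iff [Finite k] [Fintype G] (x : BigRing k G) : IsMonic x ↔ LMonic (bigToL k G x) := by
  simp only [IsMonic, lMonic_iff, coeff_bigToL]

variable {N : Type u} [AddCommGroup N] [Module (GrpRing k G)[X] N]

lemma gsize_eq [Finite k] [Fintype G] {f : (GrpRing k G)[X]} (hm : LMonic (polyL _ f))
    (hu : IsUnit (polyL _ f)) (hf : Ideal.span {f} = fitt (S := (GrpRing k G)[X]) N) :
    gsize (k := k) (G := G) N = f := by
  have hex : ∃ f : (GrpRing k G)[X], IsMonic (toBig k G f) ∧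
      Ideal.span {f} = fitt (S := (GrpRing k G)[X]) N :=
    ⟨f, by rwa [isMonic_iff, bigToL_toBig], hf⟩
  obtain ⟨h1, h2⟩ := Classical.epsilon_spec hex
  change IsMonic (toBig k G (gsize N)) at h1
  change Ideal.span {gsize N} = _ at h2
  rw [isMonic_iff, bigToL_toBig] at h1
  rw [← hf] at h2
  obtain ⟨v, hv⟩ := Ideal.mem_span_singleton.1 (h2 ▸ Ideal.mem_span_singleton_self (gsize N))
  obtain ⟨w, hw⟩ := Ideal.mem_span_singleton.1 (h2.symm ▸ Ideal.mem_span_singleton_self f)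
  have hvw : v * w = 1 := by
    apply polyL_injective
    apply hu.mul_left_cancel
    rw [← map_mul, ← map_mul, mul_one, ← mul_assoc, ← hv, ← hw]
  apply polyL_injective
  exact h1.eq_of_eq_mul_unit hm hu (IsUnit.of_mul_eq_one w hvw) (by rw [hv, map_mul])

variable [Module (GrpRing k G) N] [IsScalarTower (GrpRing k G) (GrpRing k G)[X] N] {m : ℕ}

open Polynomial Matrix in
/-- If `N` is a direct summand of `Rᵐ`, where `π` is the idempotent matrix of the projection and
`A` the matrix of the multiplication by `t`, then `N` is the cokernel of `X π - A + 1 - π`. -/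
lemma fitt_eq_of_presentation {i : N →ₗ[GrpRing k G] (Fin m → GrpRing k G)}
    {r : (Fin m → GrpRing k G) →ₗ[GrpRing k G] N} (h : r ∘ₗ i = LinearMap.id) :
    fitt (S := (GrpRing k G)[X]) N = Ideal.span {(1 + ((X : (GrpRing k G)[X]) •
      (LinearMap.toMatrix' (i ∘ₗ r)).map C - (LinearMap.toMatrix' (i ∘ₗ tEnd k G N ∘ₗ r)).map C -
      (LinearMap.toMatrix' (i ∘ₗ r)).map C)).det} := by
  set π := LinearMap.toMatrix' (i ∘ₗ r) with hπ
  set A := LinearMap.toMatrix' (i ∘ₗ tEnd k G N ∘ₗ r) with hA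
  set B : Matrix (Fin m) (Fin m) (GrpRing k G)[X] := 1 + ((X : (GrpRing k G)[X]) •
      π.map C - A.map C - π.map C) with hB
  have hri : ∀ n, r (i n) = n := fun n => LinearMap.congr_fun h n
  have hπv : ∀ w, π *ᵥ w = i (r w) := fun w => by
    rw [hπ, LinearMap.toMatrix'_mulVec]; rfl
  have hAv : ∀ w, A *ᵥ w = i ((X : (GrpRing k G)[X]) • r w) := fun w => by
    rw [hA, LinearMap.toMatrix'_mulVec]; rfl
  -- constant vectors; modulo the image of `B` every vector is congruent to one of them
  let c : (Fin m → GrpRing k G) → (Fin m → (GrpRing k G)[X]) := fun w j => C (w j)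
  have hc_add : ∀ v w, c (v + w) = c v + c w := fun v w => by ext1 j; simp [c]
  have hc_sub : ∀ v w, c (v - w) = c v - c w := fun v w => by ext1 j; simp [c]
  have hMc : ∀ (M : Matrix (Fin m) (Fin m) (GrpRing k G)) w, M.map C *ᵥ c w = c (M *ᵥ w) := by
    intro M w
    ext1 j
    simp [c, Matrix.mulVec, dotProduct]
  have hBc : ∀ w, B *ᵥ c w = c w + ((X : (GrpRing k G)[X]) • c (i (r w)) -
      c (i ((X : (GrpRing k G)[X]) • r w)) - c (i (r w))) := by
    intro w
    rw [hB, Matrix.add_mulVec, Matrix.sub_mulVec, Matrix.sub_mulVec, Matrix.smul_mulVec, hMc, hMc,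
      hπv, hAv, Matrix.one_mulVec]
  have hBsmul : ∀ (p : (GrpRing k G)[X]) v, B *ᵥ (p • v) = p • B *ᵥ v := fun p v =>
    Matrix.mulVec_smul _ _ _
  have hspan : ∀ v, ∃ w y, v = c w + B *ᵥ y := by
    have hX : ∀ v, (∃ w y, v = c w + B *ᵥ y) →
        ∃ w y, (X : (GrpRing k G)[X]) • v = c w + B *ᵥ y := by
      rintro _ ⟨w, y, rfl⟩
      refine ⟨i ((X : (GrpRing k G)[X]) • r w),
        c (i (r w)) + (X : (GrpRing k G)[X]) • (c (w - i (r w)) + y), ?_⟩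
      rw [Matrix.mulVec_add, hBsmul, Matrix.mulVec_add, hBc, hBc, map_sub, hri, sub_self, smul_zero,
        map_zero, hc_sub]
      have : c 0 = 0 := by ext1 j; simp [c]
      simp only [this, smul_sub, smul_add, sub_zero, smul_zero, add_zero]
      abel
    have hadd : ∀ v v', (∃ w y, v = c w + B *ᵥ y) → (∃ w y, v' = c w + B *ᵥ y) →
        ∃ w y, v + v' = c w + B *ᵥ y := by
      rintro _ _ ⟨w, y, rfl⟩ ⟨w', y', rfl⟩
      refine ⟨w + w', y + y', ?_⟩
      rw [hc_add, Matrix.mulVec_add]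
      abel
    have hsingle : ∀ (j : Fin m) (p : (GrpRing k G)[X]),
        ∃ w y, (Pi.single j p : Fin m → (GrpRing k G)[X]) = c w + B *ᵥ y := by
      intro j p
      induction p using Polynomial.induction_on' with
      | add p q hp hq => rw [Pi.single_add]; exact hadd _ _ hp hq
      | monomial n a =>
        induction n with
        | zero =>
          refine ⟨Pi.single j a, 0, ?_⟩
          rw [Matrix.mulVec_zero, add_zero, Polynomial.monomial_zero_left]
          ext1 l
          by_cases hl : l = j
          · subst hl; simp [c]
          · simp [c, hl]
        | succ n ih =>
          have := hX _ ih
          rwa [← Pi.single_smul, smul_eq_mul, Polynomial.X_mul_monomial] at this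
    intro v
    rw [← Finset.univ_sum_single v]
    refine Finset.sum_induction _ (fun v => ∃ w y, v = c w + B *ᵥ y) (fun a b => hadd a b)
      ⟨0, 0, ?_⟩ fun j _ => hsingle j _
    ext1 j
    simp [c]
  let ρ : (Fin m → (GrpRing k G)[X]) →ₗ[(GrpRing k G)[X]] N :=
    Fintype.linearCombination _ fun j => r (Pi.single j 1)
  have hCs : ∀ (a : GrpRing k G) (x : N), (C a : (GrpRing k G)[X]) • x = a • x := fun a x =>
    algebraMap_smul (GrpRing k G)[X] a x
  have hρc : ∀ w, ρ (c w) = r w := fun w => by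
    conv_rhs => rw [pi_eq_sum_univ' w]
    simp [ρ, c, Fintype.linearCombination_apply, hCs]
  have hρB : ∀ y, ρ (B *ᵥ y) = 0 := by
    intro y
    have : ρ ∘ₗ Matrix.toLin' B = 0 := by
      refine LinearMap.pi_ext' fun j => LinearMap.ext_ring ?_
      have h1 : (Pi.single j 1 : Fin m → (GrpRing k G)[X]) = c (Pi.single j 1) := by
        ext1 l
        by_cases hl : l = j
        · subst hl; simp [c]
        · simp [c, hl]
      simp only [LinearMap.comp_apply, LinearMap.single_apply, Matrix.toLin'_apply,
        LinearMap.zero_apply]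
      rw [h1, hBc, map_add, map_sub, map_sub, map_smul, hρc, hρc, hρc, hri, hri]
      abel
    exact LinearMap.congr_fun this y
  rw [← Matrix.det_transpose B]
  refine fitt_eq_span_det _ ρ (fun n => ⟨c (i n), by rw [hρc, hri]⟩) fun v => ?_
  simp only [Matrix.vecMul_transpose]
  constructor
  · intro hv
    obtain ⟨w, y, rfl⟩ := hspan v
    rw [map_add, hρc, hρB, add_zero] at hv
    refine ⟨c w + y, ?_⟩
    have : c 0 = 0 := by ext1 j; simp [c]
    rw [Matrix.mulVec_add, hBc, hv, smul_zero, map_zero, this]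
    simp
  · rintro ⟨w, rfl⟩
    exact hρB w

lemma presentation_matrix_mul {R P : Type*} [CommRing R] [AddCommGroup P] [Module R P]
    {i : P →ₗ[R] (Fin m → R)} {r : (Fin m → R) →ₗ[R] P} (h : r ∘ₗ i = LinearMap.id)
    (φ : Module.End R P) : LinearMap.toMatrix' (i ∘ₗ r) * LinearMap.toMatrix' (i ∘ₗ φ ∘ₗ r) =
      LinearMap.toMatrix' (i ∘ₗ φ ∘ₗ r) := by
  rw [← LinearMap.toMatrix'_comp, LinearMap.comp_assoc, ← LinearMap.comp_assoc _ i r, h,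
    LinearMap.id_comp]

lemma presentation_matrix_idem {R P : Type*} [CommRing R] [AddCommGroup P] [Module R P]
    {i : P →ₗ[R] (Fin m → R)} {r : (Fin m → R) →ₗ[R] P} (h : r ∘ₗ i = LinearMap.id) :
    LinearMap.toMatrix' (i ∘ₗ r) * LinearMap.toMatrix' (i ∘ₗ r) = LinearMap.toMatrix' (i ∘ₗ r) :=
  presentation_matrix_mul h LinearMap.id

lemma LMonic_psL {R : Type*} [CommRing R] {p : R⟦X⟧} (hp : PowerSeries.constantCoeff p = 1) :
    LMonic (psL R p) := by
  have := lMonic_uPow_mul_psL 0 hp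
  rwa [uPow_zero, one_mul] at this

variable [Finite k] [Fintype G]

open Polynomial in
/-- The size of a module presented as a direct summand of `Rᵐ`, as an element of `R((t⁻¹))`. The
first factor only depends on the underlying `R`-module. -/
lemma polyL_gsize {i : N →ₗ[GrpRing k G] (Fin m → GrpRing k G)}
    {r : (Fin m → GrpRing k G) →ₗ[GrpRing k G] N} (h : r ∘ₗ i = LinearMap.id) :
    polyL _ (gsize (k := k) (G := G) N) = polyL _ (rankPoly (LinearMap.toMatrix' (i ∘ₗ r))) *
      psL _ ((LinearMap.toMatrix' (i ∘ₗ tEnd k G N ∘ₗ r)).charpolyRev :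
        (GrpRing k G)[X]) := by
  have hπ := presentation_matrix_idem h
  have hA := presentation_matrix_mul h (tEnd k G N)
  have h1 := polyL_det_eq (π := LinearMap.toMatrix' (i ∘ₗ r)) hA
  rw [gsize_eq _ _ (fitt_eq_of_presentation h).symm, h1]
  · rw [h1]
    exact (lMonic_rankPoly hπ).mul (LMonic_psL (constantCoeff_charpolyRev _))
  · rw [h1]
    exact (isUnit_polyL_rankPoly hπ).mul
      ((isUnit_of_constantCoeff_eq_one (constantCoeff_charpolyRev _)).map _)

variable (N) in
lemma gsize_spec [Finite N] [Module.Projective (GrpRing k G) N] :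
    LMonic (polyL _ (gsize (k := k) (G := G) N)) ∧
    IsUnit (polyL _ (gsize (k := k) (G := G) N)) ∧
    Ideal.span {gsize (k := k) (G := G) N} = fitt (S := (GrpRing k G)[X]) N := by
  obtain ⟨m, i, r, h⟩ := exists_presentation (GrpRing k G) N
  have hπ := presentation_matrix_idem h
  have hm : LMonic (polyL _ (gsize (k := k) (G := G) N)) := by
    rw [polyL_gsize h]
    exact (lMonic_rankPoly hπ).mul (LMonic_psL (constantCoeff_charpolyRev _))
  have hu : IsUnit (polyL _ (gsize (k := k) (G := G) N)) := by
    rw [polyL_gsize h]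
    exact (isUnit_polyL_rankPoly hπ).mul
      ((isUnit_of_constantCoeff_eq_one (constantCoeff_charpolyRev _)).map _)
  refine ⟨hm, hu, ?_⟩
  rw [fitt_eq_of_presentation h]
  congr 2
  apply polyL_injective
  rw [polyL_gsize h, polyL_det_eq (presentation_matrix_mul h (tEnd k G N))]

end Size

section SizeExact

variable {k : Type u} [Field k] {G : Type u} [CommGroup G] [Finite k] [Fintype G]
  {N : Type u} [AddCommGroup N] [Module (GrpRing k G)[X] N]
  [Module (GrpRing k G) N] [IsScalarTower (GrpRing k G) (GrpRing k G)[X] N]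

variable (N) in
/-- The size of a finite projective module is the characteristic polynomial of `t`. -/
lemma gsize_eq_detProj [Finite N] [Module.Projective (GrpRing k G) N] :
    gsize (k := k) (G := G) N =
      detProj ((Polynomial.X : (GrpRing k G)[X]) • LinearMap.id -
        (tEnd k G N).baseChange (GrpRing k G)[X]) := by
  obtain ⟨m, i, r, h⟩ := exists_presentation (GrpRing k G) N
  rw [detProj_baseChange h]
  apply polyL_injective
  rw [polyL_gsize h, ← polyL_det_eq (presentation_matrix_mul h (tEnd k G N)), map_sub, map_sub,
    map_smul]
  have h1 := presMatrix_baseChange (S := (GrpRing k G)[X]) i r LinearMap.id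
  rw [LinearMap.baseChange_id, LinearMap.id_comp] at h1
  rw [h1, presMatrix_baseChange]
  rfl

/-- Sizes are multiplicative in short exact sequences: over `R` such a sequence splits, and
characteristic polynomials are multiplicative. -/
lemma gsize_eq_mul_of_exact {N' N'' : Type u} [AddCommGroup N'] [Module (GrpRing k G)[X] N']
    [Module (GrpRing k G) N'] [IsScalarTower (GrpRing k G) (GrpRing k G)[X] N']
    [AddCommGroup N''] [Module (GrpRing k G)[X] N'']
    [Module (GrpRing k G) N''] [IsScalarTower (GrpRing k G) (GrpRing k G)[X] N'']
    [Finite N] [Module.Projective (GrpRing k G) N] [Finite N'] [Module.Projective (GrpRing k G) N']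
    [Finite N''] [Module.Projective (GrpRing k G) N'']
    (a : N' →ₗ[(GrpRing k G)[X]] N) (b : N →ₗ[(GrpRing k G)[X]] N'')
    (ha : Function.Injective a) (hb : Function.Surjective b) (hab : Function.Exact a b) :
    gsize (k := k) (G := G) N = gsize (k := k) (G := G) N' * gsize (k := k) (G := G) N'' := by
  rw [gsize_eq_detProj, gsize_eq_detProj, gsize_eq_detProj]
  set R := GrpRing k G
  let a' : N' →ₗ[R] N := a.restrictScalars R
  let b' : N →ₗ[R] N'' := b.restrictScalars R
  obtain ⟨s, hs⟩ := b'.exists_rightInverse_of_surjective (LinearMap.range_eq_top.2 hb)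
  have hs' : ∀ x, b (s x) = x := fun x => LinearMap.congr_fun hs x
  -- the projection to `N'` with kernel the image of `s`
  have hex : ∀ x : N, ∃ y : N', a y = x - s (b x) := fun x =>
    (hab _).1 (by rw [map_sub, hs', sub_self])
  choose p hp using hex
  let p' : N →ₗ[R] N' :=
    { toFun := p
      map_add' := fun x y => ha (by rw [map_add, hp, hp, hp, map_add, map_add]; abel)
      map_smul' := fun c x => ha (by
        change a' (p (c • x)) = a' (c • p x)
        rw [map_smul]
        change a (p (c • x)) = c • a (p x)
        rw [hp, hp, smul_sub]
        change c • x - s (b' (c • x)) = _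
        rw [map_smul, map_smul]
        rfl) }
  have hcomp : ∀ {A B C : Type u} [AddCommGroup A] [AddCommGroup B] [AddCommGroup C] [Module R A]
      [Module R B] [Module R C] (f : B →ₗ[R] C) (g : A →ₗ[R] B),
      f.baseChange R[X] ∘ₗ g.baseChange R[X] = (f ∘ₗ g).baseChange R[X] := fun f g =>
    (LinearMap.baseChange_comp (g := _) _).symm
  have hba : ∀ y, b (a y) = 0 := fun y => (hab _).2 ⟨y, rfl⟩
  refine detProj_of_exact (a := a'.baseChange R[X]) (p := p'.baseChange R[X])
    (b := b'.baseChange R[X]) (s := s.baseChange R[X]) ?_ ?_ ?_ ?_ ?_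
  · rw [hcomp, ← LinearMap.baseChange_id]
    congr 1
    ext y
    refine ha ?_
    change a (p (a y)) = _
    rw [hp, hba, map_zero, sub_zero]
    rfl
  · rw [hcomp, ← LinearMap.baseChange_id]
    congr 1
  · rw [hcomp, hcomp, ← LinearMap.baseChange_add, ← LinearMap.baseChange_id]
    congr 1
    ext x
    change a (p x) + s (b x) = x
    rw [hp, sub_add_cancel]
  · rw [LinearMap.sub_comp, LinearMap.comp_sub, LinearMap.smul_comp, LinearMap.comp_smul, hcomp,
      hcomp, LinearMap.id_comp, LinearMap.comp_id]
    congr 2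
    ext y
    exact (map_smul a Polynomial.X y).symm
  · rw [LinearMap.sub_comp, LinearMap.comp_sub, LinearMap.smul_comp, LinearMap.comp_smul, hcomp,
      hcomp, LinearMap.id_comp, LinearMap.comp_id]
    congr 2
    ext y
    exact map_smul b Polynomial.X y

end SizeExact

section FittQuotient

open Matrix

variable {S V : Type*} [CommRing S] [AddCommGroup V] [Module S V]

/-- The Fitting ideal of a quotient of free modules is generated by the determinant of the matrix
that expresses a basis of the submodule in a basis of the ambient module. -/
lemma fitt_quotient_of_bases {n : ℕ} {E E' : Submodule S V}
    (e : Module.Basis (Fin n) S E) (e' : Module.Basis (Fin n) S E') (P : Matrix (Fin n) (Fin n) S)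
    (h : ∀ i, (e i : V) = ∑ j, P i j • (e' j : V)) :
    fitt (S := S) (E' ⧸ E.submoduleOf E') = Ideal.span {P.det} := by
  have hv : ∀ w : Fin n → S, (∑ i, w i • (e i : V)) = ∑ j, (w ᵥ* P) j • (e' j : V) := by
    intro w
    simp only [h, Finset.smul_sum, smul_smul]
    rw [Finset.sum_comm]
    simp only [Matrix.vecMul, dotProduct, Finset.sum_smul]
  refine fitt_eq_span_det P
    ((E.submoduleOf E').mkQ ∘ₗ (Fintype.linearCombination S fun j => e' j))
    ((Submodule.mkQ_surjective _).comp fun x => ⟨e'.repr x, e'.sum_repr x⟩) fun v => ?_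
  simp only [LinearMap.comp_apply, Submodule.mkQ_apply, Submodule.Quotient.mk_eq_zero,
    Fintype.linearCombination_apply]
  change ((∑ j, v j • e' j : E') : V) ∈ E ↔ _
  simp only [Submodule.coe_sum, Submodule.coe_smul]
  constructor
  · intro hmem
    refine ⟨e.repr ⟨_, hmem⟩, ?_⟩
    have h1 := hv (e.repr ⟨_, hmem⟩)
    have h2 := congrArg (Subtype.val) (e.sum_repr ⟨_, hmem⟩)
    simp only [Submodule.coe_sum, Submodule.coe_smul] at h2
    rw [h2] at h1
    ext j
    have h3 : ∑ j, v j • e' j = ∑ j, (e.repr ⟨_, hmem⟩ ᵥ* P) j • e' j := Subtype.ext (by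
      simpa only [Submodule.coe_sum, Submodule.coe_smul] using h1)
    exact congrFun (e'.linearIndependent.fintypeLinearCombination_injective h3) j
  · rintro ⟨w, rfl⟩
    rw [← hv]
    exact Submodule.sum_mem _ fun i _ => E.smul_mem _ (e i).2

end FittQuotient

/-! ### Coordinates on `K_∞` -/

section Coordinates

variable {k : Type u} [Field k] [Finite k]
variable {F : Type u} [Field F] [Algebra (RatFunc k) F]
variable {K : Type u} [Field K] [Algebra (RatFunc k) K] [Algebra F K]
  [IsScalarTower (RatFunc k) F K]
variable {G : Type u} [CommGroup G] [MulSemiringAction G K] [IsGaloisGroup G F K]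

lemma single_smul (g : G) (c : KInf k) (v : KInfty k F K) :
    (MonoidAlgebra.single g c : BigRing k G) • v = c • rhoInf k F K G g v := by
  change (rhoInf k F K G).asAlgebraHom (MonoidAlgebra.single g c) v = _
  rw [Representation.asAlgebraHom_single]
  rfl

instance : IsScalarTower (KInf k) (BigRing k G) (KInfty k F K) where
  smul_assoc c x v := by
    change (rhoInf k F K G).asAlgebraHom (c • x) v = c • (rhoInf k F K G).asAlgebraHom x v
    rw [map_smul]
    rfl

lemma rhoInf_tmul (g : G) (c : KInf k) (x : K) :
    rhoInf k F K G g (KInfty.tmul k F K c x) = KInfty.tmul k F K c (g • x) := rfl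

lemma poly_smul_eq (p : (GrpRing k G)[X]) (v : KInfty k F K) : p • v = toBig k G p • v := rfl

lemma grp_smul_eq (r : GrpRing k G) (v : KInfty k F K) :
    r • v = toBig k G (Polynomial.C r) • v := rfl

lemma kpoly_smul_eq (p : k[X]) (v : KInfty k F K) : p • v = (algebraMap k[X] (KInf k) p) • v := rfl

lemma algebraMap_kpoly (p : k[X]) :
    algebraMap k[X] (KInf k) p = Polynomial.eval₂ (algebraMap k (KInf k)) (tInf k) p := rfl

variable (G) in
lemma toBig_map (p : k[X]) :
    toBig k G (p.map (algebraMap k (GrpRing k G))) =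
      algebraMap (KInf k) (BigRing k G) (algebraMap k[X] (KInf k) p) := by
  rw [algebraMap_kpoly, Polynomial.hom_eval₂, toBig, Polynomial.coe_eval₂RingHom,
    Polynomial.eval₂_map]
  congr 1
  refine RingHom.ext fun c => ?_
  change MonoidAlgebra.mapRingHom G (algebraMap k (KInf k)) (MonoidAlgebra.single 1 c) = _
  rw [MonoidAlgebra.mapRingHom_single]
  rfl

lemma map_smul_eq (p : k[X]) (v : KInfty k F K) :
    p.map (algebraMap k (GrpRing k G)) • v = p • v := by
  rw [poly_smul_eq, toBig_map, algebraMap_smul, kpoly_smul_eq]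

lemma toBig_single (g : G) :
    toBig k G (Polynomial.C (MonoidAlgebra.single g 1)) = MonoidAlgebra.single g 1 := by
  rw [toBig, Polynomial.coe_eval₂RingHom, Polynomial.eval₂_C, MonoidAlgebra.mapRingHom_single,
    map_one]

lemma grp_single_smul (g : G) (v : KInfty k F K) :
    (MonoidAlgebra.single g 1 : GrpRing k G) • v = rhoInf k F K G g v := by
  rw [grp_smul_eq, toBig_single, single_smul, one_smul]

variable [FiniteDimensional (RatFunc k) F] [Fintype G]

variable (k F K G) in
/-- A basis of `K_∞` over `k((t⁻¹))[G]` obtained from a basis of `F` over `k(t)` and a normal basis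
of `K/F`. -/
lemma exists_bigBasis : ∃ (y : Fin (Module.finrank (RatFunc k) F) → K)
    (b : Module.Basis (Fin (Module.finrank (RatFunc k) F)) (BigRing k G) (KInfty k F K)),
    ∀ i, b i = KInfty.tmul k F K 1 (y i) := by
  classical
  have : IsGalois F K := IsGaloisGroup.isGalois G F K
  have : FiniteDimensional F K := IsGaloisGroup.finiteDimensional G F K
  have : SMulCommClass G F K := IsGaloisGroup.commutes
  let e : G ≃ Gal(K/F) := (IsGaloisGroup.mulEquivCongr G Gal(K/F) F K).toEquiv
  let a : K := IsGalois.normalBasis F K 1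
  let nb : Module.Basis G F K := (IsGalois.normalBasis F K).reindex e.symm
  have hnb : ∀ g, nb g = g • a := fun g => by
    rw [Module.Basis.reindex_apply, Equiv.symm_symm, IsGalois.normalBasis_apply]
    exact IsGaloisGroup.mulEquivCongr_apply_smul G Gal(K/F) F K g a
  let fb := Module.finBasis (RatFunc k) F
  let B := fb.smulTower nb
  let b' : Module.Basis (Fin (Module.finrank (RatFunc k) F) × G) (KInf k) (KInfty k F K) :=
    Algebra.TensorProduct.basis (KInf k) B
  let y : Fin (Module.finrank (RatFunc k) F) → K := fun i => fb i • a
  let b : Fin (Module.finrank (RatFunc k) F) → KInfty k F K := fun i => KInfty.tmul k F K 1 (y i)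
  have hb : ∀ i g, b' (i, g) = rhoInf k F K G g (b i) := fun i g => by
    have h₁ : B (i, g) = g • y i := by
      rw [Module.Basis.smulTower_apply, hnb]
      exact (smul_comm g (fb i) a).symm
    have h₂ : b' (i, g) = KInfty.tmul k F K 1 (B (i, g)) :=
      Algebra.TensorProduct.basis_apply B (i, g)
    rw [h₂, h₁]
    rfl
  have hsmul : ∀ (x : BigRing k G) i, x • b i = ∑ g, x.coeff g • b' (i, g) := fun x i => by
    conv_lhs => rw [show x = ∑ g, MonoidAlgebra.single g (x.coeff g) by
      ext h; rw [coeff_sum_single]]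
    rw [Finset.sum_smul]
    exact Finset.sum_congr rfl fun g _ => by rw [single_smul, hb]
  refine ⟨y, Module.Basis.mk (v := b) ?_ ?_, fun i => by rw [Module.Basis.mk_apply]⟩
  · rw [Fintype.linearIndependent_iff]
    intro x hx i
    simp_rw [hsmul] at hx
    rw [← Fintype.sum_prod_type' (f := fun i g => (x i).coeff g • b' (i, g))] at hx
    have := Fintype.linearIndependent_iff.1 b'.linearIndependent (fun p => (x p.1).coeff p.2) hx
    ext g
    exact this (i, g)
  · intro v _
    rw [← b'.sum_repr v]
    refine Submodule.sum_mem _ fun p _ => ?_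
    rw [hb, ← single_smul]
    exact Submodule.smul_mem _ _ (Submodule.subset_span ⟨p.1, rfl⟩)

/-- The coordinates in `R((t⁻¹))` of an element of `K_∞`, with respect to a basis of `K_∞` over
`k((t⁻¹))[G]`. -/
def coord {ι : Type*} (b : Module.Basis ι (BigRing k G) (KInfty k F K)) (x : KInfty k F K) (i : ι) :
    LRing k G :=
  bigToL k G (b.repr x i)

section Coord

variable {ι : Type*} (b : Module.Basis ι (BigRing k G) (KInfty k F K))

omit [FiniteDimensional (RatFunc k) F]

lemma coord_add (x y : KInfty k F K) (i : ι) : coord b (x + y) i = coord b x i + coord b y i := by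
  rw [coord, map_add, Finsupp.add_apply, map_add]; rfl

lemma coord_zero (i : ι) : coord b (0 : KInfty k F K) i = 0 := by
  rw [coord, map_zero, Finsupp.zero_apply, map_zero]

lemma coord_smul (z : BigRing k G) (x : KInfty k F K) (i : ι) :
    coord b (z • x) i = bigToL k G z * coord b x i := by
  rw [coord, map_smul, Finsupp.smul_apply, smul_eq_mul, map_mul]; rfl

lemma coord_sum {κ : Type*} (s : Finset κ) (x : κ → KInfty k F K) (i : ι) :
    coord b (∑ j ∈ s, x j) i = ∑ j ∈ s, coord b (x j) i :=
  map_sum (⟨⟨fun x => coord b x i, coord_zero b i⟩, fun x y => coord_add b x y i⟩ :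
    KInfty k F K →+ LRing k G) x s

lemma coord_sub (x y : KInfty k F K) (i : ι) : coord b (x - y) i = coord b x i - coord b y i :=
  map_sub (⟨⟨fun x => coord b x i, coord_zero b i⟩, fun x y => coord_add b x y i⟩ :
    KInfty k F K →+ LRing k G) x y

lemma coord_poly_smul (p : (GrpRing k G)[X]) (x : KInfty k F K) (i : ι) :
    coord b (p • x) i = polyL _ p * coord b x i := by
  rw [poly_smul_eq, coord_smul, bigToL_toBig]

lemma coord_grp_smul (r : GrpRing k G) (x : KInfty k F K) (i : ι) :
    coord b (r • x) i = HahnSeries.C r * coord b x i := by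
  rw [grp_smul_eq, coord_smul, bigToL_toBig, polyL_C]

lemma coord_basis [DecidableEq ι] (i j : ι) : coord b (b i) j = if i = j then 1 else 0 := by
  rw [coord, b.repr_self, Finsupp.single_apply]
  split_ifs <;> simp

/-- The filtration of `K_∞` by the order in `t⁻¹` of the coordinates. -/
def filt (j : ℤ) : Submodule (GrpRing k G) (KInfty k F K) where
  carrier := {x | ∀ i, ∀ l < j, (coord b x i).coeff l = 0}
  add_mem' hx hy i l hl := by rw [coord_add, HahnSeries.coeff_add, hx i l hl, hy i l hl, add_zero]
  zero_mem' i l _ := by rw [coord_zero, HahnSeries.coeff_zero]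
  smul_mem' r x hx i l hl := by rw [coord_grp_smul, coeff_C_mul, hx i l hl, mul_zero]

variable {b}

lemma mem_filt {j : ℤ} {x : KInfty k F K} :
    x ∈ filt b j ↔ ∀ i, ∀ l < j, (coord b x i).coeff l = 0 := Iff.rfl

variable (b) in
lemma filt_anti : Antitone (filt b) := fun _ _ h _ hx i l hl => hx i l (hl.trans_le h)

lemma X_smul_mem_filt {j : ℤ} {x : KInfty k F K} :
    (Polynomial.X : (GrpRing k G)[X]) • x ∈ filt b (j - 1) ↔ x ∈ filt b j := by
  simp only [mem_filt, coord_poly_smul, polyL_X, coeff_uPow_mul]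
  refine forall_congr' fun i => ⟨fun h l hl => ?_, fun h l hl => h _ (by omega)⟩
  have := h (l - 1) (by omega)
  simpa using this

end Coord

section Projective

omit [FiniteDimensional (RatFunc k) F]

/-- A submodule stable under a `k`-linear map with trace `1` is projective. -/
lemma projective_submodule (P : Submodule (GrpRing k G) (KInfty k F K))
    (f : KInfty k F K →ₗ[KInf k] KInfty k F K)
    (hf : ∀ x, ∑ g : G, rhoInf k F K G g⁻¹ (f (rhoInf k F K G g x)) = x)
    (hP : ∀ x ∈ P, f x ∈ P) : Module.Projective (GrpRing k G) P := by
  refine projective_of_sum_conj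
    ((f.toAddMonoidHom.comp P.subtype.toAddMonoidHom).codRestrict P.toAddSubmonoid
      fun x => hP x x.2 : P →+ P) (fun c m => Subtype.ext ?_)
      fun m => Subtype.ext ?_
  · have h : ∀ v : KInfty k F K, algebraMap k (GrpRing k G) c • v = algebraMap k (KInf k) c • v :=
      fun v => by
        have : (Polynomial.C (algebraMap k (GrpRing k G) c)) =
          (Polynomial.C c).map (algebraMap k (GrpRing k G)) := (Polynomial.map_C _).symm
        rw [grp_smul_eq, this, toBig_map, algebraMap_smul, algebraMap_kpoly, Polynomial.eval₂_C]
    change f (algebraMap k (GrpRing k G) c • (m : KInfty k F K)) =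
      algebraMap k (GrpRing k G) c • f (m : KInfty k F K)
    rw [h, h, map_smul]
  · rw [Submodule.coe_sum]
    conv_rhs => rw [← hf (m : KInfty k F K)]
    refine Finset.sum_congr rfl fun g _ => ?_
    change (MonoidAlgebra.single g⁻¹ 1 : GrpRing k G) •
      f ((MonoidAlgebra.single g 1 : GrpRing k G) • (m : KInfty k F K)) = _
    rw [grp_single_smul, grp_single_smul]

variable {ι : Type*} (b : Module.Basis ι (BigRing k G) (KInfty k F K))

/-- The projection of `K_∞` onto the `k((t⁻¹))`-span of a basis over `k((t⁻¹))[G]`. -/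
def projOne [Fintype ι] : KInfty k F K →ₗ[KInf k] KInfty k F K where
  toFun x := ∑ i, (b.repr x i).coeff 1 • b i
  map_add' x y := by
    rw [← Finset.sum_add_distrib]
    refine Finset.sum_congr rfl fun i _ => ?_
    rw [map_add, Finsupp.add_apply, MonoidAlgebra.coeff_add, Finsupp.add_apply, add_smul]
  map_smul' c x := by
    rw [RingHom.id_apply, Finset.smul_sum]
    refine Finset.sum_congr rfl fun i _ => ?_
    have : b.repr (c • x) i = c • b.repr x i := by
      rw [← algebraMap_smul (BigRing k G) c x, map_smul, Finsupp.smul_apply, algebraMap_smul]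
    rw [this, smul_smul]
    rfl

lemma sum_projOne [Fintype ι] (x : KInfty k F K) :
    ∑ g : G, rhoInf k F K G g⁻¹ (projOne b (rhoInf k F K G g x)) = x := by
  classical
  have h : ∀ g : G, rhoInf k F K G g⁻¹ (projOne b (rhoInf k F K G g x)) =
      ∑ i, (MonoidAlgebra.single g⁻¹ ((b.repr x i).coeff g⁻¹) : BigRing k G) • b i := fun g => by
    change rhoInf k F K G g⁻¹ (∑ i, (b.repr (rhoInf k F K G g x) i).coeff 1 • b i) = _
    rw [map_sum]
    refine Finset.sum_congr rfl fun i _ => ?_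
    have : rhoInf k F K G g x = (MonoidAlgebra.single g 1 : BigRing k G) • x := by
      rw [single_smul, one_smul]
    rw [this, b.repr.map_smul, Finsupp.smul_apply, map_smul, single_smul, smul_eq_mul]
    congr 1
    simp [MonoidAlgebra.coeff_single_mul_apply]
  simp_rw [h]
  rw [Finset.sum_comm]
  conv_rhs => rw [← b.sum_repr x]
  refine Finset.sum_congr rfl fun i _ => ?_
  rw [← Finset.sum_smul]
  congr 1
  refine (Equiv.sum_comp (Equiv.inv G) fun g =>
    (MonoidAlgebra.single g ((b.repr x i).coeff g) : BigRing k G)).trans ?_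
  ext g
  rw [coeff_sum_single]

lemma coord_projOne [Fintype ι] (x : KInfty k F K) (i : ι) (l : ℤ) :
    (coord b (projOne b x) i).coeff l =
      MonoidAlgebra.single 1 (((coord b x i).coeff l).coeff 1) := by
  classical
  have : b.repr (projOne b x) i = MonoidAlgebra.single 1 ((b.repr x i).coeff 1) := by
    have h : projOne b x =
        b.equivFun.symm fun i => algebraMap (KInf k) (BigRing k G) ((b.repr x i).coeff 1) := by
      rw [b.equivFun_symm_apply]
      exact Finset.sum_congr rfl fun i _ => (algebraMap_smul (BigRing k G) _ (b i)).symm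
    rw [h]
    exact congrFun (b.equivFun.apply_symm_apply _) i
  ext g
  rw [coord, coord, coeff_bigToL, coeff_bigToL, coeff_coeffBig, coeff_coeffBig, this,
    MonoidAlgebra.coeff_single, MonoidAlgebra.coeff_single, Finsupp.single_apply,
    Finsupp.single_apply]
  split_ifs <;> rfl

lemma projective_filt [Fintype ι] (j : ℤ) : Module.Projective (GrpRing k G) (filt b j) := by
  refine projective_submodule _ (projOne b) (sum_projOne b) fun x hx i l hl => ?_
  rw [coord_projOne, hx i l hl]
  simp

include b in
lemma projective_kInfty [Fintype ι] : Module.Projective (GrpRing k G) (KInfty k F K) := by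
  have := projective_submodule (⊤ : Submodule (GrpRing k G) (KInfty k F K)) (projOne b)
    (sum_projOne b) fun _ _ => trivial
  exact Module.Projective.of_equiv Submodule.topEquiv

end Projective

end Coordinates

/-! ### Lattices -/

section Lattices

variable {k : Type u} [Field k] [Finite k]
variable {F : Type u} [Field F] [Algebra (RatFunc k) F]
variable {K : Type u} [Field K] [Algebra (RatFunc k) K] [Algebra F K]
  [IsScalarTower (RatFunc k) F K]
variable {G : Type u} [CommGroup G] [MulSemiringAction G K] [IsGaloisGroup G F K]

instance : IsScalarTower k[X] (KInf k) (KInfty k F K) where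
  smul_assoc p c v := by
    rw [kpoly_smul_eq, Algebra.smul_def p c]
    exact (smul_smul (algebraMap k[X] (KInf k) p) c v).symm

lemma kpoly_smul_injective : Function.Injective fun p : k[X] => p • (1 : KInf k) := by
  intro p q h
  refine polyToLaurent_injective k ?_
  have h' : algebraMap k[X] (KInf k) p * 1 = algebraMap k[X] (KInf k) q * 1 := by
    rw [← Algebra.smul_def, ← Algebra.smul_def]
    exact h
  rwa [mul_one, mul_one] at h'

/-- Lattices are the `A[G]`-submodules generated over `A` by a `k((t⁻¹))`-basis of `K_∞`. -/
lemma isLattice_iff [Module.Finite (KInf k) (KInfty k F K)]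
    {Λ : Submodule (GrpRing k G)[X] (KInfty k F K)} : IsLattice Λ ↔
      ∃ β : Module.Basis (Fin (Module.finrank (KInf k) (KInfty k F K))) (KInf k) (KInfty k F K),
        (Submodule.span k[X] (Set.range β) : Set (KInfty k F K)) = Λ := by
  constructor
  · rintro ⟨⟨β, -, hs⟩, h⟩
    have hβ : ⊤ ≤ Submodule.span (KInf k) (Set.range β) := by
      rw [← h, ← hs, Submodule.span_span_of_tower]
    exact ⟨basisOfTopLeSpanOfCardEqFinrank β hβ (Fintype.card_fin _),
      by rw [coe_basisOfTopLeSpanOfCardEqFinrank, hs]⟩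
  · rintro ⟨β, h⟩
    refine ⟨⟨β, β.linearIndependent.restrict_scalars kpoly_smul_injective, h⟩, ?_⟩
    rw [← h, Submodule.span_span_of_tower, β.span_eq]

lemma exists_kpoly_of_mem {d : ℕ} {β : Fin d → KInfty k F K}
    {Λ : Submodule (GrpRing k G)[X] (KInfty k F K)}
    (h : (Submodule.span k[X] (Set.range β) : Set (KInfty k F K)) = Λ) {x : KInfty k F K}
    (hx : x ∈ Λ) : ∃ p : Fin d → k[X], ∑ i, p i • β i = x := by
  have : x ∈ (Submodule.span k[X] (Set.range β) : Set (KInfty k F K)) := by rw [h]; exact hx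
  exact (Submodule.mem_span_range_iff_exists_fun k[X]).1 this

/-- A sublattice of a lattice contains a multiple of it. -/
lemma IsLattice.exists_smul_mem [Module.Finite (KInf k) (KInfty k F K)]
    {Λ E : Submodule (GrpRing k G)[X] (KInfty k F K)} (hΛ : IsLattice Λ) (hE : IsLattice E)
    (h : Λ ≤ E) : ∃ a : k[X], a ≠ 0 ∧ ∀ x ∈ E, a • x ∈ Λ := by
  obtain ⟨β, hβ⟩ := isLattice_iff.1 hΛ
  obtain ⟨η, hη⟩ := isLattice_iff.1 hE
  have hβE : ∀ i, ∃ p : Fin _ → k[X], ∑ j, p j • η j = β i := fun i =>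
    exists_kpoly_of_mem hη (h (hβ.subset (Submodule.subset_span ⟨i, rfl⟩)))
  choose P hP using hβE
  let A : Matrix (Fin (Module.finrank (KInf k) (KInfty k F K)))
    (Fin (Module.finrank (KInf k) (KInfty k F K))) k[X] := Matrix.of P
  have hmat : (A.map (algebraMap k[X] (KInf k))).transpose = η.toMatrix β := by
    ext i j
    rw [Module.Basis.toMatrix_apply, ← hP j, Matrix.transpose_apply, Matrix.map_apply]
    simp_rw [kpoly_smul_eq]
    exact (congrFun (η.repr_sum_self fun l => algebraMap k[X] (KInf k) (P j l)) i).symm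
  -- the multiple is the determinant of the change of basis over `A`
  have hdet : A.det ≠ 0 := by
    intro h0
    have h1 : IsUnit (η.toMatrix β).det :=
      (Matrix.isUnit_iff_isUnit_det _).1
        ((IsUnit.of_mul_eq_one _ (η.toMatrix_mul_toMatrix_flip β)))
    rw [← hmat, Matrix.det_transpose] at h1
    have h2 : (A.map (algebraMap k[X] (KInf k))).det = algebraMap k[X] (KInf k) A.det :=
      (RingHom.map_det _ A).symm
    rw [h2, h0, map_zero] at h1
    exact not_isUnit_zero h1
  have hkey : ∀ i, A.det • η i = ∑ l, A.adjugate i l • β l := by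
    intro i
    simp_rw [← hP, Finset.smul_sum, smul_smul]
    rw [Finset.sum_comm]
    simp_rw [← Finset.sum_smul]
    have : ∀ j, ∑ l, A.adjugate i l * P l j = if i = j then A.det else 0 := fun j => by
      have := congrFun (congrFun A.adjugate_mul i) j
      rw [Matrix.mul_apply, Matrix.smul_apply, Matrix.one_apply, smul_eq_mul, mul_ite, mul_one,
        mul_zero] at this
      exact this
    simp_rw [this, ite_smul, zero_smul]
    rw [Finset.sum_ite_eq, if_pos (Finset.mem_univ _)]
  refine ⟨A.det, hdet, fun x hx => ?_⟩
  obtain ⟨p, rfl⟩ := exists_kpoly_of_mem hη hx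
  have hβΛ : ∀ l, β l ∈ Λ := fun l => hβ.subset (Submodule.subset_span ⟨l, rfl⟩)
  have hsm : ∀ (q : k[X]) {y : KInfty k F K}, y ∈ Λ → q • y ∈ Λ := fun q y hy => by
    rw [← map_smul_eq (G := G)]
    exact Λ.smul_mem _ hy
  rw [Finset.smul_sum]
  refine Λ.sum_mem fun i _ => ?_
  rw [smul_comm, hkey]
  exact hsm _ (Λ.sum_mem fun l _ => hsm _ (hβΛ l))

/-- A quotient of lattices is finite: division with remainder by some `a ≠ 0` with `a E ≤ Λ`
provides representatives with coefficients of bounded degree. -/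
lemma IsLattice.finite_quotient [Module.Finite (KInf k) (KInfty k F K)]
    {Λ E : Submodule (GrpRing k G)[X] (KInfty k F K)} (hΛ : IsLattice Λ) (hE : IsLattice E)
    (h : Λ ≤ E) : Finite (E ⧸ Λ.submoduleOf E) := by
  obtain ⟨a, ha, haE⟩ := hΛ.exists_smul_mem hE h
  obtain ⟨η, hη⟩ := isLattice_iff.1 hE
  have hηE : ∀ l, η l ∈ E := fun l => hη.subset (Submodule.subset_span ⟨l, rfl⟩)
  have hsm : ∀ (q : k[X]) {y : KInfty k F K}, y ∈ E → q • y ∈ E := fun q y hy => by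
    rw [← map_smul_eq (G := G)]
    exact E.smul_mem _ hy
  let d := Module.finrank (KInf k) (KInfty k F K)
  let s : (Fin d → Polynomial.degreeLT k a.natDegree) → E := fun p =>
    ⟨∑ i, (p i : k[X]) • η i, E.sum_mem fun i _ => hsm _ (hηE i)⟩
  have : Finite (Polynomial.degreeLT k a.natDegree) :=
    Finite.of_equiv _ (Polynomial.degreeLTEquiv k a.natDegree).symm.toEquiv
  refine Finite.of_surjective (fun p => (Λ.submoduleOf E).mkQ (s p)) fun q => ?_
  obtain ⟨⟨x, hx⟩, rfl⟩ := (Λ.submoduleOf E).mkQ_surjective q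
  obtain ⟨p, hp⟩ := exists_kpoly_of_mem hη hx
  refine ⟨fun i => ⟨p i % a, Polynomial.mem_degreeLT.2 ?_⟩, ?_⟩
  · rw [← Polynomial.degree_eq_natDegree ha]
    exact Polynomial.degree_mod_lt _ ha
  · refine (Submodule.Quotient.eq _).2 (?_ : (∑ i, (p i % a) • η i) - x ∈ Λ)
    rw [← hp, ← Finset.sum_sub_distrib]
    refine Λ.sum_mem fun i _ => ?_
    have : (p i % a) • η i - p i • η i = a • (-(p i / a)) • η i := by
      rw [← sub_smul, smul_smul]
      congr 1
      rw [mul_neg]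
      exact sub_eq_iff_eq_add.2 (by
        rw [add_comm, ← sub_eq_add_neg]
        exact eq_sub_of_add_eq (EuclideanDomain.mod_add_div (p i) a))
    rw [this]
    exact haE _ (hsm _ (hηE i))

variable (G) in
/-- The lattice `a⁻¹ Λ`. -/
def invSmul (a : k[X]) (Λ : Submodule (GrpRing k G)[X] (KInfty k F K)) :
    Submodule (GrpRing k G)[X] (KInfty k F K) :=
  Λ.comap (a.map (algebraMap k (GrpRing k G)) • LinearMap.id)

lemma mem_invSmul {a : k[X]} {Λ : Submodule (GrpRing k G)[X] (KInfty k F K)} {x : KInfty k F K} :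
    x ∈ invSmul G a Λ ↔ a • x ∈ Λ := by
  rw [← map_smul_eq (G := G)]
  rfl

lemma isLattice_invSmul [Module.Finite (KInf k) (KInfty k F K)]
    {Λ : Submodule (GrpRing k G)[X] (KInfty k F K)} (hΛ : IsLattice Λ) {a : k[X]} (ha : a ≠ 0) :
    IsLattice (invSmul G a Λ) := by
  obtain ⟨β, hβ⟩ := isLattice_iff.1 hΛ
  have ha' : algebraMap k[X] (KInf k) a ≠ 0 := by
    intro h
    exact ha (polyToLaurent_injective k (h.trans (map_zero (polyToLaurent k)).symm))
  have hu : ∀ x : KInfty k F K, a • (algebraMap k[X] (KInf k) a)⁻¹ • x = x := fun x => by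
    rw [kpoly_smul_eq, smul_smul, mul_inv_cancel₀ ha', one_smul]
  have hu' : ∀ x : KInfty k F K, (algebraMap k[X] (KInf k) a)⁻¹ • a • x = x := fun x => by
    rw [kpoly_smul_eq, smul_smul, inv_mul_cancel₀ ha', one_smul]
  let β' := β.isUnitSMul (w := fun _ => (algebraMap k[X] (KInf k) a)⁻¹)
    fun _ => (isUnit_iff_ne_zero.2 (inv_ne_zero ha'))
  have hβ' : ∀ i, β' i = (algebraMap k[X] (KInf k) a)⁻¹ • β i := fun i =>
    Module.Basis.isUnitSMul_apply _ i
  refine isLattice_iff.2 ⟨β', Set.ext fun x => ?_⟩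
  rw [SetLike.mem_coe, SetLike.mem_coe, Submodule.mem_span_range_iff_exists_fun, mem_invSmul]
  constructor
  · rintro ⟨p, rfl⟩
    refine hβ.subset (?_ : _ ∈ Submodule.span k[X] (Set.range β))
    rw [Finset.smul_sum]
    refine Submodule.sum_mem _ fun i _ => ?_
    rw [hβ', smul_comm, hu]
    exact Submodule.smul_mem _ _ (Submodule.subset_span ⟨i, rfl⟩)
  · intro hx
    obtain ⟨p, hp⟩ := exists_kpoly_of_mem hβ hx
    refine ⟨p, ?_⟩
    rw [← hu' x, ← hp, Finset.smul_sum]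
    refine Finset.sum_congr rfl fun i _ => ?_
    rw [hβ', smul_comm]

/-- Projective `A[G]`-modules are projective over `R`. -/
lemma projective_restrict {S M : Type*} [CommRing S] [AddCommGroup M] [Module S[X] M] [Module S M]
    [IsScalarTower S S[X] M] [Module.Projective S[X] M] : Module.Projective S M := by
  obtain ⟨s, hs⟩ := (Module.projective_def (R := S[X]) (P := M)).1 inferInstance
  exact Module.Projective.of_split (s.restrictScalars S)
    ((Finsupp.linearCombination S[X] (id : M → M)).restrictScalars S)
    (LinearMap.ext fun m => hs m)

section FreeLattice

variable [Fintype G] {ι : Type*} [Fintype ι]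
  (e : Module.Basis ι (BigRing k G) (KInfty k F K))

include e in
lemma finite_kInfty : Module.Finite (KInf k) (KInfty k F K) :=
  Module.Finite.of_basis ((MonoidAlgebra.basis G (KInf k)).smulTower e)

/-- The `A[G]`-lattice generated by a basis of `K_∞` over `k((t⁻¹))[G]`. -/
def spanLattice : Submodule (GrpRing k G)[X] (KInfty k F K) :=
  Submodule.span (GrpRing k G)[X] (Set.range e)

variable {e}

omit [Fintype G] in
lemma mem_spanLattice_iff {x : KInfty k F K} :
    x ∈ spanLattice e ↔ ∃ p : ι → (GrpRing k G)[X], ∑ i, p i • e i = x :=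
  Submodule.mem_span_range_iff_exists_fun _

lemma toBig_injective : Function.Injective (toBig k G) := fun p q h => by
  refine polyL_injective ?_
  rw [← bigToL_toBig, ← bigToL_toBig, h]

variable (e)

lemma linearIndependent_bigBasis : LinearIndependent (GrpRing k G)[X] e := by
  rw [Fintype.linearIndependent_iff]
  intro p hp i
  have := Fintype.linearIndependent_iff.1 e.linearIndependent (fun i => toBig k G (p i)) hp i
  exact toBig_injective (this.trans (map_zero _).symm)

/-- The basis over `A[G]` of `spanLattice e`. -/
def spanBasis : Module.Basis ι (GrpRing k G)[X] (spanLattice e) :=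
  Module.Basis.span (linearIndependent_bigBasis e)

lemma coe_spanBasis (i : ι) : (spanBasis e i : KInfty k F K) = e i := by
  exact congrArg _ (Module.Basis.span_apply (linearIndependent_bigBasis e) i)

lemma isLattice_spanLattice : IsLattice (spanLattice e) := by
  classical
  have := finite_kInfty e
  let β := (MonoidAlgebra.basis G (KInf k)).smulTower e
  have hβ : ∀ g i, β (g, i) = (MonoidAlgebra.single g 1 : BigRing k G) • e i := fun g i => by
    rw [Module.Basis.smulTower_apply]
    congr 1
  have hcard : Fintype.card (G × ι) = Module.finrank (KInf k) (KInfty k F K) :=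
    (Module.finrank_eq_card_basis β).symm
  refine isLattice_iff.2 ⟨β.reindex (Fintype.equivFinOfCardEq hcard), ?_⟩
  rw [Module.Basis.range_reindex]
  refine Set.ext fun x => ⟨fun hx => ?_, fun hx => ?_⟩
  · refine Submodule.span_induction (p := fun x _ => x ∈ spanLattice e) ?_ (Submodule.zero_mem _)
      (fun _ _ _ _ => Submodule.add_mem _) ?_ hx
    · rintro _ ⟨⟨g, i⟩, rfl⟩
      rw [hβ, ← toBig_single, ← poly_smul_eq]
      exact Submodule.smul_mem _ _ (Submodule.subset_span ⟨i, rfl⟩)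
    · intro p x _ hx
      rw [← map_smul_eq (G := G)]
      exact Submodule.smul_mem _ _ hx
  · obtain ⟨p, rfl⟩ := mem_spanLattice_iff.1 hx
    refine Submodule.sum_mem _ fun i _ => ?_
    generalize p i = q
    induction q using Polynomial.induction_on' with
    | add q r hq hr => rw [add_smul]; exact Submodule.add_mem _ hq hr
    | monomial m r =>
      induction r using MonoidAlgebra.induction_linear with
      | zero => rw [map_zero, zero_smul]; exact Submodule.zero_mem _
      | add q r hq hr => rw [map_add, add_smul]; exact Submodule.add_mem _ hq hr
      | single g c =>
        have : (Polynomial.monomial m (MonoidAlgebra.single g c : GrpRing k G)) =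
            (Polynomial.monomial m c).map (algebraMap k (GrpRing k G)) *
              Polynomial.C (MonoidAlgebra.single g 1) := by
          rw [Polynomial.map_monomial, Polynomial.monomial_mul_C]
          congr 1
          simp [MonoidAlgebra.single_mul_single]
        rw [this, mul_smul, map_smul_eq, poly_smul_eq (Polynomial.C _), toBig_single]
        exact Submodule.smul_mem _ _ (Submodule.subset_span ⟨(g, i), hβ g i⟩)

end FreeLattice

end Lattices

/-! ### Overlattices in good position -/

section PolynomialPart

variable {R : Type*} [CommRing R]

lemma exists_coeff_eq_zero (x : LaurentSeries R) : ∃ m : ℤ, ∀ l < m, x.coeff l = 0 :=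
  ⟨x.order, fun _ hl => HahnSeries.coeff_eq_zero_of_lt_order hl⟩

/-- Every Laurent series in `t⁻¹` has a polynomial part. -/
lemma exists_polyL_sub (x : LaurentSeries R) :
    ∃ q : R[X], ∀ l ≤ 0, (x - polyL R q).coeff l = 0 := by
  classical
  obtain ⟨m, hm⟩ := exists_coeff_eq_zero x
  refine ⟨∑ n ∈ Finset.range (m.natAbs + 1), Polynomial.monomial n (x.coeff (-(n : ℤ))),
    fun l hl => ?_⟩
  obtain ⟨n, rfl⟩ : ∃ n : ℕ, l = -(n : ℤ) := ⟨l.natAbs, by omega⟩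
  rw [HahnSeries.coeff_sub, coeff_polyL, Polynomial.finsetSum_coeff]
  simp_rw [Polynomial.coeff_monomial]
  rw [Finset.sum_ite_eq' (Finset.range (m.natAbs + 1)) n]
  split_ifs with h
  · exact sub_self _
  · rw [hm _ (by rw [Finset.mem_range] at h; omega), sub_zero]

lemma coeff_mul_eq_zero {x y : LaurentSeries R} {a c : ℤ} (hx : ∀ l < a, x.coeff l = 0)
    (hy : ∀ l < c, y.coeff l = 0) : ∀ l < a + c, (x * y).coeff l = 0 := by
  intro l hl
  obtain ⟨p, rfl⟩ := exists_eq_uPow_mul_psL hx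
  obtain ⟨q, rfl⟩ := exists_eq_uPow_mul_psL hy
  rw [mul_mul_mul_comm, ← uPow_add, ← map_mul, coeff_uPow_mul, coeff_psL_of_neg _ (by omega)]

/-- A matrix over `R[[t⁻¹]]` congruent to `1` modulo `t⁻¹` is invertible; the inverse has the same
form. -/
lemma exists_inverse_one_add {ι : Type*} [Fintype ι] [DecidableEq ι] {N : ℕ} (hN : N ≠ 0)
    (Y : Matrix ι ι R⟦X⟧) : ∃ Y' : Matrix ι ι R⟦X⟧,
      (1 + (PowerSeries.X : R⟦X⟧) ^ N • Y) * (1 + (PowerSeries.X : R⟦X⟧) ^ N • Y') = 1 ∧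
      (1 + (PowerSeries.X : R⟦X⟧) ^ N • Y') * (1 + (PowerSeries.X : R⟦X⟧) ^ N • Y) = 1 := by
  set B := 1 + (PowerSeries.X : R⟦X⟧) ^ N • Y with hB
  have hc : B.map (PowerSeries.constantCoeff (R := R)) = 1 := by
    ext i j
    rw [Matrix.map_apply, hB, Matrix.add_apply, Matrix.smul_apply, map_add, smul_eq_mul, map_mul,
      map_pow, PowerSeries.constantCoeff_X, zero_pow hN, zero_mul, add_zero, Matrix.one_apply,
      Matrix.one_apply]
    split_ifs <;> simp
  have hdet : IsUnit B.det := by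
    refine isUnit_of_constantCoeff_eq_one ?_
    rw [RingHom.map_det]
    exact (congrArg Matrix.det hc).trans Matrix.det_one
  refine ⟨-(Y * B⁻¹), ?_⟩
  have h : 1 + (PowerSeries.X : R⟦X⟧) ^ N • -(Y * B⁻¹) = B⁻¹ := by
    have h1 := Matrix.mul_nonsing_inv B hdet
    nth_rewrite 1 [hB] at h1
    rw [add_mul, one_mul, Matrix.smul_mul] at h1
    rw [smul_neg, ← h1]
    abel
  rw [h]
  exact ⟨Matrix.mul_nonsing_inv B hdet, Matrix.nonsing_inv_mul B hdet⟩

end PolynomialPart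

open scoped Matrix

/-- The basis obtained from another one by an invertible matrix. -/
lemma exists_basis_of_matrix {S V ι : Type*} [CommRing S] [AddCommGroup V] [Module S V] [Fintype ι]
    [DecidableEq ι] (b : Module.Basis ι S V) {Z Z' : Matrix ι ι S} (h : Z * Z' = 1)
    (h' : Z' * Z = 1) :
    ∃ e : Module.Basis ι S V, (∀ i, e i = ∑ l, Z i l • b l) ∧ ∀ i, b i = ∑ l, Z' i l • e l := by
  have hc : ∀ w : ι → S, ∑ i, w i • ∑ l, Z i l • b l = ∑ l, (w ᵥ* Z) l • b l := fun w => by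
    simp_rw [Finset.smul_sum, smul_smul]
    rw [Finset.sum_comm]
    simp_rw [Matrix.vecMul, dotProduct, Finset.sum_smul]
  have hb : ∀ i, b i = ∑ l, Z' i l • ∑ m, Z l m • b m := fun i => by
    rw [hc fun l => Z' i l]
    have : ∀ m, ((fun l => Z' i l) ᵥ* Z) m = (1 : Matrix ι ι S) i m := fun m => by
      rw [← h', Matrix.mul_apply]
      rfl
    simp_rw [this]
    simp [Matrix.one_apply]
  refine ⟨Module.Basis.mk (v := fun i => ∑ l, Z i l • b l) ?_ ?_, fun i => by
    rw [Module.Basis.mk_apply], fun i => (hb i).trans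
    (Finset.sum_congr rfl fun l _ => by rw [Module.Basis.mk_apply])⟩
  · rw [Fintype.linearIndependent_iff]
    intro w hw
    rw [hc] at hw
    have h0 : w ᵥ* Z = 0 := funext (Fintype.linearIndependent_iff.1 b.linearIndependent _ hw)
    have : w = 0 := by rw [← Matrix.vecMul_one w, ← h, ← Matrix.vecMul_vecMul, h0,
      Matrix.zero_vecMul]
    exact fun i => congrFun this i
  · rw [← b.span_eq, Submodule.span_le]
    rintro _ ⟨i, rfl⟩
    rw [hb i]
    exact Submodule.sum_mem _ fun l _ => Submodule.smul_mem _ _ (Submodule.subset_span ⟨l, rfl⟩)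

section Good

variable {k : Type u} [Field k] [Finite k]
variable {F : Type u} [Field F] [Algebra (RatFunc k) F]
variable {K : Type u} [Field K] [Algebra (RatFunc k) K] [Algebra F K]
  [IsScalarTower (RatFunc k) F K]
variable {G : Type u} [CommGroup G] [MulSemiringAction G K] [IsGaloisGroup G F K] [Fintype G]

/-- The `k((t⁻¹))[G]`-linear form on `K_∞` whose coefficient at `1` is a given linear form. -/
def equivariantForm (φ : KInfty k F K →ₗ[KInf k] KInf k) :
    KInfty k F K →ₗ[BigRing k G] BigRing k G where
  toFun x := ∑ g : G, MonoidAlgebra.single g (φ (rhoInf k F K G g⁻¹ x))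
  map_add' x y := by
    simp_rw [map_add, MonoidAlgebra.single_add, Finset.sum_add_distrib]
  map_smul' z x := by
    classical
    rw [RingHom.id_apply, smul_eq_mul]
    induction z using MonoidAlgebra.induction_linear with
    | zero => simp
    | add z w hz hw =>
      rw [add_mul, ← hz, ← hw]
      simp_rw [add_smul, map_add, MonoidAlgebra.single_add, Finset.sum_add_distrib]
    | single h c =>
      ext g
      rw [MonoidAlgebra.coeff_single_mul_apply, coeff_sum_single, coeff_sum_single, single_smul,
        map_smul, map_smul, smul_eq_mul, mul_inv_rev, inv_inv, map_mul]
      rfl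

lemma coeff_equivariantForm (φ : KInfty k F K →ₗ[KInf k] KInf k) (x : KInfty k F K) (g : G) :
    (equivariantForm φ x : BigRing k G).coeff g = φ (rhoInf k F K G g⁻¹ x) :=
  coeff_sum_single (fun g => φ (rhoInf k F K G g⁻¹ x)) g

omit [Fintype G] in
lemma rhoInf_apply_eq (g : G) (x : KInfty k F K) :
    rhoInf k F K G g x = (MonoidAlgebra.single g 1 : BigRing k G) • x := by
  rw [single_smul, one_smul]

variable {ι : Type*}

/-- The `k((t⁻¹))`-linear form reading off the coefficient at `1` of a coordinate. -/
def coordOne (b : Module.Basis ι (BigRing k G) (KInfty k F K)) (i : ι) :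
    KInfty k F K →ₗ[KInf k] KInf k where
  toFun x := (b.repr x i).coeff 1
  map_add' x y := by
    rw [map_add, Finsupp.add_apply, MonoidAlgebra.coeff_add, Finsupp.add_apply]
  map_smul' c x := by
    have : b.repr (c • x) i = c • b.repr x i := by
      rw [← algebraMap_smul (BigRing k G) c x, map_smul, Finsupp.smul_apply, algebraMap_smul]
    rw [this]
    rfl

lemma equivariantForm_coordOne (b : Module.Basis ι (BigRing k G) (KInfty k F K)) (i : ι)
    (x : KInfty k F K) : equivariantForm (coordOne b i) x = b.repr x i := by
  ext g
  rw [coeff_equivariantForm, rhoInf_apply_eq]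
  change (b.repr (_ • x) i).coeff 1 = _
  rw [b.repr.map_smul, Finsupp.smul_apply, smul_eq_mul, MonoidAlgebra.coeff_single_mul_apply]
  simp

variable [Fintype ι] [DecidableEq ι]

/-- The matrix of coordinates of a basis. -/
def coordMat (b e : Module.Basis ι (BigRing k G) (KInfty k F K)) : Matrix ι ι (LRing k G) :=
  Matrix.of fun i l => coord b (e i) l

/-- A basis `e` is in good position with respect to `b`, at level `j` and to order `N`, if its
coordinates are `t^{1-j}` times a matrix that is congruent to `1` modulo `t^{-N}`. Then
`K_∞` is the direct sum of the lattice generated by `e` and of the `j`-th step of the filtration. -/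
def IsGood (b : Module.Basis ι (BigRing k G) (KInfty k F K)) (j : ℤ) (N : ℕ)
    (e : Module.Basis ι (BigRing k G) (KInfty k F K)) : Prop :=
  ∃ Y : Matrix ι ι (GrpRing k G)⟦X⟧, coordMat b e =
    uPow (GrpRing k G) (j - 1) •
      (1 + (PowerSeries.X : (GrpRing k G)⟦X⟧) ^ N • Y).map (psL (GrpRing k G))

omit [Fintype ι] [DecidableEq ι] [Finite k] in
lemma exists_lower_bound {κ : Type*} [Finite κ] (f : κ → KInf k) :
    ∃ m : ℤ, ∀ i, ∀ l < m, lcoeff (f i) l = 0 := by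
  choose m hm using fun i => exists_coeff_eq_zero (f i : LaurentSeries k)
  obtain ⟨c, hc⟩ := (Set.finite_range m).bddBelow
  exact ⟨c, fun i l hl => hm i l (hl.trans_le (hc ⟨i, rfl⟩))⟩

variable (G) in
omit [Fintype ι] [DecidableEq ι] in
lemma bigToL_algebraMap_single (m : ℤ) :
    bigToL k G (algebraMap (KInf k) (BigRing k G) (HahnSeries.single m 1 : LaurentSeries k)) =
      uPow (GrpRing k G) m := by
  ext l g
  rw [coeff_bigToL, coeff_coeffBig]
  let d : KInf k := (HahnSeries.single m 1 : LaurentSeries k)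
  change lcoeff ((MonoidAlgebra.single (1 : G) d : BigRing k G).coeff g) l = _
  classical
  rw [MonoidAlgebra.coeff_single, Finsupp.single_apply, HahnSeries.coeff_single]
  by_cases h : l = m
  · rw [if_pos h, MonoidAlgebra.one_def, MonoidAlgebra.coeff_single, Finsupp.single_apply]
    split_ifs
    · subst h; exact HahnSeries.coeff_single_same _ _
    · rfl
  · rw [if_neg h]
    split_ifs
    · exact HahnSeries.coeff_single_of_ne h
    · rfl

/-- Every lattice is contained in a free lattice in good position, at all sufficiently high
levels. -/
lemma exists_isGood (b : Module.Basis ι (BigRing k G) (KInfty k F K))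
    {Λ : Submodule (GrpRing k G)[X] (KInfty k F K)} (hΛ : IsLattice Λ) {N : ℕ} (hN : N ≠ 0) :
    ∃ j₀ : ℤ, ∀ j ≥ j₀, ∃ e : Module.Basis ι (BigRing k G) (KInfty k F K),
      IsGood b j N e ∧ Λ ≤ spanLattice e := by
  have := finite_kInfty b
  obtain ⟨β, hβ⟩ := isLattice_iff.1 hΛ
  -- lower bound for the coordinates of the conjugates of `b` with respect to `β`
  obtain ⟨m, hm⟩ := exists_lower_bound
    fun p : (ι × G) × Fin (Module.finrank (KInf k) (KInfty k F K)) =>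
      β.repr (rhoInf k F K G p.1.2⁻¹ (b p.1.1)) p.2
  refine ⟨N - m, fun j hj => ?_⟩
  let τ : KInf k := (HahnSeries.single (1 - j) 1 : LaurentSeries k)
  choose q hq using fun (c : ι) (l : Fin (Module.finrank (KInf k) (KInfty k F K))) =>
    exists_polyL_sub (τ * coordOne b c (β l) : LaurentSeries k)
  -- the form `φ c` takes polynomial values on the lattice and is close to a coordinate form
  let φ : ι → KInfty k F K →ₗ[KInf k] KInf k := fun c =>
    β.constr (KInf k) fun l => algebraMap k[X] (KInf k) (q c l)
  have hφ : ∀ c l, φ c (β l) = algebraMap k[X] (KInf k) (q c l) := fun c l =>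
    β.constr_basis (KInf k) _ l
  -- the difference of the two forms, which is small on the conjugates of `b`
  let ψ : ι → KInfty k F K →ₗ[KInf k] KInf k := fun c =>
    { toFun := fun x => τ * coordOne b c x - φ c x
      map_add' := fun x y => by rw [map_add, map_add, mul_add]; ring
      map_smul' := fun a x => by
        rw [map_smul, map_smul, smul_eq_mul, smul_eq_mul, RingHom.id_apply, smul_eq_mul]; ring }
  have hψ : ∀ c i (g : G), ∀ l < m + 1, lcoeff (ψ c (rhoInf k F K G g⁻¹ (b i))) l = 0 := by
    intro c i g l hl
    rw [← β.sum_repr (rhoInf k F K G g⁻¹ (b i)), map_sum, lcoeff_sum]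
    refine Finset.sum_eq_zero fun s _ => ?_
    rw [map_smul, smul_eq_mul]
    refine coeff_mul_eq_zero (R := k) (hm ((i, g), s)) (c := 1) (fun l' hl' => ?_) l hl
    change lcoeff (τ * coordOne b c (β s) - φ c (β s)) l' = 0
    rw [hφ]
    exact hq c s l' (by omega)
  have hF : ∀ i c, ∃ p : (GrpRing k G)⟦X⟧, bigToL k G (equivariantForm (ψ c) (b i)) =
      uPow (GrpRing k G) (m + 1) * psL (GrpRing k G) p := fun i c => by
    refine exists_eq_uPow_mul_psL fun l hl => ?_
    rw [coeff_bigToL]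
    ext g
    rw [coeff_coeffBig, coeff_equivariantForm, hψ c i g l hl]
    rfl
  choose p hp using hF
  -- the inverse `Zm` of the matrix `Fm` of the equivariant forms on `b` is the matrix of the new
  -- basis
  let Y₀ : Matrix ι ι (GrpRing k G)⟦X⟧ :=
    Matrix.of fun i c => -(PowerSeries.X ^ (m + j - N).toNat * p i c)
  have hY₀ : ∀ i c, Y₀ i c = -(PowerSeries.X ^ (m + j - N).toNat * p i c) := fun _ _ => rfl
  let Fm : Matrix ι ι (BigRing k G) := Matrix.of fun i c => equivariantForm (φ c) (b i)
  have hFm : Fm.map (bigToL k G) = uPow (GrpRing k G) (1 - j) •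
      (1 + (PowerSeries.X : (GrpRing k G)⟦X⟧) ^ N • Y₀).map (psL (GrpRing k G)) := by
    ext1 i c
    have h1 : equivariantForm (φ c) (b i) = algebraMap (KInf k) (BigRing k G) τ * b.repr (b i) c -
        equivariantForm (ψ c) (b i) := by
      rw [← equivariantForm_coordOne]
      ext g
      have h2 : ∀ (y : BigRing k G) (g : G),
          (algebraMap (KInf k) (BigRing k G) τ * y).coeff g = τ * y.coeff g := fun y g => by
        rw [← Algebra.smul_def]
        rfl
      rw [MonoidAlgebra.coeff_sub, Finsupp.sub_apply, h2, coeff_equivariantForm,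
        coeff_equivariantForm, coeff_equivariantForm]
      exact (sub_sub_cancel (τ * coordOne b c (rhoInf k F K G g⁻¹ (b i))) _).symm
    change bigToL k G (equivariantForm (φ c) (b i)) = _
    rw [h1, map_sub, map_mul, hp, bigToL_algebraMap_single,
      Matrix.smul_apply, Matrix.map_apply, Matrix.add_apply, Matrix.smul_apply, hY₀,
      smul_eq_mul, smul_eq_mul, mul_neg, map_add, map_neg, map_mul, map_mul, ← uPow_natCast,
      ← uPow_natCast, mul_add, mul_neg, ← mul_assoc, ← mul_assoc, ← uPow_add, ← uPow_add,
      ← sub_eq_add_neg, b.repr_self, Finsupp.single_apply, Matrix.one_apply]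
    congr 2
    · split_ifs <;> simp
    · congr 1
      omega
  obtain ⟨Y, hY, hY'⟩ := exists_inverse_one_add hN Y₀
  have hmap : ∀ A B : Matrix ι ι (GrpRing k G)⟦X⟧, A * B = 1 →
      A.map (psL (GrpRing k G)) * B.map (psL (GrpRing k G)) = 1 := fun A B h => by
    rw [← Matrix.map_mul, h]
    exact Matrix.map_one _ (map_zero _) (map_one _)
  let ZL : Matrix ι ι (LRing k G) := uPow (GrpRing k G) (j - 1) •
      (1 + (PowerSeries.X : (GrpRing k G)⟦X⟧) ^ N • Y).map (psL (GrpRing k G))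
  let Zm : Matrix ι ι (BigRing k G) := ZL.map (bigToL k G).symm
  have hZm : Zm.map (bigToL k G) = ZL := by
    ext1 i c
    exact (bigToL k G).apply_symm_apply _
  have hinj : ∀ A B : Matrix ι ι (BigRing k G),
      A.map (bigToL k G) * B.map (bigToL k G) = 1 → A * B = 1 := fun A B h => by
    have h1 : (A * B).map (bigToL k G) = (1 : Matrix ι ι (BigRing k G)).map (bigToL k G) := by
      rw [Matrix.map_mul, h, Matrix.map_one _ (map_zero _) (map_one _)]
    ext1 i c
    exact (bigToL k G).injective (congrFun (congrFun h1 i) c)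
  have hZF : Zm * Fm = 1 := hinj _ _ (by
    rw [hZm, hFm, Matrix.smul_mul, Matrix.mul_smul, smul_smul, hmap _ _ hY', ← uPow_add]
    simp)
  have hFZ : Fm * Zm = 1 := hinj _ _ (by
    rw [hZm, hFm, Matrix.smul_mul, Matrix.mul_smul, smul_smul, hmap _ _ hY, ← uPow_add]
    simp)
  obtain ⟨e, he, hbe⟩ := exists_basis_of_matrix b hZF hFZ
  refine ⟨e, ⟨Y, ?_⟩, fun x hx => ?_⟩
  · ext1 i c
    change coord b (e i) c = _
    rw [he, coord_sum]
    simp_rw [coord_smul, coord_basis]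
    simp only [mul_ite, mul_one, mul_zero, Finset.sum_ite_eq', Finset.mem_univ, if_true]
    exact congrFun (congrFun hZm i) c
  -- the coordinates in the new basis are the equivariant forms, which are polynomial on `Λ`
  · have hx1 : x = ∑ c, (equivariantForm (φ c) x : BigRing k G) • e c := by
      conv_lhs => rw [← b.sum_repr x]
      simp_rw [hbe, Finset.smul_sum, smul_smul]
      rw [Finset.sum_comm]
      refine Finset.sum_congr rfl fun c _ => ?_
      rw [← Finset.sum_smul]
      congr 1
      conv_rhs => rw [← b.sum_repr x, map_sum]
      exact Finset.sum_congr rfl fun i _ => by rw [map_smul, smul_eq_mul]; rfl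
    have hpoly : ∀ c, ∃ r : (GrpRing k G)[X], toBig k G r = equivariantForm (φ c) x := by
      intro c
      have : ∀ g : G, ∃ r : k[X], algebraMap k[X] (KInf k) r = φ c (rhoInf k F K G g⁻¹ x) := by
        intro g
        have hgx : rhoInf k F K G g⁻¹ x ∈ Λ := by
          rw [rhoInf_apply_eq, ← toBig_single, ← poly_smul_eq]
          exact Λ.smul_mem _ hx
        obtain ⟨s, hs⟩ := exists_kpoly_of_mem hβ hgx
        refine ⟨∑ l : Fin (Module.finrank (KInf k) (KInfty k F K)), s l * q c l, ?_⟩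
        rw [← hs, map_sum, map_sum]
        refine Finset.sum_congr rfl fun l _ => ?_
        rw [kpoly_smul_eq, map_smul, hφ, map_mul, smul_eq_mul]
      choose r hr using this
      refine ⟨∑ g : G, (r g).map (algebraMap k (GrpRing k G)) *
        Polynomial.C (MonoidAlgebra.single g 1), ?_⟩
      rw [map_sum]
      refine Finset.sum_congr rfl fun g _ => ?_
      rw [map_mul, toBig_map, toBig_single, ← hr, ← Algebra.smul_def, MonoidAlgebra.smul_single,
        smul_eq_mul, mul_one]
    choose r hr using hpoly
    refine mem_spanLattice_iff.2 ⟨r, ?_⟩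
    rw [hx1]
    exact Finset.sum_congr rfl fun c _ => by rw [← hr, ← poly_smul_eq]

end Good

/-! ### Covolumes and indices of lattices -/

section Decomposition

variable {k : Type u} [Field k] [Finite k]
variable {F : Type u} [Field F] [Algebra (RatFunc k) F]
variable {K : Type u} [Field K] [Algebra (RatFunc k) K] [Algebra F K]
  [IsScalarTower (RatFunc k) F K]
variable {G : Type u} [CommGroup G] [MulSemiringAction G K] [IsGaloisGroup G F K] [Fintype G]
variable {ι : Type*} [Fintype ι] [DecidableEq ι]
variable {b e : Module.Basis ι (BigRing k G) (KInfty k F K)} {j : ℤ} {N : ℕ}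

lemma coeff_sum_eq_zero {R κ : Type*} [CommRing R] (s : Finset κ) {f : κ → LaurentSeries R} {d : ℤ}
    (h : ∀ i ∈ s, ∀ l < d, (f i).coeff l = 0) : ∀ l < d, (∑ i ∈ s, f i).coeff l = 0 := by
  intro l hl
  rw [HahnSeries.coeff_sum]
  exact Finset.sum_eq_zero fun i hi => h i hi l hl

omit [DecidableEq ι] in
lemma coord_eq_sum (b e : Module.Basis ι (BigRing k G) (KInfty k F K)) (x : KInfty k F K) (l : ι) :
    coord b x l = ∑ i, coord e x i * coordMat b e i l := by
  conv_lhs => rw [← e.sum_repr x, coord_sum]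
  exact Finset.sum_congr rfl fun i _ => coord_smul _ _ _ _

lemma coordMat_mul (b e : Module.Basis ι (BigRing k G) (KInfty k F K)) :
    coordMat e b * coordMat b e = 1 := by
  ext1 i l
  rw [Matrix.mul_apply, Matrix.one_apply, ← coord_basis b i l, coord_eq_sum b e]
  rfl

lemma IsGood.coordMat_symm (he : IsGood b j N e) (hN : N ≠ 0) :
    ∃ Y : Matrix ι ι (GrpRing k G)⟦X⟧, coordMat e b = uPow (GrpRing k G) (1 - j) •
      (1 + (PowerSeries.X : (GrpRing k G)⟦X⟧) ^ N • Y).map (psL (GrpRing k G)) := by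
  obtain ⟨Y, hY⟩ := he
  obtain ⟨Y', h, -⟩ := exists_inverse_one_add hN Y
  refine ⟨Y', ?_⟩
  have h1 : coordMat b e * (uPow (GrpRing k G) (1 - j) •
      (1 + (PowerSeries.X : (GrpRing k G)⟦X⟧) ^ N • Y').map (psL (GrpRing k G))) = 1 := by
    rw [hY, Matrix.smul_mul, Matrix.mul_smul, smul_smul, ← Matrix.map_mul, h, ← uPow_add,
      Matrix.map_one _ (map_zero _) (map_one _)]
    simp
  exact left_inv_eq_right_inv (coordMat_mul b e) h1

omit [DecidableEq ι] in
lemma filt_eq_of_coordMat {Y : Matrix ι ι (GrpRing k G)⟦X⟧} {m : ℤ}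
    (h : coordMat b e = uPow (GrpRing k G) m • Y.map (psL (GrpRing k G))) (l : ℤ) :
    filt e l ≤ filt b (l + m) := by
  intro x hx i
  rw [coord_eq_sum b e]
  refine coeff_sum_eq_zero _ fun s _ => coeff_mul_eq_zero (hx s) fun l' hl' => ?_
  rw [h, Matrix.smul_apply, Matrix.map_apply, smul_eq_mul, coeff_uPow_mul,
    coeff_psL_of_neg _ (by omega)]

lemma IsGood.filt_eq (he : IsGood b j N e) (hN : N ≠ 0) (l : ℤ) :
    filt b l = filt e (l - j + 1) := by
  obtain ⟨Y', hY'⟩ := he.coordMat_symm hN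
  obtain ⟨Y, hY⟩ := he
  refine le_antisymm ?_ ?_
  · have := filt_eq_of_coordMat hY' l
    rwa [show l + (1 - j) = l - j + 1 by ring] at this
  · have := filt_eq_of_coordMat hY (l - j + 1)
    rwa [show l - j + 1 + (j - 1) = l by ring] at this

omit [DecidableEq ι] in
lemma coord_sum_smul (e : Module.Basis ι (BigRing k G) (KInfty k F K))
    (p : ι → (GrpRing k G)[X]) (i : ι) : coord e (∑ l, p l • e l) i = polyL _ (p i) := by
  classical
  rw [coord_sum]
  simp_rw [coord_poly_smul, coord_basis]
  simp

omit [DecidableEq ι] in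
/-- The lattice generated by a basis `e` is a complement of the elements whose coordinates with
respect to `e` lie in `t⁻¹ R[[t⁻¹]]`. -/
lemma exists_sub_mem_filt_one (e : Module.Basis ι (BigRing k G) (KInfty k F K))
    (x : KInfty k F K) : ∃ y ∈ spanLattice e, x - y ∈ filt e 1 := by
  choose p hp using fun i => exists_polyL_sub (coord e x i)
  refine ⟨∑ i, p i • e i, mem_spanLattice_iff.2 ⟨p, rfl⟩, fun i l hl => ?_⟩
  rw [coord_sub, coord_sum_smul]
  exact hp i l (by omega)

omit [DecidableEq ι] in
lemma eq_zero_of_mem_filt_one (e : Module.Basis ι (BigRing k G) (KInfty k F K))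
    {x : KInfty k F K} (hx : x ∈ spanLattice e) (hx' : x ∈ filt e 1) : x = 0 := by
  obtain ⟨p, rfl⟩ := mem_spanLattice_iff.1 hx
  refine Finset.sum_eq_zero fun i _ => ?_
  have : p i = 0 := by
    ext1 m
    rw [← coeff_polyL, ← coord_sum_smul e p, hx' i _ (by omega), Polynomial.coeff_zero]
  rw [this, zero_smul]

lemma IsGood.exists_sub_mem (he : IsGood b j N e) (hN : N ≠ 0) (x : KInfty k F K) :
    ∃ y ∈ spanLattice e, x - y ∈ filt b j := by
  rw [he.filt_eq hN, sub_self, zero_add]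
  exact exists_sub_mem_filt_one e x

lemma IsGood.eq_zero (he : IsGood b j N e) (hN : N ≠ 0) {x : KInfty k F K}
    (hx : x ∈ spanLattice e) (hx' : x ∈ filt b j) : x = 0 := by
  rw [he.filt_eq hN, sub_self, zero_add] at hx'
  exact eq_zero_of_mem_filt_one e hx hx'

lemma IsGood.det_eq (he : IsGood b j N e) (hN : N ≠ 0) : ∃ p : (GrpRing k G)⟦X⟧,
    PowerSeries.constantCoeff p = 1 ∧
    (coordMat b e).det = uPow (GrpRing k G) (Fintype.card ι * (j - 1)) * psL _ p := by
  obtain ⟨Y, hY⟩ := he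
  refine ⟨(1 + (PowerSeries.X : (GrpRing k G)⟦X⟧) ^ N • Y).det, ?_, ?_⟩
  · rw [RingHom.map_det, RingHom.mapMatrix_apply]
    have : (1 + (PowerSeries.X : (GrpRing k G)⟦X⟧) ^ N • Y).map
        (PowerSeries.constantCoeff (R := GrpRing k G)) = 1 := by
      ext1 i j
      rw [Matrix.map_apply, Matrix.add_apply, Matrix.smul_apply, map_add, smul_eq_mul, map_mul,
        map_pow, PowerSeries.constantCoeff_X, zero_pow hN, zero_mul, add_zero, Matrix.one_apply,
        Matrix.one_apply]
      split_ifs <;> simp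
    exact (congrArg Matrix.det this).trans Matrix.det_one
  · rw [hY, Matrix.det_smul, uPow_pow, RingHom.map_det]
    rfl

lemma IsGood.lMonic_det (he : IsGood b j N e) (hN : N ≠ 0) : LMonic (coordMat b e).det := by
  obtain ⟨p, hp, h⟩ := he.det_eq hN
  rw [h]
  exact lMonic_uPow_mul_psL _ hp

lemma isUnit_det_coordMat (b e : Module.Basis ι (BigRing k G) (KInfty k F K)) :
    IsUnit (coordMat b e).det :=
  (Matrix.isUnit_iff_isUnit_det _).1 (IsUnit.of_mul_eq_one_right _ (coordMat_mul b e))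

/-- The matrix of coordinates of a family of elements. -/
def famMat {κ : Type*} (b : Module.Basis ι (BigRing k G) (KInfty k F K))
    (e : κ → KInfty k F K) : Matrix κ ι (LRing k G) :=
  Matrix.of fun i l => coord b (e i) l

end Decomposition

section Size

variable {k : Type u} [Field k] [Finite k] {G : Type u} [CommGroup G] [Fintype G]
  {V : Type u} [AddCommGroup V] [Module (GrpRing k G)[X] V] [Module (GrpRing k G) V]
  [IsScalarTower (GrpRing k G) (GrpRing k G)[X] V]

omit [Finite k] in
lemma projective_submoduleOf {Λ E : Submodule (GrpRing k G)[X] V} (h : Λ ≤ E)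
    [Module.Projective (GrpRing k G) Λ] [Module.Projective (GrpRing k G) E] :
    Module.Projective (GrpRing k G) (E ⧸ Λ.submoduleOf E) := by
  have h1 : Module.Projective (GrpRing k G) ((Λ.submoduleOf E).restrictScalars (GrpRing k G)) :=
    Module.Projective.of_equiv
      ((Submodule.submoduleOfEquivOfLe h).symm.restrictScalars (GrpRing k G))
  have h2 := projective_quotient ((Λ.submoduleOf E).restrictScalars (GrpRing k G))
  exact Module.Projective.of_equiv (Submodule.Quotient.restrictScalarsEquiv _ _)

/-- Multiplicativity of sizes in a chain of submodules. -/
lemma gsize_quotient_mul {Λ E E' : Submodule (GrpRing k G)[X] V} (h : Λ ≤ E) (h' : E ≤ E')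
    [Module.Projective (GrpRing k G) Λ] [Module.Projective (GrpRing k G) E]
    [Module.Projective (GrpRing k G) E'] [Finite (E ⧸ Λ.submoduleOf E)]
    [Finite (E' ⧸ E.submoduleOf E')] [Finite (E' ⧸ Λ.submoduleOf E')] :
    gsize (k := k) (G := G) (E' ⧸ Λ.submoduleOf E') =
      gsize (k := k) (G := G) (E ⧸ Λ.submoduleOf E) *
        gsize (k := k) (G := G) (E' ⧸ E.submoduleOf E') := by
  have := projective_submoduleOf h
  have := projective_submoduleOf h'
  have := projective_submoduleOf (h.trans h')
  have hle : Λ.submoduleOf E' ≤ E.submoduleOf E' := fun x hx => h hx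
  have hle' : Λ.submoduleOf E ≤ (Λ.submoduleOf E').comap (Submodule.inclusion h') :=
    fun x hx => hx
  refine gsize_eq_mul_of_exact
    ((Λ.submoduleOf E).mapQ (Λ.submoduleOf E') (Submodule.inclusion h') hle')
    (Submodule.factor hle) ?_ (Submodule.factor_surjective hle) ?_
  · refine (injective_iff_map_eq_zero _).2 fun x hx => ?_
    obtain ⟨x, rfl⟩ := Submodule.Quotient.mk_surjective _ x
    have h1 : Submodule.inclusion h' x ∈ Λ.submoduleOf E' := (Submodule.Quotient.mk_eq_zero _).1 hx
    exact (Submodule.Quotient.mk_eq_zero _).2 h1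
  · intro x
    obtain ⟨x, rfl⟩ := Submodule.Quotient.mk_surjective _ x
    change (Submodule.Quotient.mk x : E' ⧸ E.submoduleOf E') = 0 ↔ _
    rw [Submodule.Quotient.mk_eq_zero]
    constructor
    · intro hx
      exact ⟨Submodule.Quotient.mk ⟨x, hx⟩, rfl⟩
    · rintro ⟨y, hy⟩
      obtain ⟨y, rfl⟩ := Submodule.Quotient.mk_surjective _ y
      have h1 := (Submodule.Quotient.eq _).1 hy
      have h2 : (y : V) - x ∈ Λ := h1
      have h3 := E.sub_mem y.2 (h h2)
      rwa [sub_sub_cancel] at h3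

end Size

section Covolume

variable {k : Type u} [Field k] [Finite k]
variable {F : Type u} [Field F] [Algebra (RatFunc k) F]
variable {K : Type u} [Field K] [Algebra (RatFunc k) K] [Algebra F K]
  [IsScalarTower (RatFunc k) F K]
variable {G : Type u} [CommGroup G] [MulSemiringAction G K] [IsGaloisGroup G F K] [Fintype G]
variable {n : ℕ} {b : Module.Basis (Fin n) (BigRing k G) (KInfty k F K)}

/-- `c` is a covolume of the lattice `Λ`: the determinant of a basis of a free lattice `E ⊇ Λ`,
times the size of `E/Λ`. -/
def IsCovol (b : Module.Basis (Fin n) (BigRing k G) (KInfty k F K))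
    (Λ : Submodule (GrpRing k G)[X] (KInfty k F K)) (c : LRing k G) : Prop :=
  ∃ (E : Submodule (GrpRing k G)[X] (KInfty k F K)) (e : Module.Basis (Fin n) (GrpRing k G)[X] E),
    IsLattice E ∧ Λ ≤ E ∧
    c = (famMat b fun i => (e i : KInfty k F K)).det *
      polyL _ (gsize (k := k) (G := G) (E ⧸ Λ.submoduleOf E))

omit [Fintype G] in
lemma IsProjLattice.projective {Λ : Submodule (GrpRing k G)[X] (KInfty k F K)}
    (h : IsProjLattice Λ) : Module.Projective (GrpRing k G) Λ :=
  have := h.2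
  projective_restrict

lemma projective_of_basis {S M κ : Type*} [CommRing S] [AddCommGroup M] [Module S[X] M] [Module S M]
    [IsScalarTower S S[X] M] (e : Module.Basis κ S[X] M) : Module.Projective S M :=
  have := Module.Projective.of_basis e
  projective_restrict

/-- Generators of the same principal ideal differ by a unit of `R[X]` if one of them is invertible
in `R((t⁻¹))`. -/
lemma isUnit_of_span_eq {R : Type*} [CommRing R] {x y : R[X]} (hx : IsUnit (polyL R x))
    (h : Ideal.span {x} = Ideal.span {y}) : ∃ v : R[X], IsUnit v ∧ x = y * v := by
  obtain ⟨v, hv⟩ := Ideal.mem_span_singleton'.1 (h ▸ Ideal.mem_span_singleton_self x)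
  obtain ⟨w, hw⟩ := Ideal.mem_span_singleton'.1 (h.symm ▸ Ideal.mem_span_singleton_self y)
  refine ⟨v, IsUnit.of_mul_eq_one w (polyL_injective (hx.mul_right_cancel ?_)),
    by rw [← hv, mul_comm]⟩
  rw [← map_mul, ← map_mul, mul_assoc, hw, hv, one_mul]

/-- Replacing the free overlattice `E` of `Λ` by a larger one changes the covolume by a unit of
`A[G]`. -/
lemma covol_compare {Λ E : Submodule (GrpRing k G)[X] (KInfty k F K)} (hΛ : IsProjLattice Λ)
    (hE : IsLattice E) (hΛE : Λ ≤ E) (e : Module.Basis (Fin n) (GrpRing k G)[X] E)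
    {e' : Module.Basis (Fin n) (BigRing k G) (KInfty k F K)} (hEe' : E ≤ spanLattice e') :
    ∃ v : (GrpRing k G)[X], IsUnit v ∧ (coordMat b e').det *
        polyL _ (gsize (k := k) (G := G) (spanLattice e' ⧸ Λ.submoduleOf (spanLattice e'))) =
      (famMat b fun i => (e i : KInfty k F K)).det *
        polyL _ (gsize (k := k) (G := G) (E ⧸ Λ.submoduleOf E)) * polyL _ v := by
  have := finite_kInfty b
  have hE' := isLattice_spanLattice e'
  have := hΛ.1.finite_quotient hE hΛE
  have := hE.finite_quotient hE' hEe'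
  have := hΛ.1.finite_quotient hE' (hΛE.trans hEe')
  have := hΛ.projective
  have := projective_of_basis e
  have := projective_of_basis (spanBasis e')
  choose p hp using fun i => mem_spanLattice_iff.1 (hEe' (e i).2)
  let P : Matrix (Fin n) (Fin n) (GrpRing k G)[X] := Matrix.of p
  have hfitt := fitt_quotient_of_bases e (spanBasis e') P fun i => by
    simp_rw [coe_spanBasis]
    exact (hp i).symm
  have := projective_submoduleOf hEe'
  obtain ⟨-, hu, hs⟩ := gsize_spec (k := k) (G := G) (spanLattice e' ⧸ E.submoduleOf (spanLattice e'))
  obtain ⟨v, hv, h⟩ := isUnit_of_span_eq hu (hs.trans hfitt)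
  have hmat : (famMat b fun i => (e i : KInfty k F K)) = P.map (polyL _) * coordMat b e' := by
    ext1 i l
    rw [Matrix.mul_apply]
    change coord b (e i) l = _
    rw [coord_eq_sum b e', ← hp]
    simp_rw [coord_sum_smul]
    rfl
  have hdet : (P.map (polyL (GrpRing k G))).det = polyL _ P.det := (RingHom.map_det _ P).symm
  refine ⟨v, hv, ?_⟩
  rw [gsize_quotient_mul hΛE hEe', h, hmat, Matrix.det_mul, hdet, map_mul, map_mul]
  ring

include b in
/-- Two overlattices of `Λ` are contained in a common free lattice, namely in an overlattice of
`a⁻¹ Λ` for some `a ≠ 0`. -/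
lemma exists_isGood_of_le {Λ E E₁ : Submodule (GrpRing k G)[X] (KInfty k F K)} (hΛ : IsLattice Λ)
    (hE : IsLattice E) (hΛE : Λ ≤ E) (hE₁ : IsLattice E₁) (hΛE₁ : Λ ≤ E₁) :
    ∃ e' : Module.Basis (Fin n) (BigRing k G) (KInfty k F K),
      E ≤ spanLattice e' ∧ E₁ ≤ spanLattice e' := by
  have := finite_kInfty b
  obtain ⟨a, ha, h⟩ := hΛ.exists_smul_mem hE hΛE
  obtain ⟨a', ha', h'⟩ := hΛ.exists_smul_mem hE₁ hΛE₁
  obtain ⟨j, hj⟩ := exists_isGood b (isLattice_invSmul hΛ (mul_ne_zero ha ha')) one_ne_zero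
  obtain ⟨e', -, he'⟩ := hj j le_rfl
  have hsm : ∀ (q : k[X]) {y : KInfty k F K}, y ∈ Λ → q • y ∈ Λ := fun q y hy => by
    rw [← map_smul_eq (G := G)]
    exact Λ.smul_mem _ hy
  refine ⟨e', fun x hx => he' (mem_invSmul.2 ?_), fun x hx => he' (mem_invSmul.2 ?_)⟩
  · rw [mul_comm, mul_smul]
    exact hsm _ (h x hx)
  · rw [mul_smul]
    exact hsm _ (h' x hx)

/-- The covolume of a projective lattice is well defined up to units of `A[G]`. -/
lemma IsCovol.eq_mul_unit {Λ : Submodule (GrpRing k G)[X] (KInfty k F K)} (hΛ : IsProjLattice Λ)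
    {c c' : LRing k G} (h : IsCovol b Λ c) (h' : IsCovol b Λ c') :
    ∃ v : (GrpRing k G)[X], IsUnit v ∧ c = c' * polyL _ v := by
  obtain ⟨E, e, hE, hΛE, rfl⟩ := h
  obtain ⟨E', e', hE', hΛE', rfl⟩ := h'
  obtain ⟨e'', h₁, h₂⟩ := exists_isGood_of_le (b := b) hΛ.1 hE hΛE hE' hΛE'
  obtain ⟨v, ⟨v, rfl⟩, h₃⟩ := covol_compare (b := b) hΛ hE hΛE e h₁
  obtain ⟨w, hw, h₄⟩ := covol_compare (b := b) hΛ hE' hΛE' e' h₂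
  refine ⟨w * (v⁻¹ : ((GrpRing k G)[X])ˣ), hw.mul (Units.isUnit _), ?_⟩
  rw [map_mul, ← mul_assoc, ← h₄, h₃, mul_assoc _ (polyL _ _) (polyL _ _), ← map_mul,
    Units.mul_inv, map_one, mul_one]

lemma isCovol_of_isGood {Λ : Submodule (GrpRing k G)[X] (KInfty k F K)}
    {e : Module.Basis (Fin n) (BigRing k G) (KInfty k F K)} (hΛe : Λ ≤ spanLattice e) :
    IsCovol b Λ ((coordMat b e).det *
      polyL _ (gsize (k := k) (G := G) (spanLattice e ⧸ Λ.submoduleOf (spanLattice e)))) := by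
  refine ⟨spanLattice e, spanBasis e, isLattice_spanLattice e, hΛe, ?_⟩
  simp_rw [coe_spanBasis]
  rfl

lemma quotient_spec {Λ E : Submodule (GrpRing k G)[X] (KInfty k F K)}
    [Module.Finite (KInf k) (KInfty k F K)] (hΛ : IsProjLattice Λ)
    (hE : IsLattice E) [Module.Projective (GrpRing k G) E] (hΛE : Λ ≤ E) :
    LMonic (polyL _ (gsize (k := k) (G := G) (E ⧸ Λ.submoduleOf E))) ∧
      IsUnit (polyL _ (gsize (k := k) (G := G) (E ⧸ Λ.submoduleOf E))) := by
  have := hΛ.1.finite_quotient hE hΛE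
  have := hΛ.projective
  have := projective_submoduleOf hΛE
  obtain ⟨h, h', -⟩ := gsize_spec (k := k) (G := G) (E ⧸ Λ.submoduleOf E)
  exact ⟨h, h'⟩

/-- A good overlattice computes a monic covolume. -/
lemma monic_covol_of_isGood {Λ : Submodule (GrpRing k G)[X] (KInfty k F K)} (hΛ : IsProjLattice Λ)
    {j : ℤ} {N : ℕ} (hN : N ≠ 0)
    {e : Module.Basis (Fin n) (BigRing k G) (KInfty k F K)} (he : IsGood b j N e)
    (hΛe : Λ ≤ spanLattice e) :
    LMonic ((coordMat b e).det *
      polyL _ (gsize (k := k) (G := G) (spanLattice e ⧸ Λ.submoduleOf (spanLattice e)))) ∧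
    IsUnit ((coordMat b e).det *
      polyL _ (gsize (k := k) (G := G) (spanLattice e ⧸ Λ.submoduleOf (spanLattice e)))) := by
  have := finite_kInfty b
  have := projective_of_basis (spanBasis e)
  obtain ⟨h, h'⟩ := quotient_spec hΛ (isLattice_spanLattice e) hΛe
  exact ⟨(he.lMonic_det hN).mul h, (isUnit_det_coordMat b e).mul h'⟩

lemma IsCovol.isUnit {Λ : Submodule (GrpRing k G)[X] (KInfty k F K)} (hΛ : IsProjLattice Λ)
    {c : LRing k G} (h : IsCovol b Λ c) : IsUnit c := by
  obtain ⟨j, hj⟩ := exists_isGood b hΛ.1 one_ne_zero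
  obtain ⟨e, he, hΛe⟩ := hj j le_rfl
  obtain ⟨v, hv, h'⟩ := h.eq_mul_unit hΛ (isCovol_of_isGood hΛe)
  rw [h']
  exact (monic_covol_of_isGood hΛ one_ne_zero he hΛe).2.mul (hv.map _)

end Covolume

section Index

variable {k : Type u} [Field k] [Finite k]
variable {F : Type u} [Field F] [Algebra (RatFunc k) F]
variable {K : Type u} [Field K] [Algebra (RatFunc k) K] [Algebra F K]
  [IsScalarTower (RatFunc k) F K]
variable {G : Type u} [CommGroup G] [MulSemiringAction G K] [IsGaloisGroup G F K] [Fintype G]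
variable (b : Module.Basis (Fin (Module.finrank (RatFunc k) F)) (BigRing k G) (KInfty k F K))

lemma isUnit_of_bigToL {z : BigRing k G} (h : IsUnit (bigToL k G z)) : IsUnit z := by
  have := h.map (bigToL k G).symm
  rwa [RingEquiv.symm_apply_apply] at this

lemma bigToL_mul_inverse {z : BigRing k G} (h : IsUnit (bigToL k G z)) :
    bigToL k G z * bigToL k G (Ring.inverse z) = 1 := by
  rw [← map_mul, Ring.mul_inverse_cancel _ (isUnit_of_bigToL h), map_one]

/-- A lattice index in the sense of any choice of free overlattices is the quotient of the monic
covolumes. -/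
lemma index_spec {Λ Λ₀ : Submodule (GrpRing k G)[X] (KInfty k F K)} (hΛ : IsProjLattice Λ)
    (hΛ₀ : IsProjLattice Λ₀) {z : BigRing k G} (hz : IsIndex Λ Λ₀ z) {x y : LRing k G}
    (hx : IsCovol b Λ x) (hxm : LMonic x) (hy : IsCovol b Λ₀ y) (hym : LMonic y) :
    bigToL k G z * x = y := by
  have := finite_kInfty b
  obtain ⟨E, E', z₀, hE, hE', hΛE, hΛE', ⟨e, e', X, v, hX, hz₀, hdet⟩, rfl⟩ := hz
  have := projective_of_basis e
  have := projective_of_basis e'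
  obtain ⟨hm, hu⟩ := quotient_spec hΛ hE hΛE
  obtain ⟨hm', hu'⟩ := quotient_spec hΛ₀ hE' hΛE'
  rw [isMonic_iff] at hz₀
  set g := gsize (k := k) (G := G) (E ⧸ Λ.submoduleOf E)
  set g' := gsize (k := k) (G := G) (E' ⧸ Λ₀.submoduleOf E')
  have hinv : polyL _ g * bigToL k G (Ring.inverse (toBig k G g)) = 1 := by
    rw [← bigToL_toBig] at hu ⊢
    exact bigToL_mul_inverse hu
  have hmat : (famMat b fun i => (e' i : KInfty k F K)) =
      X.map (bigToL k G) * famMat b fun i => (e i : KInfty k F K) := by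
    ext1 i l
    rw [Matrix.mul_apply]
    change coord b (e' i) l = _
    rw [hX, coord_sum]
    exact Finset.sum_congr rfl fun s _ => coord_smul _ _ _ _
  have hXdet : (X.map (bigToL k G)).det = bigToL k G X.det := (RingEquiv.map_det (bigToL k G) X).symm
  have hc : IsCovol b Λ ((famMat b fun i => (e i : KInfty k F K)).det * polyL _ g) :=
    ⟨E, e, hE, hΛE, rfl⟩
  have hc' : IsCovol b Λ₀ ((famMat b fun i => (e' i : KInfty k F K)).det * polyL _ g') :=
    ⟨E', e', hE', hΛE', rfl⟩
  obtain ⟨w, hw, h₁⟩ := hx.eq_mul_unit hΛ hc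
  obtain ⟨w', hw', h₂⟩ := hc'.eq_mul_unit hΛ₀ hy
  have hlm : LMonic (bigToL k G (z₀ * toBig k G g' * Ring.inverse (toBig k G g)) * x) := by
    rw [map_mul, map_mul, bigToL_toBig]
    exact ((hz₀.mul hm').mul (hm.of_mul_eq_one hinv)).mul hxm
  refine hlm.eq_of_eq_mul_unit hym (hy.isUnit hΛ₀)
    (v := w' * w * (v⁻¹ : ((GrpRing k G)[X])ˣ)) ((hw'.mul hw).mul (Units.isUnit _)) ?_
  rw [hmat, Matrix.det_mul, hXdet, hdet, map_mul, bigToL_toBig] at h₂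
  have hv : polyL (GrpRing k G) v * polyL _ ((v⁻¹ : ((GrpRing k G)[X])ˣ) : (GrpRing k G)[X]) = 1 := by
    rw [← map_mul, Units.mul_inv, map_one]
  rw [h₁, map_mul, map_mul, bigToL_toBig, map_mul, map_mul, ← mul_assoc y, ← mul_assoc y, ← h₂]
  linear_combination (bigToL k G z₀ * polyL _ g' *
    (famMat b fun i => (e i : KInfty k F K)).det * polyL _ w) * hinv -
    (bigToL k G z₀ * (famMat b fun i => (e i : KInfty k F K)).det * polyL _ g' * polyL _ w) * hv

include b in
lemma exists_isIndex {Λ Λ₀ : Submodule (GrpRing k G)[X] (KInfty k F K)} (hΛ : IsProjLattice Λ)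
    (hΛ₀ : IsProjLattice Λ₀) : ∃ z : BigRing k G, IsIndex Λ Λ₀ z := by
  obtain ⟨j, hj⟩ := exists_isGood b hΛ.1 one_ne_zero
  obtain ⟨e, he, hΛe⟩ := hj j le_rfl
  obtain ⟨j', hj'⟩ := exists_isGood b hΛ₀.1 one_ne_zero
  obtain ⟨e', he', hΛe'⟩ := hj' j' le_rfl
  let X : Matrix (Fin (Module.finrank (RatFunc k) F)) (Fin (Module.finrank (RatFunc k) F))
    (BigRing k G) := Matrix.of fun i l => e.repr (e' i) l
  have hXΦ : X.map (bigToL k G) = coordMat e e' := rfl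
  have hmul : coordMat e e' * coordMat b e = coordMat b e' := by
    ext1 i l
    rw [Matrix.mul_apply]
    exact (coord_eq_sum b e _ l).symm
  have hdet : bigToL k G X.det * (coordMat b e).det = (coordMat b e').det := by
    rw [← hmul, Matrix.det_mul, ← hXΦ]
    exact congrArg (· * _) (RingEquiv.map_det (bigToL k G) X)
  have hmonic : LMonic (bigToL k G X.det) := by
    obtain ⟨u, hu⟩ := isUnit_det_coordMat b e
    have h1 : (coordMat b e).det * ((u⁻¹ : (LRing k G)ˣ) : LRing k G) = 1 := by
      rw [← hu, Units.mul_inv]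
    have h2 : bigToL k G X.det = (coordMat b e').det * ((u⁻¹ : (LRing k G)ˣ) : LRing k G) := by
      rw [← hdet, mul_assoc, h1, mul_one]
    rw [h2]
    exact (he'.lMonic_det one_ne_zero).mul ((he.lMonic_det one_ne_zero).of_mul_eq_one h1)
  refine ⟨_, spanLattice e, spanLattice e', X.det, isLattice_spanLattice e,
    isLattice_spanLattice e', hΛe, hΛe', ⟨spanBasis e, spanBasis e', X, 1, fun i => ?_,
      (isMonic_iff _).2 hmonic, by rw [Units.val_one, map_one, mul_one]⟩, rfl⟩
  simp_rw [coe_spanBasis]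
  exact (e.sum_repr (e' i)).symm

/-- The lattice index is the quotient of the monic covolumes. -/
lemma latticeIndex_spec {Λ Λ₀ : Submodule (GrpRing k G)[X] (KInfty k F K)} (hΛ : IsProjLattice Λ)
    (hΛ₀ : IsProjLattice Λ₀) {x y : LRing k G}
    (hx : IsCovol b Λ x) (hxm : LMonic x) (hy : IsCovol b Λ₀ y) (hym : LMonic y) :
    bigToL k G (latticeIndex Λ Λ₀) * x = y :=
  index_spec b hΛ hΛ₀ (Classical.epsilon_spec (exists_isIndex b hΛ hΛ₀)) hx hxm hy hym

end Index

/-! ### Volumes -/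

section Volume

/-- A complement of a projective submodule of a projective `R`-module is projective. -/
lemma projective_of_isCompl {k : Type u} [Field k] {G : Type u} [CommGroup G] [Fintype G]
    {M : Type*} [AddCommGroup M] [Module (GrpRing k G) M] {P Q : Submodule (GrpRing k G) M}
    (h : IsCompl P Q) [Module.Projective (GrpRing k G) M] [Module.Projective (GrpRing k G) Q] :
    Module.Projective (GrpRing k G) P := by
  have := projective_quotient Q
  exact Module.Projective.of_equiv (Submodule.quotientEquivOfIsCompl Q P h.symm)

variable {k : Type u} [Field k] [Finite k]
variable {F : Type u} [Field F] [Algebra (RatFunc k) F]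
variable {K : Type u} [Field K] [Algebra (RatFunc k) K] [Algebra F K]
  [IsScalarTower (RatFunc k) F K]
variable {G : Type u} [CommGroup G] [MulSemiringAction G K] [IsGaloisGroup G F K] [Fintype G]
variable {M H : Type u} [AddCommGroup M] [Module (GrpRing k G)[X] M] [Module (GrpRing k G) M]
  [IsScalarTower (GrpRing k G) (GrpRing k G)[X] M] [TopologicalSpace M]
  [AddCommGroup H] [Module (GrpRing k G)[X] H]

/-- The map `K_∞ → M`. -/
def StructSeq.toM (D : StructSeq k F K G M H) : KInfty k F K →ₗ[(GrpRing k G)[X]] M :=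
  D.ι ∘ₗ D.Λ.mkQ

omit [Fintype G] [Module (GrpRing k G) M] [IsScalarTower (GrpRing k G) (GrpRing k G)[X] M] in
lemma StructSeq.toM_eq_zero {D : StructSeq k F K G M H} {x : KInfty k F K} :
    D.toM x = 0 ↔ x ∈ D.Λ := by
  change D.ι (D.Λ.mkQ x) = 0 ↔ _
  rw [map_eq_zero_iff _ D.injective_ι, Submodule.mkQ_apply, Submodule.Quotient.mk_eq_zero]

omit [Fintype G] [Module (GrpRing k G) M] [IsScalarTower (GrpRing k G) (GrpRing k G)[X] M] in
lemma StructSeq.π_toM (D : StructSeq k F K G M H) (x : KInfty k F K) : D.π (D.toM x) = 0 :=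
  (D.exact _).2 ⟨_, rfl⟩

omit [Fintype G] [Module (GrpRing k G) M] [IsScalarTower (GrpRing k G) (GrpRing k G)[X] M] in
lemma StructSeq.exists_toM_eq {D : StructSeq k F K G M H} {m : M} (h : D.π m = 0) :
    ∃ x, D.toM x = m := by
  obtain ⟨y, rfl⟩ := (D.exact _).1 h
  obtain ⟨x, rfl⟩ := D.Λ.mkQ_surjective y
  exact ⟨x, rfl⟩

variable {ι : Type*} [Fintype ι] [DecidableEq ι]
  (b : Module.Basis ι (BigRing k G) (KInfty k F K))

/-- The image in `M` of a step of the filtration of `K_∞`. -/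
def filtM (D : StructSeq k F K G M H) (j : ℤ) : Submodule (GrpRing k G) M :=
  (filt b j).map (D.toM.restrictScalars (GrpRing k G))

variable {b}

omit [Fintype ι] [DecidableEq ι] in
variable (b) in
lemma filtM_anti (D : StructSeq k F K G M H) : Antitone (filtM b D) := fun _ _ h =>
  Submodule.map_mono (filt_anti b h)

omit [Fintype G] [Module (GrpRing k G) M] [IsScalarTower (GrpRing k G) (GrpRing k G)[X] M] in
lemma isSection_zero {D : StructSeq k F K G M H} {s : H →+ M} (hs : IsSection D s)
    {x : KInfty k F K} {h : H} (hx : D.π (D.toM x + s h) = 0) : h = 0 := by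
  rwa [map_add, D.π_toM, zero_add, hs.1] at hx

omit [DecidableEq ι] in
lemma projective_filtM (D : StructSeq k F K G M H) {j : ℤ}
    (hj : ∀ x ∈ filt b j, x ∈ D.Λ → x = 0) : Module.Projective (GrpRing k G) (filtM b D j) := by
  have := projective_filt b j
  let f : filt b j →ₗ[GrpRing k G] M :=
    (D.toM.restrictScalars (GrpRing k G)) ∘ₗ (filt b j).subtype
  have hf : Function.Injective f := by
    refine (injective_iff_map_eq_zero f).2 fun x hx => Subtype.ext ?_
    exact hj x x.2 (StructSeq.toM_eq_zero.1 hx)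
  have hr : LinearMap.range f = filtM b D j := by
    rw [LinearMap.range_comp, Submodule.range_subtype]
    rfl
  exact Module.Projective.of_equiv ((LinearEquiv.ofInjective f hf).trans (LinearEquiv.ofEq _ _ hr))

section Extension

variable {D : StructSeq k F K G M H} {s : H →+ M}
  {Λ' : Submodule (GrpRing k G)[X] (KInfty k F K)} {N : Submodule (GrpRing k G)[X] M}
  {e : Module.Basis ι (BigRing k G) (KInfty k F K)} {j : ℤ} {N' : ℕ}

omit [Fintype G] [Module (GrpRing k G) M] [IsScalarTower (GrpRing k G) (GrpRing k G)[X] M] in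
lemma IsAdmissible.mem_iff (hN : IsAdmissible D s Λ' N) {m : M} :
    m ∈ N ↔ ∃ x ∈ Λ', ∃ h : H, m = D.toM x + s h := by
  have := hN.2.2
  exact iff_of_eq (congrFun this m)

omit [Fintype G] [Module (GrpRing k G) M] [IsScalarTower (GrpRing k G) (GrpRing k G)[X] M] in
lemma IsAdmissible.toM_mem_iff (hN : IsAdmissible D s Λ' N) (hs : IsSection D s)
    {x : KInfty k F K} : D.toM x ∈ N ↔ x ∈ Λ' := by
  rw [hN.mem_iff]
  constructor
  · rintro ⟨y, hy, h, hxy⟩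
    have h0 : h = 0 := isSection_zero hs (by rw [← hxy, D.π_toM])
    rw [h0, map_zero, add_zero, ← sub_eq_zero, ← map_sub, StructSeq.toM_eq_zero] at hxy
    simpa using Λ'.add_mem (hN.2.1 hxy) hy
  · intro hx
    exact ⟨x, hx, 0, by rw [map_zero, add_zero]⟩

omit [Module (GrpRing k G) M] [IsScalarTower (GrpRing k G) (GrpRing k G)[X] M] [Fintype ι]
  [DecidableEq ι] [Fintype G] in
lemma IsAdmissible.mem_sup_iff (hN : IsAdmissible D s Λ' N) (hΛe : Λ' ≤ spanLattice e) {m : M} :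
    m ∈ N ⊔ (spanLattice e).map D.toM ↔ ∃ x ∈ spanLattice e, ∃ h : H, m = D.toM x + s h := by
  rw [Submodule.mem_sup]
  constructor
  · rintro ⟨y, hy, z, ⟨z, hz, rfl⟩, rfl⟩
    obtain ⟨x, hx, h, rfl⟩ := hN.mem_iff.1 hy
    exact ⟨x + z, Submodule.add_mem _ (hΛe hx) hz, h, by rw [map_add]; abel⟩
  · rintro ⟨x, hx, h, rfl⟩
    refine ⟨s h, hN.mem_iff.2 ⟨0, Λ'.zero_mem, h, by rw [map_zero, zero_add]⟩, D.toM x,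
      ⟨x, hx, rfl⟩, add_comm _ _⟩

/-- Enlarging `N` by the image of a free lattice in good position gives a complement of a step of
the filtration. -/
lemma IsAdmissible.isCompl (hN : IsAdmissible D s Λ' N) (hs : IsSection D s)
    (he : IsGood b j N' e) (hN' : N' ≠ 0) (hΛe : Λ' ≤ spanLattice e) :
    IsCompl ((N ⊔ (spanLattice e).map D.toM).restrictScalars (GrpRing k G)) (filtM b D j) := by
  constructor
  · rw [Submodule.disjoint_def]
    rintro _ hx ⟨u, hu, rfl⟩
    rw [Submodule.restrictScalars_mem, hN.mem_sup_iff hΛe] at hx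
    obtain ⟨x, hx, h, hxu⟩ := hx
    change D.toM u = _ at hxu
    have h0 : h = 0 := isSection_zero hs (by rw [← hxu, D.π_toM])
    rw [h0, map_zero, add_zero, ← sub_eq_zero, ← map_sub, StructSeq.toM_eq_zero] at hxu
    have hu' : u ∈ spanLattice e := by
      simpa using Submodule.add_mem _ (hΛe (hN.2.1 hxu)) hx
    rw [he.eq_zero hN' hu' hu, map_zero]
  · rw [codisjoint_iff, eq_top_iff]
    intro m _
    obtain ⟨x, hx⟩ := StructSeq.exists_toM_eq (D := D) (m := m - s (D.π m))
      (by rw [map_sub, hs.1, sub_self])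
    obtain ⟨y, hy, hxy⟩ := he.exists_sub_mem hN' x
    refine Submodule.mem_sup.2 ⟨D.toM y + s (D.π m), ?_, D.toM (x - y), ⟨_, hxy, rfl⟩, ?_⟩
    · rw [Submodule.restrictScalars_mem, hN.mem_sup_iff hΛe]
      exact ⟨y, hy, _, rfl⟩
    · rw [map_sub, hx]
      abel

omit [Module (GrpRing k G) M] [IsScalarTower (GrpRing k G) (GrpRing k G)[X] M]
  [DecidableEq ι] in
lemma IsAdmissible.finite_sup [Finite H] (hN : IsAdmissible D s Λ' N)
    (hΛe : Λ' ≤ spanLattice e) :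
    Finite (N ⊔ (spanLattice e).map D.toM : Submodule (GrpRing k G)[X] M) := by
  have := finite_kInfty e
  have := D.isLattice.finite_quotient (isLattice_spanLattice e) (hN.2.1.trans hΛe)
  let f : spanLattice e →ₗ[(GrpRing k G)[X]] M := D.toM ∘ₗ (spanLattice e).subtype
  have hf : D.Λ.submoduleOf (spanLattice e) ≤ LinearMap.ker f := fun x hx =>
    StructSeq.toM_eq_zero.2 hx
  let g := (D.Λ.submoduleOf (spanLattice e)).liftQ f hf
  have hfin : (Set.range fun p : (spanLattice e ⧸ D.Λ.submoduleOf (spanLattice e)) × H =>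
      g p.1 + s p.2).Finite := Set.finite_range _
  refine (hfin.subset fun m hm => ?_).to_subtype
  obtain ⟨x, hx, h, rfl⟩ := (hN.mem_sup_iff hΛe).1 hm
  exact ⟨(Submodule.Quotient.mk ⟨x, hx⟩, h), rfl⟩

/-- The enlarged submodule is projective, and its size exceeds that of `N` by the size of `E/Λ'`. -/
lemma IsAdmissible.gsize_sup [Finite H] [Module.Projective (GrpRing k G) M]
    (hN : IsAdmissible D s Λ' N) (hs : IsSection D s)
    (he : IsGood b j N' e) (hN' : N' ≠ 0) (hΛe : Λ' ≤ spanLattice e) :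
    Module.Projective (GrpRing k G) (N ⊔ (spanLattice e).map D.toM : Submodule _ M) ∧
    LMonic (polyL _ (gsize (k := k) (G := G) N)) ∧ IsUnit (polyL _ (gsize (k := k) (G := G) N)) ∧
    gsize (k := k) (G := G) (N ⊔ (spanLattice e).map D.toM : Submodule _ M) =
      gsize (k := k) (G := G) N *
        gsize (k := k) (G := G) (spanLattice e ⧸ Λ'.submoduleOf (spanLattice e)) := by
  set E := spanLattice e with hE
  set NE := N ⊔ E.map D.toM with hNE
  have := finite_kInfty e
  have hfin : Finite NE := hN.finite_sup hΛe
  have hj : ∀ x ∈ filt b j, x ∈ D.Λ → x = 0 := fun x hx hx' =>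
    he.eq_zero hN' (hΛe (hN.2.1 hx')) hx
  have := projective_filtM D hj
  have hNEp : Module.Projective (GrpRing k G) NE :=
    projective_of_isCompl (P := NE.restrictScalars (GrpRing k G)) (hN.isCompl hs he hN' hΛe)
  have hle : N ≤ NE := le_sup_left
  let f : E →ₗ[(GrpRing k G)[X]] NE :=
    (D.toM ∘ₗ E.subtype).codRestrict NE fun x => Submodule.mem_sup_right ⟨x, x.2, rfl⟩
  have hf : ∀ x : E, f x ∈ N.submoduleOf NE ↔ x ∈ Λ'.submoduleOf E := fun x =>
    hN.toM_mem_iff hs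
  let g := (Λ'.submoduleOf E).mapQ (N.submoduleOf NE) f fun x hx => (hf x).2 hx
  have hg : Function.Bijective g := by
    constructor
    · refine (injective_iff_map_eq_zero _).2 fun x hx => ?_
      obtain ⟨x, rfl⟩ := Submodule.Quotient.mk_surjective _ x
      exact (Submodule.Quotient.mk_eq_zero _).2 ((hf x).1 ((Submodule.Quotient.mk_eq_zero _).1 hx))
    · intro y
      obtain ⟨⟨y, hy⟩, rfl⟩ := Submodule.Quotient.mk_surjective _ y
      obtain ⟨x, hx, h, rfl⟩ := (hN.mem_sup_iff hΛe).1 hy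
      refine ⟨Submodule.Quotient.mk ⟨x, hx⟩, (Submodule.Quotient.eq _).2 (?_ : D.toM x - _ ∈ N)⟩
      refine hN.mem_iff.2 ⟨0, Λ'.zero_mem, -h, ?_⟩
      change D.toM x - (D.toM x + s h) = _
      rw [map_zero, map_neg, sub_add_cancel_left, zero_add]
  let g' := LinearEquiv.ofBijective g hg
  have hpΛ := hN.1.projective
  have hpE := projective_of_basis (spanBasis e)
  have hpq : Module.Projective (GrpRing k G) (E ⧸ Λ'.submoduleOf E) := projective_submoduleOf hΛe
  have hpq' : Module.Projective (GrpRing k G) (NE ⧸ N.submoduleOf NE) :=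
    Module.Projective.of_equiv (g'.restrictScalars (GrpRing k G))
  have hfq : Finite (E ⧸ Λ'.submoduleOf E) :=
    hN.1.1.finite_quotient (isLattice_spanLattice e) hΛe
  have hfN : Finite N := Finite.of_injective _ (Submodule.inclusion_injective hle)
  have hpN : Module.Projective (GrpRing k G) N := by
    have h1 : Module.Projective (GrpRing k G)
        (NE ⧸ (N.submoduleOf NE).restrictScalars (GrpRing k G)) :=
      Module.Projective.of_equiv (Submodule.Quotient.restrictScalarsEquiv _ _).symm
    have h2 := projective_of_quotient ((N.submoduleOf NE).restrictScalars (GrpRing k G))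
    let E₁ : (N.submoduleOf NE).restrictScalars (GrpRing k G) ≃ₗ[GrpRing k G] N :=
      { toFun := fun x => ⟨x.1.1, x.2⟩
        map_add' := fun _ _ => rfl
        map_smul' := fun _ _ => rfl
        invFun := fun x => ⟨⟨x.1, hle x.2⟩, x.2⟩
        left_inv := fun _ => rfl
        right_inv := fun _ => rfl }
    exact Module.Projective.of_equiv E₁
  obtain ⟨h1, h2, -⟩ := gsize_spec (k := k) (G := G) N
  refine ⟨hNEp, h1, h2, ?_⟩
  refine gsize_eq_mul_of_exact (Submodule.inclusion hle)
    (g'.symm.toLinearMap ∘ₗ (N.submoduleOf NE).mkQ) (Submodule.inclusion_injective hle)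
    (g'.symm.surjective.comp (Submodule.mkQ_surjective _)) fun x => ?_
  change g'.symm (Submodule.Quotient.mk x) = 0 ↔ _
  rw [LinearEquiv.map_eq_zero_iff, Submodule.Quotient.mk_eq_zero]
  exact ⟨fun hx => ⟨⟨x, hx⟩, rfl⟩, by rintro ⟨y, rfl⟩; exact y.2⟩

end Extension

section Spec

variable {D : StructSeq k F K G M H}
  {c : Module.Basis (Fin (Module.finrank (RatFunc k) F)) (BigRing k G) (KInfty k F K)}

/-- A volume of `M` is computed by the direct sum decompositions of `M` into the image of a small
neighbourhood of `0` of `K_∞` and a finite complement containing the image of a free lattice. -/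
lemma IsVol.exists_isCompl [Finite H] [Module.Projective (GrpRing k G) M]
    {Λ₀ : Submodule (GrpRing k G)[X] (KInfty k F K)} (hΛ₀ : IsProjLattice Λ₀)
    {v : BigRing k G} (hv : IsVol Λ₀ D v) {y : LRing k G} (hy : IsCovol c Λ₀ y) (hym : LMonic y)
    {N' : ℕ} (hN' : N' ≠ 0) : ∃ j₀ : ℤ, ∀ j ≥ j₀,
      ∃ (e : Module.Basis (Fin (Module.finrank (RatFunc k) F)) (BigRing k G) (KInfty k F K))
        (NE : Submodule (GrpRing k G)[X] M), IsGood c j N' e ∧ D.Λ ≤ spanLattice e ∧ Finite NE ∧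
        Module.Projective (GrpRing k G) NE ∧
        IsCompl (NE.restrictScalars (GrpRing k G)) (filtM c D j) ∧
        (∀ x ∈ spanLattice e, D.toM x ∈ NE) ∧
        bigToL k G v * y = polyL _ (gsize (k := k) (G := G) NE) * (coordMat c e).det := by
  obtain ⟨s, Λ', N, hs, hN, rfl⟩ := hv
  obtain ⟨j₀, hj₀⟩ := exists_isGood c hN.1.1 hN'
  refine ⟨j₀, fun j hj => ?_⟩
  obtain ⟨e, he, hΛe⟩ := hj₀ j hj
  obtain ⟨h1, h2, h3, h4⟩ := hN.gsize_sup hs he hN' hΛe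
  refine ⟨e, N ⊔ (spanLattice e).map D.toM, he, hN.2.1.trans hΛe, hN.finite_sup hΛe, h1,
    hN.isCompl hs he hN' hΛe, fun x hx => Submodule.mem_sup_right ⟨x, hx, rfl⟩, ?_⟩
  obtain ⟨h5, h6⟩ := monic_covol_of_isGood hN.1 hN' he hΛe
  have h7 := latticeIndex_spec c hN.1 hΛ₀ (isCovol_of_isGood hΛe) h5 hy hym
  have h8 : IsUnit (bigToL k G (latticeIndex Λ' Λ₀)) :=
    isUnit_of_mul_isUnit_left (h7 ▸ hy.isUnit hΛ₀)
  have h9 := bigToL_mul_inverse h8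
  rw [h4, map_mul, map_mul, bigToL_toBig, ← h7]
  linear_combination (polyL _ (gsize (k := k) (G := G) N) * (coordMat c e).det *
    polyL _ (gsize (k := k) (G := G) (spanLattice e ⧸ Λ'.submoduleOf (spanLattice e)))) * h9

end Spec

end Volume

section Existence

/-- A divisible module over a principal ideal domain is a direct factor of every module that
contains it. -/
lemma exists_retraction_of_divisible {A Q M : Type u} [CommRing A] [IsDomain A]
    [IsPrincipalIdealRing A] [AddCommGroup Q] [Module A Q] [AddCommGroup M] [Module A M]
    (hQ : ∀ a : A, a ≠ 0 → ∀ x : Q, ∃ y, a • y = x) (i : Q →ₗ[A] M) (hi : Function.Injective i) :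
    ∃ r : M →ₗ[A] Q, r ∘ₗ i = LinearMap.id := by
  have hB : Module.Baer A Q := by
    intro I f
    obtain ⟨a, rfl⟩ := IsPrincipalIdealRing.principal I
    have haI : a ∈ Submodule.span A {a} := Submodule.mem_span_singleton_self a
    by_cases ha : a = 0
    · refine ⟨0, fun x hx => ?_⟩
      have hx0 : x = 0 := by
        obtain ⟨c, rfl⟩ := Submodule.mem_span_singleton.1 hx
        rw [ha, smul_zero]
      subst hx0
      exact (map_zero f).symm
    · obtain ⟨y, hy⟩ := hQ a ha (f ⟨a, haI⟩)
      refine ⟨LinearMap.toSpanSingleton A Q y, fun x hx => ?_⟩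
      obtain ⟨c, rfl⟩ := Submodule.mem_span_singleton.1 hx
      rw [LinearMap.toSpanSingleton_apply]
      change (c * a) • y = _
      rw [mul_smul, hy, ← map_smul]
      rfl
  exact hB.extension_property i hi LinearMap.id

variable {k : Type u} [Field k] [Finite k]
variable {F : Type u} [Field F] [Algebra (RatFunc k) F]
variable {K : Type u} [Field K] [Algebra (RatFunc k) K] [Algebra F K]
  [IsScalarTower (RatFunc k) F K]
variable {G : Type u} [CommGroup G] [MulSemiringAction G K] [IsGaloisGroup G F K] [Fintype G]
variable {M H : Type u} [AddCommGroup M] [Module (GrpRing k G)[X] M]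
  [TopologicalSpace M] [AddCommGroup H] [Module (GrpRing k G)[X] H]

omit [Fintype G] in
/-- The structural exact sequence splits over `A`. -/
lemma exists_isSection (D : StructSeq k F K G M H) : ∃ s : H →+ M, IsSection D s := by
  let φ : k[X] →+* (GrpRing k G)[X] := Polynomial.mapRingHom (algebraMap k (GrpRing k G))
  let _ : Module k[X] M := Module.compHom M φ
  let _ : Module k[X] (KInfty k F K ⧸ D.Λ) := Module.compHom _ φ
  let i : (KInfty k F K ⧸ D.Λ) →ₗ[k[X]] M :=
    { toFun := D.ι, map_add' := map_add D.ι, map_smul' := fun p x => map_smul D.ι (φ p) x }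
  obtain ⟨r, hr⟩ := exists_retraction_of_divisible (fun a ha x => by
    obtain ⟨x, rfl⟩ := Submodule.Quotient.mk_surjective _ x
    have ha' : algebraMap k[X] (KInf k) a ≠ 0 := fun h =>
      ha (polyToLaurent_injective k (h.trans (map_zero (polyToLaurent k)).symm))
    refine ⟨Submodule.Quotient.mk ((algebraMap k[X] (KInf k) a)⁻¹ • x), ?_⟩
    change φ a • (Submodule.Quotient.mk _ : KInfty k F K ⧸ D.Λ) = _
    rw [← Submodule.Quotient.mk_smul]
    congr 1
    change a.map _ • _ = x
    rw [map_smul_eq, kpoly_smul_eq, smul_smul, mul_inv_cancel₀ ha', one_smul]) i D.injective_ι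
  have hr' : ∀ x, r (D.ι x) = x := fun x => LinearMap.congr_fun hr x
  -- `m ↦ m - ι (r m)` factors through `π`
  have hker : ∀ m, D.π m = 0 → m - D.ι (r m) = 0 := fun m hm => by
    obtain ⟨x, rfl⟩ := (D.exact m).1 hm
    rw [hr', sub_self]
  let f : M → M := fun m => m - D.ι (r m)
  have hf : ∀ m m', D.π m = D.π m' → f m = f m' := fun m m' h => by
    have := hker (m - m') (by rw [map_sub, h, sub_self])
    rw [map_sub, map_sub] at this
    rw [← sub_eq_zero, ← this]
    simp only [f]
    abel
  have hfπ : ∀ m, D.π (f m) = D.π m := fun m => by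
    have : D.π (D.ι (r m)) = 0 := (D.exact _).2 ⟨_, rfl⟩
    simp only [f]
    rw [map_sub, this, sub_zero]
  let σ := Function.surjInv D.surjective_π
  have hσ : ∀ h, D.π (σ h) = h := Function.surjInv_eq D.surjective_π
  refine ⟨AddMonoidHom.mk' (fun h => f (σ h)) fun h h' => ?_, fun h => ?_, fun p h => ?_⟩
  · rw [hf (σ (h + h')) (σ h + σ h') (by rw [map_add, hσ, hσ, hσ])]
    simp only [f]
    rw [map_add, map_add]
    abel
  · exact (hfπ _).trans (hσ h)
  · change f (σ (φ p • h)) = φ p • f (σ h)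
    rw [hf (σ (φ p • h)) (φ p • σ h) (by rw [map_smul, hσ, hσ])]
    simp only [f]
    have h1 : r (φ p • σ h) = φ p • r (σ h) := map_smul r p (σ h)
    rw [h1, map_smul, smul_sub]

omit [Finite k] [Fintype G] in
lemma exists_annihilator [Finite H] :
    ∃ a : k[X], a ≠ 0 ∧ ∀ h : H, a.map (algebraMap k (GrpRing k G)) • h = 0 := by
  have : ¬ Function.Injective fun (p : k[X]) (h : H) => p.map (algebraMap k (GrpRing k G)) • h :=
    not_injective_infinite_finite _
  rw [Function.Injective] at this
  push Not at this
  obtain ⟨p, q, h, hpq⟩ := this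
  refine ⟨p - q, sub_ne_zero.2 hpq, fun x => ?_⟩
  rw [Polynomial.map_sub, sub_smul, sub_eq_zero]
  exact congrFun h x

/-- Data `s`, `Λ'`, `N` as in the definition of the volume exist: if `a ≠ 0` kills `H`, then any
free lattice containing `a⁻¹ Λ` can serve as `Λ'`. -/
lemma exists_isVol [Finite H]
    (b : Module.Basis (Fin (Module.finrank (RatFunc k) F)) (BigRing k G) (KInfty k F K))
    (Λ₀ : Submodule (GrpRing k G)[X] (KInfty k F K)) (D : StructSeq k F K G M H) :
    ∃ v, IsVol Λ₀ D v := by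
  have := finite_kInfty b
  obtain ⟨s, hs⟩ := exists_isSection D
  obtain ⟨a, ha, haH⟩ := exists_annihilator (k := k) (G := G) (H := H)
  obtain ⟨j, hj⟩ := exists_isGood b (isLattice_invSmul (G := G) D.isLattice ha) one_ne_zero
  obtain ⟨e, -, he⟩ := hj j le_rfl
  have hΛ : D.Λ ≤ spanLattice e := fun x hx => he (mem_invSmul.2 (by
    rw [← map_smul_eq (G := G)]
    exact D.Λ.smul_mem _ hx))
  -- the defect of `R[X]`-linearity of `s` takes values in the image of `a⁻¹ Λ`
  have hdef : ∀ (p : (GrpRing k G)[X]) (h : H),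
      ∃ x ∈ spanLattice e, p • s h = D.toM x + s (p • h) := by
    intro p h
    obtain ⟨x, hx⟩ := StructSeq.exists_toM_eq (D := D) (m := p • s h - s (p • h))
      (by rw [map_sub, map_smul, hs.1, hs.1, sub_self])
    refine ⟨x, he (mem_invSmul.2 ?_), by rw [hx]; abel⟩
    rw [← StructSeq.toM_eq_zero (D := D), ← map_smul_eq (G := G), map_smul, hx, smul_sub,
      smul_comm, ← hs.2, ← hs.2, haH, haH, map_zero, smul_zero, sub_zero]
  let N : Submodule (GrpRing k G)[X] M :=
    { carrier := {m | ∃ x ∈ spanLattice e, ∃ h : H, m = D.ι (D.Λ.mkQ x) + s h}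
      add_mem' := by
        rintro _ _ ⟨x, hx, h, rfl⟩ ⟨y, hy, h', rfl⟩
        exact ⟨x + y, Submodule.add_mem _ hx hy, h + h', by rw [map_add, map_add, map_add]; abel⟩
      zero_mem' := ⟨0, Submodule.zero_mem _, 0, by simp⟩
      smul_mem' := by
        rintro p _ ⟨x, hx, h, rfl⟩
        obtain ⟨y, hy, hxy⟩ := hdef p h
        refine ⟨p • x + y, Submodule.add_mem _ (Submodule.smul_mem _ _ hx) hy, p • h, ?_⟩
        change p • (D.toM x + s h) = D.toM (p • x + y) + s (p • h)
        rw [smul_add, hxy, map_add, D.toM.map_smul, add_assoc] }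
  exact ⟨_, s, spanLattice e, N, hs, ⟨⟨isLattice_spanLattice e,
    Module.Projective.of_basis (spanBasis e)⟩, hΛ, rfl⟩, rfl⟩

lemma isVol_vol [Finite H]
    (b : Module.Basis (Fin (Module.finrank (RatFunc k) F)) (BigRing k G) (KInfty k F K))
    (Λ₀ : Submodule (GrpRing k G)[X] (KInfty k F K)) (D : StructSeq k F K G M H) :
    IsVol Λ₀ D (vol Λ₀ D) :=
  Classical.epsilon_spec (exists_isVol b Λ₀ D)

end Existence

/-! ### The local field `k((t⁻¹))` is complete -/

lemma exists_form_bound_of_normed {𝕜 E : Type*} [NontriviallyNormedField 𝕜] [CompleteSpace 𝕜]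
    [NormedAddCommGroup E] [NormedSpace 𝕜 E] [FiniteDimensional 𝕜 E] (φ : E →ₗ[𝕜] 𝕜) :
    ∃ C : ℝ, ∀ x, ‖φ x‖ ≤ C * ‖x‖ :=
  ⟨‖LinearMap.toContinuousLinearMap φ‖, fun x => (LinearMap.toContinuousLinearMap φ).le_opNorm x⟩

/-- Linear forms on a finite-dimensional space over a complete field are bounded with respect to
any norm. -/
lemma exists_form_bound {𝕜 E : Type*} [NontriviallyNormedField 𝕜] [CompleteSpace 𝕜]
    [AddCommGroup E] [Module 𝕜 E] [hfin : FiniteDimensional 𝕜 E] (ν : E → ℝ)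
    (h₀ : ∀ x, 0 ≤ ν x) (h₁ : ∀ x, ν x = 0 ↔ x = 0)
    (hadd : ∀ x y, ν (x + y) ≤ ν x + ν y) (hsmul : ∀ (c : 𝕜) x, ν (c • x) = ‖c‖ * ν x)
    (φ : E →ₗ[𝕜] 𝕜) : ∃ C : ℝ, ∀ x, ‖φ x‖ ≤ C * ν x := by
  let inst : Norm E := ⟨ν⟩
  let core : NormedSpace.Core 𝕜 E :=
    { norm_nonneg := h₀, norm_smul := hsmul, norm_triangle := hadd, norm_eq_zero_iff := h₁ }
  exact @exists_form_bound_of_normed 𝕜 E _ _ (NormedAddCommGroup.ofCore core)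
    (@NormedSpace.ofCore 𝕜 E _ (NormedAddCommGroup.ofCore core).toSeminormedAddCommGroup _ core)
    hfin φ

section LocalField

variable {k : Type u} [Field k] [Finite k]

variable (k) in
lemma one_lt_card : (1 : ℝ) < Nat.card k := by exact_mod_cast Finite.one_lt_card (α := k)

lemma kinf_norm_zero : ‖(0 : KInf k)‖ = 0 := norm_zero

lemma kinf_norm_of_ne {f : KInf k} (hf : f ≠ 0) :
    ‖f‖ = (Nat.card k : ℝ) ^ (-HahnSeries.order (f : LaurentSeries k)) := by
  change laurentAbs k f = _
  rw [laurentAbs]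
  exact if_neg hf

lemma norm_le_iff {f : KInf k} {m : ℤ} :
    ‖f‖ ≤ (Nat.card k : ℝ) ^ (-m) ↔ ∀ l < m, lcoeff f l = 0 := by
  by_cases hf : f = 0
  · subst hf
    rw [kinf_norm_zero]
    exact ⟨fun _ _ _ => rfl, fun _ => by positivity⟩
  · rw [kinf_norm_of_ne hf, zpow_le_zpow_iff_right₀ (one_lt_card k), neg_le_neg_iff,
      HahnSeries.le_order_iff_forall (show (f : LaurentSeries k) ≠ 0 from hf)]
    rfl

lemma norm_tInf : ‖tInf k‖ = Nat.card k := by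
  have h : tInf k ≠ 0 := HahnSeries.single_ne_zero one_ne_zero
  rw [kinf_norm_of_ne h]
  change (Nat.card k : ℝ) ^ (-(HahnSeries.single (-1 : ℤ) (1 : k)).order) = _
  rw [HahnSeries.order_single one_ne_zero, neg_neg, zpow_one]

instance : NontriviallyNormedField (KInf k) :=
  { (inferInstance : NormedField (KInf k)) with
    non_trivial := ⟨tInf k, by
      change 1 < ‖tInf k‖
      rw [norm_tInf]
      exact one_lt_card k⟩ }

lemma exists_norm_eq {f : KInf k} (hf : f ≠ 0) : ∃ m : ℤ, ‖f‖ = (Nat.card k : ℝ) ^ (-m) :=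
  ⟨_, kinf_norm_of_ne hf⟩

lemma kinf_norm_add_le (f g : KInf k) : ‖f + g‖ ≤ max ‖f‖ ‖g‖ := by
  by_cases hf : f = 0
  · rw [hf, zero_add]; exact le_max_right _ _
  by_cases hg : g = 0
  · rw [hg, add_zero]; exact le_max_left _ _
  obtain ⟨m, hm⟩ := exists_norm_eq hf
  obtain ⟨n, hn⟩ := exists_norm_eq hg
  have h1 : max ‖f‖ ‖g‖ = (Nat.card k : ℝ) ^ (-(min m n)) := by
    rw [hm, hn, ← (zpow_right_strictMono₀ (one_lt_card k)).monotone.map_max, max_neg_neg]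
  rw [h1, norm_le_iff]
  intro l hl
  rw [lcoeff_add, norm_le_iff.1 hm.le l (hl.trans_le (min_le_left _ _)),
    norm_le_iff.1 hn.le l (hl.trans_le (min_le_right _ _)), add_zero]

instance : IsUltrametricDist (KInf k) :=
  IsUltrametricDist.isUltrametricDist_of_forall_norm_add_le_max_norm kinf_norm_add_le

lemma lcoeff_sub (f g : KInf k) (l : ℤ) : lcoeff (f - g) l = lcoeff f l - lcoeff g l :=
  HahnSeries.coeff_sub (x := (f : LaurentSeries k)) (y := g) (a := l)

instance : CompleteSpace (KInf k) := by
  refine Metric.complete_of_cauchySeq_tendsto fun u hu => ?_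
  have h : ∀ m : ℤ, ∃ n₀, ∀ n ≥ n₀, ∀ l < m, lcoeff (u n) l = lcoeff (u n₀) l := by
    intro m
    obtain ⟨n₀, h⟩ := Metric.cauchySeq_iff'.1 hu ((Nat.card k : ℝ) ^ (-m)) (by
      have := one_lt_card k
      positivity)
    refine ⟨n₀, fun n hn l hl => ?_⟩
    have h1 := h n hn
    rw [dist_eq_norm] at h1
    exact sub_eq_zero.1 ((lcoeff_sub _ _ _).symm.trans (norm_le_iff.1 h1.le l hl))
  choose n₀ hn₀ using h
  -- the coefficients of the limit
  let c : ℤ → k := fun l => lcoeff (u (n₀ (l + 1))) l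
  have hc : ∀ m, ∀ n ≥ n₀ m, ∀ l < m, lcoeff (u n) l = c l := by
    intro m n hn l hl
    have h1 := hn₀ m n hn l hl
    have h2 := hn₀ m (max (n₀ m) (n₀ (l + 1))) (le_max_left _ _) l hl
    have h3 := hn₀ (l + 1) (max (n₀ m) (n₀ (l + 1))) (le_max_right _ _) l (lt_add_one l)
    rw [h1, ← h2, h3]
  obtain ⟨m₀, hm₀⟩ := exists_coeff_eq_zero (u (n₀ 0) : LaurentSeries k)
  have hb : ∀ l < min m₀ 0, c l = 0 := fun l hl => by
    rw [← hc 0 _ le_rfl l (hl.trans_le (min_le_right _ _))]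
    exact hm₀ l (hl.trans_le (min_le_left _ _))
  let f : KInf k := (HahnSeries.ofSuppBddBelow c ⟨min m₀ 0, fun l hl => by
    by_contra h
    exact hl (hb l (not_le.1 h))⟩ : LaurentSeries k)
  have hf : ∀ l, lcoeff f l = c l := fun l => rfl
  refine ⟨f, Metric.tendsto_atTop.2 fun ε hε => ?_⟩
  obtain ⟨m, hm⟩ := exists_pow_lt_of_lt_one hε (inv_lt_one_of_one_lt₀ (one_lt_card k))
  refine ⟨n₀ m, fun n hn => ?_⟩
  rw [dist_eq_norm]
  refine lt_of_le_of_lt ?_ hm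
  have h1 : ((Nat.card k : ℝ)⁻¹) ^ m = (Nat.card k : ℝ) ^ (-(m : ℤ)) := by
    rw [inv_pow, zpow_neg, zpow_natCast]
  rw [h1, norm_le_iff]
  intro l hl
  rw [lcoeff_sub, hf, hc m n hn l hl, sub_self]

end LocalField

/-! ### The sup norm on `K_∞` -/

section SupNorm

variable {k : Type u} [Field k] [Finite k]
variable {F : Type u} [Field F] [Algebra (RatFunc k) F]
variable {K : Type u} [Field K] [Algebra (RatFunc k) K] [Algebra F K]
  [IsScalarTower (RatFunc k) F K]

/-- The local norm at a maximal ideal of `K_∞`. -/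
def normAt (w : MaximalSpectrum (KInfty k F K)) (x : KInfty k F K) : ℝ :=
  letI : Field (KInfty k F K ⧸ w.asIdeal) := Ideal.Quotient.field w.asIdeal
  spectralNorm (KInf k) (KInfty k F K ⧸ w.asIdeal) (Ideal.Quotient.mk w.asIdeal x)

lemma normInf_eq (x : KInfty k F K) : normInf k F K x = ⨆ w, normAt w x := rfl

lemma normAt_nonneg (w : MaximalSpectrum (KInfty k F K)) (x : KInfty k F K) : 0 ≤ normAt w x :=
  letI : Field (KInfty k F K ⧸ w.asIdeal) := Ideal.Quotient.field w.asIdeal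
  spectralNorm_nonneg _

lemma normAt_zero (w : MaximalSpectrum (KInfty k F K)) : normAt w (0 : KInfty k F K) = 0 := by
  let : Field (KInfty k F K ⧸ w.asIdeal) := Ideal.Quotient.field w.asIdeal
  change spectralNorm (KInf k) (KInfty k F K ⧸ w.asIdeal) (Ideal.Quotient.mk w.asIdeal 0) = 0
  rw [map_zero]
  exact spectralNorm_zero

variable [Module.Finite (KInf k) (KInfty k F K)]

lemma normAt_add_le (w : MaximalSpectrum (KInfty k F K)) (x y : KInfty k F K) :
    normAt w (x + y) ≤ max (normAt w x) (normAt w y) := by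
  let : Field (KInfty k F K ⧸ w.asIdeal) := Ideal.Quotient.field w.asIdeal
  have : Module.Finite (KInf k) (KInfty k F K ⧸ w.asIdeal) :=
    Module.Finite.of_surjective (Ideal.Quotient.mkₐ (KInf k) w.asIdeal).toLinearMap
      Ideal.Quotient.mk_surjective
  have : Algebra.IsAlgebraic (KInf k) (KInfty k F K ⧸ w.asIdeal) := inferInstance
  have := isNonarchimedean_spectralNorm (K := KInf k) (L := KInfty k F K ⧸ w.asIdeal)
    (Ideal.Quotient.mk w.asIdeal x) (Ideal.Quotient.mk w.asIdeal y)
  rwa [← map_add] at this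

lemma normAt_smul (w : MaximalSpectrum (KInfty k F K)) (c : KInf k) (x : KInfty k F K) :
    normAt w (c • x) = ‖c‖ * normAt w x := by
  let : Field (KInfty k F K ⧸ w.asIdeal) := Ideal.Quotient.field w.asIdeal
  have : Module.Finite (KInf k) (KInfty k F K ⧸ w.asIdeal) :=
    Module.Finite.of_surjective (Ideal.Quotient.mkₐ (KInf k) w.asIdeal).toLinearMap
      Ideal.Quotient.mk_surjective
  have : Algebra.IsAlgebraic (KInf k) (KInfty k F K ⧸ w.asIdeal) := inferInstance
  exact spectralNorm_smul (K := KInf k) (L := KInfty k F K ⧸ w.asIdeal) c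
    (y := Ideal.Quotient.mk w.asIdeal x) (Algebra.IsAlgebraic.isAlgebraic _)

lemma mem_of_normAt_eq_zero {w : MaximalSpectrum (KInfty k F K)} {x : KInfty k F K}
    (h : normAt w x = 0) : x ∈ w.asIdeal := by
  let : Field (KInfty k F K ⧸ w.asIdeal) := Ideal.Quotient.field w.asIdeal
  have : Module.Finite (KInf k) (KInfty k F K ⧸ w.asIdeal) :=
    Module.Finite.of_surjective (Ideal.Quotient.mkₐ (KInf k) w.asIdeal).toLinearMap
      Ideal.Quotient.mk_surjective
  have : Algebra.IsAlgebraic (KInf k) (KInfty k F K ⧸ w.asIdeal) := inferInstance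
  exact Ideal.Quotient.eq_zero_iff_mem.1 (eq_zero_of_map_spectralNorm_eq_zero
    (K := KInf k) (L := KInfty k F K ⧸ w.asIdeal) h (Algebra.IsAlgebraic.isAlgebraic _))

/-- The local norm of a root of a monic polynomial with coefficients in `k[[t⁻¹]]` is at most `1`.
-/
lemma normAt_le_one {x : KInfty k F K} {p : Polynomial (KInf k)} (hp : p.Monic)
    (hp1 : ∀ n, ‖p.coeff n‖ ≤ 1) (hx : Polynomial.aeval x p = 0)
    (w : MaximalSpectrum (KInfty k F K)) : normAt w x ≤ 1 := by
  let : Field (KInfty k F K ⧸ w.asIdeal) := Ideal.Quotient.field w.asIdeal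
  have : Module.Finite (KInf k) (KInfty k F K ⧸ w.asIdeal) :=
    Module.Finite.of_surjective (Ideal.Quotient.mkₐ (KInf k) w.asIdeal).toLinearMap
      Ideal.Quotient.mk_surjective
  have : Algebra.IsAlgebraic (KInf k) (KInfty k F K ⧸ w.asIdeal) := inferInstance
  have h1 : Polynomial.aeval (Ideal.Quotient.mk w.asIdeal x) p = 0 := by
    have := Polynomial.aeval_algHom_apply (Ideal.Quotient.mkₐ (KInf k) w.asIdeal) x p
    rw [hx, map_zero] at this
    exact this
  have h2 := norm_root_le_spectralValue (f := spectralAlgNorm (KInf k) (KInfty k F K ⧸ w.asIdeal))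
    spectralAlgNorm_isPowMul isNonarchimedean_spectralNorm hp h1
  exact h2.trans ((spectralValue_le_one_iff hp).2 hp1)

instance : Finite (MaximalSpectrum (KInfty k F K)) :=
  have : IsArtinianRing (KInfty k F K) := IsArtinianRing.of_finite (KInf k) (KInfty k F K)
  inferInstance

lemma normAt_le_normInf (w : MaximalSpectrum (KInfty k F K)) (x : KInfty k F K) :
    normAt w x ≤ normInf k F K x :=
  le_ciSup (f := fun w => normAt w x) (Set.finite_range _).bddAbove w

omit [Module.Finite (KInf k) (KInfty k F K)] in
lemma normInf_nonneg (x : KInfty k F K) : 0 ≤ normInf k F K x :=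
  Real.iSup_nonneg fun w => normAt_nonneg w x

omit [Module.Finite (KInf k) (KInfty k F K)] in
lemma normInf_le {x : KInfty k F K} {B : ℝ} (hB : 0 ≤ B) (h : ∀ w, normAt w x ≤ B) :
    normInf k F K x ≤ B :=
  Real.iSup_le h hB

lemma normInf_add_le (x y : KInfty k F K) :
    normInf k F K (x + y) ≤ max (normInf k F K x) (normInf k F K y) :=
  normInf_le (le_max_of_le_left (normInf_nonneg x)) fun w => (normAt_add_le w x y).trans
    (max_le_max (normAt_le_normInf w x) (normAt_le_normInf w y))

lemma normInf_smul (c : KInf k) (x : KInfty k F K) :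
    normInf k F K (c • x) = ‖c‖ * normInf k F K x := by
  rw [normInf_eq, normInf_eq, Real.mul_iSup_of_nonneg (norm_nonneg c)]
  simp_rw [normAt_smul]

omit [Module.Finite (KInf k) (KInfty k F K)] in
lemma normInf_zero : normInf k F K 0 = 0 :=
  le_antisymm (normInf_le le_rfl fun w => (normAt_zero w).le) (normInf_nonneg 0)

lemma normInf_sum_le {ι : Type*} (s : Finset ι) (f : ι → KInfty k F K) {B : ℝ} (hB : 0 ≤ B)
    (h : ∀ i ∈ s, normInf k F K (f i) ≤ B) : normInf k F K (∑ i ∈ s, f i) ≤ B := by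
  classical
  induction s using Finset.induction_on with
  | empty => rw [Finset.sum_empty, normInf_zero]; exact hB
  | insert a s ha ih =>
    rw [Finset.sum_insert ha]
    exact (normInf_add_le _ _).trans (max_le (h a (Finset.mem_insert_self a s))
      (ih fun i hi => h i (Finset.mem_insert_of_mem hi)))

/-- The algebra `K_∞` is reduced since `K` is separable over `k(t)`. -/
lemma normInf_eq_zero [Algebra.IsSeparable (RatFunc k) K] {x : KInfty k F K} :
    normInf k F K x = 0 ↔ x = 0 := by
  refine ⟨fun h => ?_, fun h => by rw [h, normInf_zero]⟩
  have hart : IsArtinianRing (KInfty k F K) := IsArtinianRing.of_finite (KInf k) (KInfty k F K)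
  have hun : Algebra.FormallyUnramified (RatFunc k) K :=
    Algebra.FormallyUnramified.of_isSeparable _ _
  have hred : IsReduced (KInfty k F K) := by
    have h1 : Algebra.FormallyUnramified (KInf k) (KInf k ⊗[RatFunc k] K) := inferInstance
    have h2 : Module.Finite (KInf k) (KInf k ⊗[RatFunc k] K) :=
      inferInstanceAs (Module.Finite (KInf k) (KInfty k F K))
    exact Algebra.FormallyUnramified.isReduced_of_field (KInf k) (KInf k ⊗[RatFunc k] K)
  have hx : x ∈ nilradical (KInfty k F K) := by
    rw [nilradical, ← IsArtinianRing.jacobson_eq_radical, Ideal.jacobson, Ideal.mem_sInf]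
    rintro I ⟨-, hI⟩
    have h0 : normAt ⟨I, hI⟩ x = 0 :=
      le_antisymm ((normAt_le_normInf _ x).trans h.le) (normAt_nonneg _ _)
    exact mem_of_normAt_eq_zero h0
  rwa [nilradical_eq_zero, Ideal.zero_eq_bot, Ideal.mem_bot] at hx

end SupNorm

section Comparison

variable {k : Type u} [Field k] [Finite k]
variable {F : Type u} [Field F] [Algebra (RatFunc k) F]
variable {K : Type u} [Field K] [Algebra (RatFunc k) K] [Algebra F K]
  [IsScalarTower (RatFunc k) F K]
variable {G : Type u} [CommGroup G] [MulSemiringAction G K] [IsGaloisGroup G F K] [Fintype G]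
variable {ι : Type*} (b : Module.Basis ι (BigRing k G) (KInfty k F K))

/-- The coordinate forms of `K_∞` over `k((t⁻¹))`. -/
def coordForm (p : ι × G) : KInfty k F K →ₗ[KInf k] KInf k where
  toFun x := (b.repr x p.1).coeff p.2
  map_add' x y := by
    rw [map_add, Finsupp.add_apply, MonoidAlgebra.coeff_add, Finsupp.add_apply]
  map_smul' c x := by
    have : b.repr (c • x) p.1 = c • b.repr x p.1 := by
      rw [← algebraMap_smul (BigRing k G) c x, map_smul, Finsupp.smul_apply, algebraMap_smul]
    rw [this]
    rfl

lemma sum_coordForm [Fintype ι] (x : KInfty k F K) :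
    ∑ p : ι × G, coordForm b p x • rhoInf k F K G p.2 (b p.1) = x := by
  rw [Fintype.sum_prod_type]
  conv_rhs => rw [← b.sum_repr x]
  refine Finset.sum_congr rfl fun i _ => ?_
  have : b.repr x i = ∑ g, MonoidAlgebra.single g ((b.repr x i).coeff g) := by
    ext h
    rw [coeff_sum_single]
  rw [this, Finset.sum_smul]
  refine Finset.sum_congr rfl fun g _ => ?_
  rw [single_smul]
  rfl

variable {b}

lemma mem_filt_iff_lcoeff {l : ℤ} {x : KInfty k F K} :
    x ∈ filt b l ↔ ∀ p, ∀ m < l, lcoeff (coordForm b p x) m = 0 := by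
  rw [mem_filt]
  have h : ∀ i m g, ((coord b x i).coeff m).coeff g = lcoeff (coordForm b (i, g) x) m :=
    fun i m g => by
      rw [coord, coeff_bigToL, coeff_coeffBig]
      rfl
  constructor
  · rintro hx ⟨i, g⟩ m hm
    rw [← h, hx i m hm]
    rfl
  · intro hx i m hm
    ext g
    rw [h, hx (i, g) m hm]
    rfl

lemma mem_filt_iff_norm {l : ℤ} {x : KInfty k F K} :
    x ∈ filt b l ↔ ∀ p, ‖coordForm b p x‖ ≤ (Nat.card k : ℝ) ^ (-l) := by
  rw [mem_filt_iff_lcoeff]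
  exact forall_congr' fun p => norm_le_iff.symm

lemma exists_le_zpow (B : ℝ) : ∃ c : ℤ, B ≤ (Nat.card k : ℝ) ^ c := by
  obtain ⟨n, hn⟩ := pow_unbounded_of_one_lt B (one_lt_card k)
  exact ⟨n, by rw [zpow_natCast]; exact hn.le⟩

variable [Finite ι]

variable (b) in
/-- The norm is small on the filtration. -/
lemma exists_normInf_le : ∃ c : ℤ, ∀ l, ∀ x ∈ filt b l,
    normInf k F K x ≤ (Nat.card k : ℝ) ^ (c - l) := by
  have := Fintype.ofFinite ι
  have := finite_kInfty b
  obtain ⟨c, hc⟩ := exists_le_zpow (k := k)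
    (∑ p : ι × G, normInf k F K (rhoInf k F K G p.2 (b p.1)))
  refine ⟨c, fun l x hx => ?_⟩
  have hq := one_lt_card k
  rw [← sum_coordForm b x]
  refine normInf_sum_le _ _ (by positivity) fun p _ => ?_
  rw [normInf_smul, sub_eq_neg_add, zpow_add₀ (by positivity)]
  refine mul_le_mul (mem_filt_iff_norm.1 hx p) ?_ (normInf_nonneg _) (by positivity)
  exact (Finset.single_le_sum (f := fun p : ι × G => normInf k F K (rhoInf k F K G p.2 (b p.1)))
    (fun p _ => normInf_nonneg _) (Finset.mem_univ p)).trans hc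

variable (b) in
/-- Elements of small norm are in the filtration. -/
lemma exists_mem_filt [Algebra.IsSeparable (RatFunc k) K] : ∃ c : ℤ, ∀ l, ∀ x : KInfty k F K,
    normInf k F K x ≤ (Nat.card k : ℝ) ^ (-l) → x ∈ filt b (l - c) := by
  have := Fintype.ofFinite ι
  have := finite_kInfty b
  choose C hC using fun p : ι × G => exists_form_bound (normInf k F K) normInf_nonneg
    (fun _ => normInf_eq_zero) (fun x y => (normInf_add_le x y).trans
      (max_le_add_of_nonneg (normInf_nonneg x) (normInf_nonneg y))) normInf_smul (coordForm b p)
  obtain ⟨c, hc⟩ := exists_le_zpow (k := k) (∑ p, |C p|)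
  refine ⟨c, fun l x hx => mem_filt_iff_norm.2 fun p => (hC p x).trans ?_⟩
  have hq := one_lt_card k
  have h1 : C p ≤ (Nat.card k : ℝ) ^ c := (le_abs_self _).trans
    ((Finset.single_le_sum (f := fun p => |C p|) (fun p _ => abs_nonneg _)
      (Finset.mem_univ p)).trans hc)
  rw [neg_sub, sub_eq_add_neg, zpow_add₀ (by positivity)]
  exact mul_le_mul h1 hx (normInf_nonneg _) (by positivity)

variable (k F K) in
instance : IsModuleTopology (KInf k) (KInfty k F K) := ⟨rfl⟩

instance : IsTopologicalAddGroup (KInfty k F K) :=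
  IsModuleTopology.topologicalAddGroup (KInf k) (KInfty k F K)

omit [Fintype G] [Finite ι] in
lemma continuous_coordForm (p : ι × G) : Continuous (coordForm b p) :=
  IsModuleTopology.continuous_of_linearMap _

variable (b) in
include b in
lemma t2Space_kInfty : T2Space (KInfty k F K) := by
  have := Fintype.ofFinite ι
  refine T2Space.of_injective_continuous (f := fun (x : KInfty k F K) p => coordForm b p x)
    (fun x y h => ?_) (continuous_pi fun p => continuous_coordForm p)
  rw [← sum_coordForm b x, ← sum_coordForm b y]
  exact Finset.sum_congr rfl fun p _ => by
    rw [show coordForm b p x = coordForm b p y from congrFun h p]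

variable (b) in
lemma isOpen_filt (l : ℤ) : IsOpen (filt b l : Set (KInfty k F K)) := by
  have h : (filt b l : Set (KInfty k F K)) =
      ⋂ p, coordForm b p ⁻¹' Metric.closedBall 0 ((Nat.card k : ℝ) ^ (-l)) := by
    ext x
    rw [SetLike.mem_coe, mem_filt_iff_norm, Set.mem_iInter]
    exact forall_congr' fun p => by rw [Set.mem_preimage, mem_closedBall_zero_iff]
  have hq := one_lt_card k
  rw [h]
  exact isOpen_iInter_of_finite fun p => (IsUltrametricDist.isOpen_closedBall _
    (by positivity)).preimage (continuous_coordForm p)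

/-- The quotient of `K_∞` by a lattice is Hausdorff. -/
lemma t2Space_quotient (b : Module.Basis ι (BigRing k G) (KInfty k F K))
    {Λ : Submodule (GrpRing k G)[X] (KInfty k F K)} {l : ℤ}
    (h : ∀ x ∈ filt b l, x ∈ Λ → x = 0) : T2Space (KInfty k F K ⧸ Λ) := by
  have := t2Space_kInfty b
  have hd : DiscreteTopology Λ.toAddSubgroup := by
    refine discreteTopology_of_isOpen_singleton_zero ?_
    have : ({0} : Set Λ.toAddSubgroup) = Subtype.val ⁻¹' (filt b l : Set (KInfty k F K)) := by
      ext x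
      rw [Set.mem_singleton_iff, Set.mem_preimage, SetLike.mem_coe]
      exact ⟨fun hx => by rw [hx]; exact Submodule.zero_mem _, fun hx =>
        Subtype.ext (h _ hx x.2)⟩
    rw [this]
    exact (isOpen_filt b l).preimage continuous_subtype_val
  have hc : IsClosed (Λ.toAddSubgroup : Set (KInfty k F K)) := AddSubgroup.isClosed_of_discrete
  have hc' : IsClosed (Λ : Set (KInfty k F K)) := hc
  have : T3Space (KInfty k F K ⧸ Λ) := inferInstance
  infer_instance

end Comparison

/-! ### The valuation ring at infinity of `k(t)` -/

section RatInt

variable {k : Type u} [Field k]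

lemma mem_ratInt {x : RatFunc k} : x ∈ ratInt k ↔ x = 0 ∨ x.intDegree ≤ 0 := by
  classical
  change RatFunc.inftyValuation k x ≤ 1 ↔ _
  by_cases hx : x = 0
  · simp [hx]
  · rw [RatFunc.inftyValuation_apply, RatFunc.inftyValuation_of_nonzero k hx]
    rw [← WithZero.exp_zero, WithZero.exp_le_exp]
    simp [hx]

lemma X_inv_pow_mem_ratInt (m : ℕ) : (RatFunc.X⁻¹ : RatFunc k) ^ m ∈ ratInt k :=
  (ratInt k).pow_mem (mem_ratInt.2 (Or.inr (by simp [RatFunc.intDegree_inv]))) m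

lemma intDegree_X_inv_pow (m : ℕ) : ((RatFunc.X⁻¹ : RatFunc k) ^ m).intDegree = -m := by
  rw [inv_pow, RatFunc.intDegree_inv]
  induction m with
  | zero => simp
  | succ m ih =>
    rw [pow_succ, RatFunc.intDegree_mul (pow_ne_zero _ RatFunc.X_ne_zero) RatFunc.X_ne_zero,
      RatFunc.intDegree_X]
    push_cast
    omega

lemma X_inv_pow_mul_mem (x : RatFunc k) {m : ℕ} (hm : x.intDegree.natAbs ≤ m) :
    (RatFunc.X⁻¹ : RatFunc k) ^ m * x ∈ ratInt k := by
  by_cases hx : x = 0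
  · rw [hx, mul_zero]
    exact (ratInt k).zero_mem
  refine mem_ratInt.2 (Or.inr ?_)
  rw [RatFunc.intDegree_mul (pow_ne_zero _ (inv_ne_zero RatFunc.X_ne_zero)) hx,
    intDegree_X_inv_pow]
  omega

lemma inv_one_sub_X_inv_pow_mem {d : ℕ} (hd : 0 < d) :
    (1 - (RatFunc.X⁻¹ : RatFunc k) ^ d) ≠ 0 ∧ (1 - (RatFunc.X⁻¹ : RatFunc k) ^ d)⁻¹ ∈ ratInt k := by
  classical
  have h : RatFunc.inftyValuation k ((RatFunc.X⁻¹ : RatFunc k) ^ d) < 1 := by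
    rw [map_pow, map_inv₀, RatFunc.inftyValuation.X, ← WithZero.exp_neg, ← WithZero.exp_nsmul,
      ← WithZero.exp_zero, WithZero.exp_lt_exp]
    simpa using hd
  have h1 := Valuation.map_one_sub_of_lt _ h
  refine ⟨fun h0 => ?_, ?_⟩
  · rw [h0, map_zero] at h1
    exact zero_ne_one h1
  · change RatFunc.inftyValuation k _ ≤ 1
    rw [map_inv₀, h1, inv_one]

variable [Finite k]

lemma lcoeff_algebraMap_poly (p : k[X]) (n : ℕ) :
    lcoeff (algebraMap k[X] (KInf k) p) (-n) = p.coeff n := coeff_polyToLaurentAux k p n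

lemma norm_algebraMap_poly {p : k[X]} (hp : p ≠ 0) :
    ‖algebraMap k[X] (KInf k) p‖ = (Nat.card k : ℝ) ^ (p.natDegree : ℤ) := by
  refine le_antisymm ?_ (not_lt.1 fun hlt => ?_)
  · rw [← neg_neg (p.natDegree : ℤ), norm_le_iff]
    intro l hl
    obtain ⟨n, rfl⟩ : ∃ n : ℕ, l = -n := ⟨l.natAbs, by omega⟩
    rw [lcoeff_algebraMap_poly, Polynomial.coeff_eq_zero_of_natDegree_lt (by omega)]
  · have h0 : algebraMap k[X] (KInf k) p ≠ 0 :=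
      (map_ne_zero_iff _ (polyToLaurent_injective k)).2 hp
    obtain ⟨m, hm⟩ := exists_norm_eq h0
    rw [hm, zpow_lt_zpow_iff_right₀ (one_lt_card k)] at hlt
    have := norm_le_iff.1 hm.le (-p.natDegree) (by omega)
    rw [lcoeff_algebraMap_poly, Polynomial.coeff_natDegree, Polynomial.leadingCoeff_eq_zero] at this
    exact hp this

lemma algebraMap_ratFunc_poly (p : k[X]) : algebraMap (RatFunc k) (KInf k) (algebraMap _ _ p) =
    algebraMap k[X] (KInf k) p := IsFractionRing.lift_algebraMap (polyToLaurent_injective k) p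

lemma algebraMap_ratFunc_X : algebraMap (RatFunc k) (KInf k) RatFunc.X = tInf k := by
  rw [← RatFunc.algebraMap_X, algebraMap_ratFunc_poly, algebraMap_kpoly, Polynomial.eval₂_X]

lemma norm_algebraMap_le_one {x : RatFunc k} (hx : x ∈ ratInt k) :
    ‖algebraMap (RatFunc k) (KInf k) x‖ ≤ 1 := by
  rcases mem_ratInt.1 hx with rfl | hd
  · rw [map_zero, kinf_norm_zero]
    exact zero_le_one
  by_cases hx0 : x = 0
  · rw [hx0, map_zero, kinf_norm_zero]
    exact zero_le_one
  have hq := one_lt_card k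
  rw [← RatFunc.num_div_denom x, map_div₀, algebraMap_ratFunc_poly, algebraMap_ratFunc_poly,
    norm_div, norm_algebraMap_poly (RatFunc.num_ne_zero hx0),
    norm_algebraMap_poly (RatFunc.denom_ne_zero x), ← zpow_sub₀ (by positivity)]
  exact zpow_le_one_of_nonpos₀ hq.le hd

end RatInt

/-! ### Taming modules as lattices over the valuation ring at infinity -/

section Taming

variable {k : Type u} [Field k]
variable {F : Type u} [Field F] [Algebra (RatFunc k) F]
variable {K : Type u} [Field K] [Algebra F K]
variable {G : Type u} [CommGroup G] [MulSemiringAction G K] [IsGaloisGroup G F K]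
variable {W : Submodule (MonoidAlgebra (OF k F) G) (rhoK k F K G).asModule}

/-- The elements of a taming module, as a set of elements of `K`. -/
def tamingSet (W : Submodule (MonoidAlgebra (OF k F) G) (rhoK k F K G).asModule) : AddSubgroup K :=
  W.toAddSubgroup.map (rhoK k F K G).asModuleEquiv.toAddMonoidHom

lemma smul_mem_tamingSet (g : G) {x : K} (hx : x ∈ tamingSet W) : g • x ∈ tamingSet W := by
  obtain ⟨w, hw, rfl⟩ := hx
  refine ⟨MonoidAlgebra.single g 1 • w, W.smul_mem _ hw, ?_⟩
  change (rhoK k F K G).asModuleEquiv (MonoidAlgebra.single g 1 • w) = _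
  rw [Representation.asModuleEquiv_map_smul, Representation.asAlgebraHom_single, one_smul]
  rfl

lemma asModuleEquiv_algebraMap_smul (a : OF k F) (w : (rhoK k F K G).asModule) :
    (rhoK k F K G).asModuleEquiv (algebraMap (OF k F) (MonoidAlgebra (OF k F) G) a • w) =
      a • (rhoK k F K G).asModuleEquiv w := by
  have h : algebraMap (OF k F) (MonoidAlgebra (OF k F) G) a = MonoidAlgebra.single 1 a := rfl
  rw [Representation.asModuleEquiv_map_smul, h, Representation.asAlgebraHom_single, map_one]
  rfl

variable [Algebra (RatFunc k) K] [IsScalarTower (RatFunc k) F K]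

lemma ratInt_smul_eq (a : ratInt k) (x : K) :
    algebraMap (ratInt k) (OF k F) a • x = (a : RatFunc k) • x := by
  rw [algebraMap_smul]
  rfl

lemma ratInt_smul_mem_tamingSet {a : RatFunc k} (ha : a ∈ ratInt k) {x : K}
    (hx : x ∈ tamingSet W) : a • x ∈ tamingSet W := by
  obtain ⟨w, hw, rfl⟩ := hx
  refine ⟨algebraMap (OF k F) (MonoidAlgebra (OF k F) G) (algebraMap (ratInt k) (OF k F) ⟨a, ha⟩) • w,
    W.smul_mem _ hw, ?_⟩
  exact (asModuleEquiv_algebraMap_smul _ w).trans (ratInt_smul_eq ⟨a, ha⟩ _)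

variable [FiniteDimensional (RatFunc k) K]

lemma exists_X_inv_pow_smul_integral (y : K) :
    ∃ m : ℕ, IsIntegral (ratInt k) ((RatFunc.X⁻¹ : RatFunc k) ^ m • y) := by
  classical
  have hfr : IsFractionRing (ratInt k) (RatFunc k) :=
    (Valuation.integer.integers (RatFunc.inftyValuation k)).isFractionRing
  have halg : IsAlgebraic (ratInt k) y :=
    (IsFractionRing.isAlgebraic_iff (ratInt k) (RatFunc k) K).2 (Algebra.IsAlgebraic.isAlgebraic y)
  obtain ⟨a, ha, hay⟩ := halg.exists_integral_multiple
  have ha' : (a : RatFunc k) ≠ 0 := fun h => ha (Subtype.ext h)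
  let m := (a : RatFunc k)⁻¹.intDegree.natAbs
  refine ⟨m, ?_⟩
  have := hay.smul (⟨_, X_inv_pow_mul_mem (a : RatFunc k)⁻¹ (m := m) le_rfl⟩ : ratInt k)
  convert this using 1
  change _ = ((RatFunc.X⁻¹ : RatFunc k) ^ m * (a : RatFunc k)⁻¹) • ((a : RatFunc k) • y)
  rw [smul_smul, mul_assoc, inv_mul_cancel₀ ha', mul_one]

/-- A taming module spans `K` over `k(t)`: since `𝒪_{K,∞}/W` is finite, the classes of two distinct
elements `t⁻ⁿ z` and `t⁻ᵐ z` agree, and `1 - t⁻ᵈ` is a unit at infinity. -/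
lemma exists_X_inv_pow_smul_mem (hW : Finite (OK k F K ⧸ tamingSub W)) (y : K) :
    ∃ m : ℕ, (RatFunc.X⁻¹ : RatFunc k) ^ m • y ∈ tamingSet W := by
  obtain ⟨m, hm⟩ := exists_X_inv_pow_smul_integral (k := k) y
  set T : RatFunc k := RatFunc.X⁻¹ with hT
  have hint : ∀ n : ℕ, T ^ n • T ^ m • y ∈ OK k F K := fun n => by
    have h1 : IsIntegral (ratInt k) (T ^ n • T ^ m • y) :=
      hm.smul (⟨_, X_inv_pow_mem_ratInt n⟩ : ratInt k)
    exact h1.tower_top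
  obtain ⟨n, n', hne, hn⟩ := Finite.exists_ne_map_eq_of_infinite
    fun n : ℕ => (Submodule.Quotient.mk ⟨_, hint n⟩ : OK k F K ⧸ tamingSub W)
  wlog hlt : n < n' generalizing n n'
  · exact this n' n hne.symm hn.symm (by omega)
  rw [Submodule.Quotient.eq] at hn
  have h2 : T ^ n • T ^ m • y - T ^ n' • T ^ m • y ∈ tamingSet W := ⟨_, hn, rfl⟩
  obtain ⟨h0, hinv⟩ := inv_one_sub_X_inv_pow_mem (k := k) (d := n' - n) (by omega)
  refine ⟨n + m, ?_⟩
  convert ratInt_smul_mem_tamingSet hinv h2 using 1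
  have h3 : T ^ n' = T ^ n * T ^ (n' - n) := by rw [← pow_add, Nat.add_sub_cancel' hlt.le]
  rw [← sub_smul, smul_smul, h3, ← mul_one_sub, mul_comm (T ^ n), ← mul_assoc, inv_mul_cancel₀ h0,
    one_mul, smul_smul, pow_add]

lemma exists_X_inv_pow_smul_mem_of_le (hW : Finite (OK k F K ⧸ tamingSub W)) (y : K) :
    ∃ m : ℕ, ∀ n, m ≤ n → (RatFunc.X⁻¹ : RatFunc k) ^ n • y ∈ tamingSet W := by
  obtain ⟨m, hm⟩ := exists_X_inv_pow_smul_mem hW y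
  refine ⟨m, fun n hn => ?_⟩
  have := ratInt_smul_mem_tamingSet (X_inv_pow_mem_ratInt (n - m)) hm
  rwa [smul_smul, ← pow_add, Nat.sub_add_cancel hn] at this

end Taming

/-! ### Sums of conjugates on projective modules over group rings -/

section Conj

variable {S : Type*} [CommRing S] {G : Type*} [Group G] [Fintype G]
variable {P : Type*} [AddCommGroup P] [Module (MonoidAlgebra S G) P]

/-- On a projective module over the group ring of a finite group the identity is the sum of the
conjugates of some endomorphism. -/
lemma exists_sum_conj [Module.Projective (MonoidAlgebra S G) P] : ∃ f : P →+ P,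
    (∀ (a : S) x, f (algebraMap S (MonoidAlgebra S G) a • x) =
      algebraMap S (MonoidAlgebra S G) a • f x) ∧
    ∀ x, ∑ g : G, (MonoidAlgebra.single g⁻¹ 1 : MonoidAlgebra S G) •
      f ((MonoidAlgebra.single g 1 : MonoidAlgebra S G) • x) = x := by
  classical
  obtain ⟨s, hs⟩ := (Module.projective_def (R := MonoidAlgebra S G) (P := P)).1 inferInstance
  -- on a free module the projection to the coefficient of `1` has the identity as sum of conjugates
  let c : MonoidAlgebra S G →+ MonoidAlgebra S G :=
    { toFun := fun z => MonoidAlgebra.single 1 (z.coeff 1)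
      map_zero' := by simp
      map_add' := fun x y => by simp [MonoidAlgebra.single_add] }
  let q := Finsupp.linearCombination (MonoidAlgebra S G) (id : P → P)
  let r : (P →₀ MonoidAlgebra S G) →+ P :=
    q.toAddMonoidHom.comp (Finsupp.mapRange.addMonoidHom c)
  have hr : ∀ a z, r (Finsupp.single a z) = c z • a := fun a z => by
    change q (Finsupp.mapRange c (map_zero c) (Finsupp.single a z)) = _
    rw [Finsupp.mapRange_single, Finsupp.linearCombination_single]
    rfl
  have hr1 : ∀ (a : S) u, r (algebraMap S (MonoidAlgebra S G) a • u) =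
      algebraMap S (MonoidAlgebra S G) a • r u := fun a u => by
    induction u using Finsupp.induction_linear with
    | zero => rw [smul_zero, map_zero, smul_zero]
    | add u v hu hv => rw [smul_add, map_add, map_add, smul_add, hu, hv]
    | single b z =>
      rw [Finsupp.smul_single, hr, hr, smul_smul]
      congr 1
      change (MonoidAlgebra.single 1 (((MonoidAlgebra.single 1 a : MonoidAlgebra S G) * z).coeff 1) :
        MonoidAlgebra S G) = MonoidAlgebra.single 1 a * MonoidAlgebra.single 1 (z.coeff 1)
      rw [MonoidAlgebra.single_mul_single, MonoidAlgebra.coeff_single_mul_apply, inv_one, one_mul]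
  have hr2 : ∀ u, ∑ g : G, (MonoidAlgebra.single g⁻¹ 1 : MonoidAlgebra S G) •
      r ((MonoidAlgebra.single g 1 : MonoidAlgebra S G) • u) = q u := fun u => by
    induction u using Finsupp.induction_linear with
    | zero => simp
    | add u v hu hv => simp_rw [smul_add, map_add, smul_add, Finset.sum_add_distrib, hu, hv]
    | single b z =>
      simp_rw [Finsupp.smul_single, hr, smul_smul]
      rw [← Finset.sum_smul, Finsupp.linearCombination_single]
      congr 1
      refine (Finset.sum_congr rfl fun g _ => ?_).trans ((Equiv.sum_comp (Equiv.inv G) fun g =>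
        (MonoidAlgebra.single g (z.coeff g) : MonoidAlgebra S G)).trans ?_)
      · change MonoidAlgebra.single g⁻¹ 1 *
          MonoidAlgebra.single 1 ((MonoidAlgebra.single g 1 * z).coeff 1) = _
        rw [MonoidAlgebra.single_mul_single, MonoidAlgebra.coeff_single_mul_apply]
        simp
      · ext g
        simp [MonoidAlgebra.coeff_sum]
  refine ⟨r.comp s.toAddMonoidHom, fun a x => ?_, fun x => ?_⟩
  · change r (s (_ • x)) = _ • r (s x)
    rw [map_smul, hr1]
  · refine Eq.trans (Finset.sum_congr rfl fun g _ => ?_) ((hr2 (s x)).trans (hs x))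
    change _ • r (s (_ • x)) = _
    rw [map_smul]

end Conj

/-! ### Neighbourhoods of zero defined by a taming module -/

section Nbhd

variable {k : Type u} [Field k] [Finite k]
variable {F : Type u} [Field F] [Algebra (RatFunc k) F]
variable {K : Type u} [Field K] [Algebra (RatFunc k) K] [Algebra F K]
  [IsScalarTower (RatFunc k) F K]
variable {G : Type u} [CommGroup G] [MulSemiringAction G K] [IsGaloisGroup G F K]
variable {W : Submodule (MonoidAlgebra (OF k F) G) (rhoK k F K G).asModule}

lemma mem_powerSeriesSubring {c : KInf k} : c ∈ powerSeriesSubring k ↔ ‖c‖ ≤ 1 := by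
  have h0 : (1 : ℝ) = (Nat.card k : ℝ) ^ (-0 : ℤ) := by rw [neg_zero, zpow_zero]
  rw [h0, norm_le_iff]
  constructor
  · rintro ⟨f, rfl⟩ l hl
    exact coeff_psL_of_neg f hl
  · intro h
    refine ⟨PowerSeries.mk fun n => lcoeff c n, KInf.ext fun l => ?_⟩
    rcases lt_or_ge l 0 with hl | hl
    · rw [h l hl]
      exact coeff_psL_of_neg _ hl
    · lift l to ℕ using hl
      exact (coeff_psL_natCast _ l).trans (PowerSeries.coeff_mk _ _)

lemma tInf_ne_zero : tInf k ≠ 0 := HahnSeries.single_ne_zero one_ne_zero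

lemma norm_tInf_inv_pow (i : ℕ) : ‖(tInf k)⁻¹ ^ i‖ = (Nat.card k : ℝ) ^ (-(i : ℤ)) := by
  rw [norm_pow, norm_inv, norm_tInf, zpow_neg, zpow_natCast, inv_pow]

lemma tmul_mem_nbhd {a : KInf k} {i : ℕ} (ha : ‖a‖ ≤ (Nat.card k : ℝ) ^ (-(i : ℤ))) {x : K}
    (hx : x ∈ tamingSet W) : KInfty.tmul k F K a x ∈ nbhd W i := by
  obtain ⟨w, hw, rfl⟩ := hx
  have hq := one_lt_card k
  refine Submodule.subset_span ⟨tInf k ^ i * a, mem_powerSeriesSubring.2 ?_, w, hw, ?_⟩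
  · rw [norm_mul, norm_pow, norm_tInf]
    calc _ ≤ (Nat.card k : ℝ) ^ i * (Nat.card k : ℝ) ^ (-(i : ℤ)) := by gcongr
      _ = 1 := by rw [zpow_neg, zpow_natCast, mul_inv_cancel₀ (by positivity)]
  · rw [← mul_assoc, ← mul_pow, inv_mul_cancel₀ tInf_ne_zero, one_pow, one_mul]
    rfl

@[elab_as_elim]
lemma KInfty.induction_on {p : KInfty k F K → Prop} (x : KInfty k F K) (zero : p 0)
    (tmul : ∀ a x, p (KInfty.tmul k F K a x)) (add : ∀ x y, p x → p y → p (x + y)) : p x :=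
  TensorProduct.induction_on (motive := p) x zero tmul add

/-- Induction on the neighbourhoods of zero by pure tensors. Elements of `R` need no separate step:
the pure tensors are stable under `k` and under `G`. -/
lemma nbhd_induction {i : ℕ} {p : KInfty k F K → Prop} {x : KInfty k F K} (hx : x ∈ nbhd W i)
    (h0 : p 0) (hadd : ∀ x y, p x → p y → p (x + y))
    (ht : ∀ a : KInf k, ‖a‖ ≤ (Nat.card k : ℝ) ^ (-(i : ℤ)) → ∀ w ∈ tamingSet W,
      p (KInfty.tmul k F K a w)) : p x := by
  suffices h : ∀ (c : k) (g : G), p (algebraMap k (KInf k) c • rhoInf k F K G g x) by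
    have := h 1 1
    rwa [map_one, map_one, one_smul] at this
  induction hx using Submodule.span_induction with
  | zero => intro c g; rwa [map_zero, smul_zero]
  | add x y _ _ hx hy => intro c g; rw [map_add, smul_add]; exact hadd _ _ (hx c g) (hy c g)
  | mem x hx =>
    obtain ⟨a, ha, w, hw, rfl⟩ := hx
    intro c g
    refine ht (algebraMap k (KInf k) c * ((tInf k)⁻¹ ^ i * a)) ?_ _
      (smul_mem_tamingSet g ⟨w, hw, rfl⟩)
    have hc : ‖algebraMap k (KInf k) c‖ ≤ 1 := mem_powerSeriesSubring.1
      ⟨PowerSeries.C c, HahnSeries.ofPowerSeries_C c⟩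
    rw [mem_powerSeriesSubring] at ha
    rw [norm_mul, norm_mul, norm_tInf_inv_pow]
    have : (0 : ℝ) ≤ (Nat.card k : ℝ) ^ (-(i : ℤ)) := by positivity
    nlinarith [norm_nonneg a, norm_nonneg (algebraMap k (KInf k) c),
      mul_le_one₀ hc (norm_nonneg a) ha]
  | smul r x _ ih =>
    intro c g
    have hr : ∀ r : GrpRing k G, ∀ c g, p (algebraMap k (KInf k) c • rhoInf k F K G g (r • x)) := by
      intro r
      induction r using MonoidAlgebra.induction_linear with
      | zero => intro c g; rwa [zero_smul, map_zero, smul_zero]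
      | add r s hr hs =>
        intro c g
        rw [add_smul, map_add, smul_add]
        exact hadd _ _ (hr c g) (hs c g)
      | single h d =>
        intro c g
        convert ih (c * d) (g * h) using 1
        have : (MonoidAlgebra.single h d : GrpRing k G) • x =
            algebraMap k (KInf k) d • rhoInf k F K G h x := by
          rw [grp_smul_eq, toBig, Polynomial.coe_eval₂RingHom, Polynomial.eval₂_C,
            MonoidAlgebra.mapRingHom_single, single_smul]
        rw [this, map_smul, map_mul, map_mul, smul_smul]
        rfl
    exact hr r c g

variable [Fintype G] {ι : Type*} [Finite ι] (b : Module.Basis ι (BigRing k G) (KInfty k F K))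

lemma tmul_eq_smul (a : KInf k) (x : K) :
    KInfty.tmul k F K a x = a • KInfty.tmul k F K 1 x := by
  change a ⊗ₜ[RatFunc k] x = a • (1 : KInf k) ⊗ₜ[RatFunc k] x
  rw [TensorProduct.smul_tmul', smul_eq_mul, mul_one]

lemma tmul_smul_eq (a : KInf k) (c : RatFunc k) (x : K) :
    KInfty.tmul k F K a (c • x) = KInfty.tmul k F K (a * algebraMap (RatFunc k) (KInf k) c) x := by
  change a ⊗ₜ[RatFunc k] (c • x) = (a * algebraMap (RatFunc k) (KInf k) c) ⊗ₜ[RatFunc k] x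
  rw [← TensorProduct.smul_tmul, mul_comm, Algebra.smul_def]

include b in
lemma normInf_tmul_le {a : KInf k} {x : K} (hx : x ∈ OK k F K) :
    normInf k F K (KInfty.tmul k F K a x) ≤ ‖a‖ := by
  have := Fintype.ofFinite ι
  have := finite_kInfty b
  rw [tmul_eq_smul, normInf_smul]
  refine mul_le_of_le_one_right (norm_nonneg a) (normInf_le zero_le_one fun w => ?_)
  have hx1 : IsIntegral (ratInt k) x := by
    have : Algebra.IsIntegral (ratInt k) (OF k F) := integralClosure.AlgebraIsIntegral
    exact isIntegral_trans (R := ratInt k) (A := OF k F) x hx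
  obtain ⟨p, hp, hpx⟩ := hx1
  let j : ratInt k →+* KInf k := (algebraMap (RatFunc k) (KInf k)).comp (ratInt k).subtype
  refine normAt_le_one (p := p.map j) (hp.map j) (fun n => ?_) ?_ w
  · rw [Polynomial.coeff_map]
    exact norm_algebraMap_le_one (p.coeff n).2
  · let m : K →+* KInfty k F K :=
      (Algebra.TensorProduct.includeRight : K →ₐ[RatFunc k] KInf k ⊗[RatFunc k] K).toRingHom
    have hm : m x = KInfty.tmul k F K 1 x := rfl
    have h1 := congrArg m hpx
    rw [Polynomial.hom_eval₂, map_zero, hm] at h1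
    rw [Polynomial.aeval_def, Polynomial.eval₂_map]
    convert h1 using 2
    refine RingHom.ext fun a => ?_
    change (algebraMap (RatFunc k) (KInf k) a) ⊗ₜ[RatFunc k] (1 : K) =
      (1 : KInf k) ⊗ₜ[RatFunc k] (algebraMap (RatFunc k) K a)
    rw [Algebra.algebraMap_eq_smul_one, Algebra.algebraMap_eq_smul_one, TensorProduct.smul_tmul]

/-- The neighbourhoods of zero defined by a taming module are contained in the filtration. -/
lemma exists_nbhd_le [Algebra.IsSeparable (RatFunc k) K]
    (hW : ∀ x ∈ W, (rhoK k F K G).asModuleEquiv x ∈ OK k F K) :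
    ∃ c : ℤ, ∀ i : ℕ, nbhd W i ≤ filt b (i - c) := by
  obtain ⟨c, hc⟩ := exists_mem_filt b
  refine ⟨c, fun i x hx => nbhd_induction hx (Submodule.zero_mem _)
    (fun _ _ => Submodule.add_mem _) fun a ha w hw => hc _ _ ?_⟩
  obtain ⟨w, hw, rfl⟩ := hw
  exact (normInf_tmul_le b (hW w hw)).trans ha

lemma exists_bound {α : Type*} [Finite α] (p : α → ℕ → Prop)
    (h : ∀ a, ∃ m, ∀ n, m ≤ n → p a n) : ∃ m, ∀ n, m ≤ n → ∀ a, p a n := by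
  have := Fintype.ofFinite α
  choose m hm using h
  exact ⟨Finset.univ.sup m, fun n hn a => hm a n ((Finset.le_sup (Finset.mem_univ a)).trans hn)⟩

variable [FiniteDimensional (RatFunc k) K]

/-- The filtration is contained in the neighbourhoods of zero defined by a taming module. -/
lemma exists_le_nbhd (hW : Finite (OK k F K ⧸ tamingSub W)) {y : ι → K}
    (hy : ∀ i, b i = KInfty.tmul k F K 1 (y i)) : ∃ c : ℕ, ∀ i : ℕ, filt b (i + c) ≤ nbhd W i := by
  have := Fintype.ofFinite ι
  obtain ⟨c, hc⟩ := exists_bound (fun (p : ι × G) n =>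
    (RatFunc.X⁻¹ : RatFunc k) ^ n • p.2 • y p.1 ∈ tamingSet W)
    fun p => exists_X_inv_pow_smul_mem_of_le hW _
  refine ⟨c, fun i x hx => ?_⟩
  rw [← sum_coordForm b x]
  refine Submodule.sum_mem _ fun p _ => ?_
  have hq := one_lt_card k
  have h : coordForm b p x • rhoInf k F K G p.2 (b p.1) = KInfty.tmul k F K
      (coordForm b p x * tInf k ^ c) ((RatFunc.X⁻¹ : RatFunc k) ^ c • p.2 • y p.1) := by
    rw [tmul_smul_eq, map_pow, map_inv₀, algebraMap_ratFunc_X, mul_assoc, ← mul_pow,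
      mul_inv_cancel₀ tInf_ne_zero, one_pow, mul_one, hy, rhoInf_tmul, ← tmul_eq_smul]
  rw [h]
  refine tmul_mem_nbhd ?_ (hc c le_rfl p)
  rw [norm_mul, norm_pow, norm_tInf]
  calc _ ≤ (Nat.card k : ℝ) ^ (-(i + c : ℤ)) * (Nat.card k : ℝ) ^ c := by
        gcongr
        exact mem_filt_iff_norm.1 hx p
    _ = _ := by rw [← zpow_natCast, ← zpow_add₀ (by positivity)]; congr 1; ring

omit [Finite k] [Fintype G] in
/-- A map on a subgroup which spans `K` extends to `K` if it is linear over the valuation ring at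
infinity of `k(t)`. -/
lemma exists_linearMap_extension {X : AddSubgroup K}
    (hX : ∀ y : K, ∃ m : ℕ, ∀ n, m ≤ n → (RatFunc.X⁻¹ : RatFunc k) ^ n • y ∈ X)
    (hsmul : ∀ a ∈ ratInt k, ∀ x ∈ X, a • x ∈ X) (f : X →+ K)
    (hf : ∀ (a : RatFunc k) (x y : X), a ∈ ratInt k → (y : K) = a • (x : K) → f y = a • f x) :
    ∃ f' : K →ₗ[RatFunc k] K, ∀ x : X, f' x = f x := by
  let B := Module.finBasis (RatFunc k) K
  obtain ⟨c, hc⟩ := exists_bound _ fun l => hX (B l)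
  have hT : (RatFunc.X⁻¹ : RatFunc k) ≠ 0 := inv_ne_zero RatFunc.X_ne_zero
  let B' := B.unitsSMul fun _ => Units.mk0 _ (pow_ne_zero c hT)
  have hB' : ∀ l, B' l ∈ X := fun l => by
    rw [Module.Basis.unitsSMul_apply]
    exact hc c le_rfl l
  refine ⟨B'.constr ℕ fun l => f ⟨B' l, hB' l⟩, fun x => ?_⟩
  set f' := B'.constr ℕ fun l => f ⟨B' l, hB' l⟩ with hf'
  obtain ⟨m, hm⟩ := exists_bound
    (fun l n => (RatFunc.X⁻¹ : RatFunc k) ^ n * B'.repr (x : K) l ∈ ratInt k)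
    fun l => ⟨_, fun n hn => X_inv_pow_mul_mem _ hn⟩
  set T : RatFunc k := RatFunc.X⁻¹
  let z : Fin (Module.finrank (RatFunc k) K) → X := fun l =>
    ⟨(T ^ m * B'.repr (x : K) l) • B' l, hsmul _ (hm m le_rfl l) _ (hB' l)⟩
  have h1 : ((∑ l, z l : X) : K) = T ^ m • (x : K) := by
    conv_rhs => rw [← B'.sum_repr (x : K)]
    rw [AddSubgroup.val_finsetSum, Finset.smul_sum]
    exact Finset.sum_congr rfl fun l _ => by rw [smul_smul]
  have h2 : f (∑ l, z l) = T ^ m • f x := hf _ x _ (X_inv_pow_mem_ratInt m) h1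
  have h3 : f (∑ l, z l) = T ^ m • f' x := by
    rw [← map_smul, ← h1, map_sum, AddSubgroup.val_finsetSum, map_sum]
    refine Finset.sum_congr rfl fun l _ => ?_
    rw [hf _ ⟨B' l, hB' l⟩ (z l) (hm m le_rfl l) rfl, map_smul, hf', Module.Basis.constr_basis]
  exact smul_right_injective K (pow_ne_zero m hT) (h3.symm.trans h2)

omit [Finite k] [FiniteDimensional (RatFunc k) K] in
/-- On a projective taming module the identity is the sum of the conjugates of some
endomorphism. -/
lemma exists_sum_conj_tamingSet [Module.Projective (MonoidAlgebra (OF k F) G) W] :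
    ∃ f : tamingSet W →+ tamingSet W,
      (∀ (a : RatFunc k) (x y : tamingSet W), a ∈ ratInt k → (y : K) = a • (x : K) →
        (f y : K) = a • (f x : K)) ∧
      ∀ x : tamingSet W, ∑ g : G, g⁻¹ • (f ⟨g • (x : K), smul_mem_tamingSet g x.2⟩ : K) = x := by
  obtain ⟨f, hf1, hf2⟩ := exists_sum_conj (S := OF k F) (G := G) (P := W)
  let e : W ≃+ tamingSet W := W.toAddSubgroup.equivMapOfInjective
    (rhoK k F K G).asModuleEquiv.toAddMonoidHom (rhoK k F K G).asModuleEquiv.injective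
  have hea : ∀ (a : ratInt k) (w : W), (e (algebraMap (OF k F) (MonoidAlgebra (OF k F) G)
      (algebraMap (ratInt k) (OF k F) a) • w) : K) = (a : RatFunc k) • (e w : K) := fun a w =>
    (asModuleEquiv_algebraMap_smul _ (w : (rhoK k F K G).asModule)).trans (ratInt_smul_eq a _)
  have heg : ∀ (g : G) (w : W), (e ((MonoidAlgebra.single g 1 : MonoidAlgebra (OF k F) G) • w) : K) =
      g • (e w : K) := fun g w => by
    change (rhoK k F K G).asModuleEquiv ((MonoidAlgebra.single g 1 : MonoidAlgebra (OF k F) G) •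
      (w : (rhoK k F K G).asModule)) = _
    rw [Representation.asModuleEquiv_map_smul, Representation.asAlgebraHom_single, one_smul]
    rfl
  clear_value e
  refine ⟨e.toAddMonoidHom.comp (f.comp e.symm.toAddMonoidHom), fun a x y ha hxy => ?_, fun x => ?_⟩
  · have h1 : e.symm y = algebraMap (OF k F) (MonoidAlgebra (OF k F) G)
        (algebraMap (ratInt k) (OF k F) ⟨a, ha⟩) • e.symm x := by
      rw [AddEquiv.symm_apply_eq]
      refine Subtype.ext ?_
      rw [hea, e.apply_symm_apply, hxy]
    change (e (f (e.symm y)) : K) = a • (e (f (e.symm x)) : K)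
    rw [h1, hf1, hea]
  · obtain ⟨w, rfl⟩ := e.surjective x
    have h1 := congrArg (fun x => (e x : K)) (hf2 w)
    rw [map_sum, AddSubgroup.val_finsetSum] at h1
    refine Eq.trans (Finset.sum_congr rfl fun g _ => ?_) h1
    rw [heg]
    have h2 : e.symm ⟨g • (e w : K), smul_mem_tamingSet g (e w).2⟩ =
        (MonoidAlgebra.single g 1 : MonoidAlgebra (OF k F) G) • w := by
      rw [AddEquiv.symm_apply_eq]
      exact Subtype.ext (heg g w).symm
    change g⁻¹ • (e (f (e.symm _)) : K) = _
    rw [h2]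

omit [Finite k] in
/-- The identity of `K` is the sum of the conjugates of a `k(t)`-linear map which preserves the
taming module. -/
lemma exists_sum_conj_taming (hW : Finite (OK k F K ⧸ tamingSub W))
    [Module.Projective (MonoidAlgebra (OF k F) G) W] : ∃ f : K →ₗ[RatFunc k] K,
      (∀ x ∈ tamingSet W, f x ∈ tamingSet W) ∧ ∀ x, ∑ g : G, g⁻¹ • f (g • x) = x := by
  have hG : SMulCommClass G (RatFunc k) K := by
    have : SMulCommClass G F K := IsGaloisGroup.commutes
    exact ⟨fun g a x => by rw [← algebraMap_smul F a x, smul_comm, algebraMap_smul]⟩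
  obtain ⟨f, hf1, hf2⟩ := exists_sum_conj_tamingSet (W := W)
  obtain ⟨f', hf'⟩ := exists_linearMap_extension (exists_X_inv_pow_smul_mem_of_le hW)
    (fun a ha x hx => ratInt_smul_mem_tamingSet ha hx) ((tamingSet W).subtype.comp f) hf1
  refine ⟨f', fun x hx => ?_, fun x => ?_⟩
  · rw [hf' ⟨x, hx⟩]
    exact (f ⟨x, hx⟩).2
  · obtain ⟨m, hm⟩ := exists_X_inv_pow_smul_mem hW x
    have h1 := hf2 ⟨_, hm⟩
    set T : RatFunc k := RatFunc.X⁻¹ ^ m with hT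
    have hT0 : T ≠ 0 := pow_ne_zero m (inv_ne_zero RatFunc.X_ne_zero)
    have h2 : ∑ g : G, g⁻¹ • (f ⟨g • (T • x), smul_mem_tamingSet g hm⟩ : K) =
        T • ∑ g : G, g⁻¹ • f' (g • x) := by
      rw [Finset.smul_sum]
      refine Finset.sum_congr rfl fun g _ => ?_
      have h3 := hf' ⟨g • (T • x), smul_mem_tamingSet g hm⟩
      rw [← smul_comm g⁻¹ T, ← map_smul, ← smul_comm g T]
      exact congrArg (g⁻¹ • ·) h3.symm
    exact smul_right_injective K hT0 (h2.symm.trans h1)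

/-- The neighbourhoods of zero defined by a taming module are projective. -/
lemma projective_nbhd (hW : Finite (OK k F K ⧸ tamingSub W))
    [Module.Projective (MonoidAlgebra (OF k F) G) W] (i : ℕ) :
    Module.Projective (GrpRing k G) (nbhd W i) := by
  obtain ⟨f, hf, hconj⟩ := exists_sum_conj_taming hW
  let f' : KInfty k F K →ₗ[KInf k] KInfty k F K := f.baseChange (KInf k)
  refine projective_submodule (nbhd W i) f' (fun x => ?_) fun x hx => ?_
  · induction x using KInfty.induction_on with
    | zero => exact Finset.sum_eq_zero fun g _ => by rw [map_zero, map_zero, map_zero]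
    | tmul a x =>
      conv_rhs => rw [← hconj x]
      exact (TensorProduct.tmul_sum a Finset.univ fun g : G => g⁻¹ • f (g • x)).symm
    | add x y hx hy =>
      conv_rhs => rw [← hx, ← hy]
      rw [← Finset.sum_add_distrib]
      exact Finset.sum_congr rfl fun g _ => by rw [map_add, map_add, map_add]
  · refine nbhd_induction (p := fun x => f' x ∈ nbhd W i) hx ?_ (fun x y hx hy => ?_)
      fun a ha w hw => ?_
    · rw [map_zero]; exact Submodule.zero_mem _
    · rw [map_add]
      exact Submodule.add_mem _ hx hy
    · exact tmul_mem_nbhd ha (hf w hw)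

end Nbhd

/-! ### Tangency to the identity in terms of the filtration -/

section Tangency

variable {k : Type u} [Field k] [Finite k]
variable {F : Type u} [Field F] [Algebra (RatFunc k) F]
variable {K : Type u} [Field K] [Algebra (RatFunc k) K] [Algebra F K]
  [IsScalarTower (RatFunc k) F K]
variable {G : Type u} [CommGroup G] [MulSemiringAction G K] [IsGaloisGroup G F K] [Fintype G]
variable {M H : Type u} [AddCommGroup M] [Module (GrpRing k G)[X] M] [Module (GrpRing k G) M]
  [IsScalarTower (GrpRing k G) (GrpRing k G)[X] M] [TopologicalSpace M]
  [AddCommGroup H] [Module (GrpRing k G)[X] H]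
variable {M' H' : Type u} [AddCommGroup M'] [Module (GrpRing k G)[X] M'] [Module (GrpRing k G) M']
  [IsScalarTower (GrpRing k G) (GrpRing k G)[X] M'] [TopologicalSpace M']
  [AddCommGroup H'] [Module (GrpRing k G)[X] H']
variable {ι : Type*} (b : Module.Basis ι (BigRing k G) (KInfty k F K))
  (D : StructSeq k F K G M H) (D' : StructSeq k F K G M' H')

/-- On the steps of index at least `l₀` of the filtration of `K_∞`, which meet both lattices
trivially, `γ` is the identity up to terms of order smaller by a factor `t⁻ᴺ`. -/
structure TangentAt (γ : M → M') (N : ℕ) (l₀ : ℤ) : Prop where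
  left : ∀ l ≥ l₀, ∀ x ∈ filt b l, ∃ y, y - x ∈ filt b (l + N) ∧ γ (D.toM x) = D'.toM y
  right : ∀ l ≥ l₀, ∀ y ∈ filt b l, ∃ x, x - y ∈ filt b (l + N) ∧ γ (D.toM x) = D'.toM y
  inter_left : ∀ x ∈ filt b l₀, x ∈ D.Λ → x = 0
  inter_right : ∀ x ∈ filt b l₀, x ∈ D'.Λ → x = 0

variable {b D D'}

lemma X_smul_mem {l : ℤ} {x : KInfty k F K} (hx : x ∈ filt b l) :
    (Polynomial.X : (GrpRing k G)[X]) • x ∈ filt b (l - 1) := X_smul_mem_filt.2 hx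

lemma tEnd_toM (x : KInfty k F K) :
    tEnd k G M (D.toM x) = D.toM ((Polynomial.X : (GrpRing k G)[X]) • x) :=
  (D.toM.map_smul _ x).symm

/-- An isomorphism which is infinitely tangent to the identity is so with respect to the
filtration. -/
lemma exists_tangentAt [Finite ι] [Algebra.IsSeparable (RatFunc k) K] {γ : M → M'}
    (h : IsInfTangent D D' γ) (N : ℕ) : ∃ l₀, TangentAt b D D' γ N l₀ := by
  have := Fintype.ofFinite ι
  have := finite_kInfty b
  obtain ⟨c₁, hc₁⟩ := exists_normInf_le b
  obtain ⟨c₂, hc₂⟩ := exists_mem_filt b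
  obtain ⟨i, -, h1, h2, g, hg, hiso, hnear⟩ := h (N + c₁ + c₂).natAbs
  set N₀ := (N + c₁ + c₂).natAbs with hN₀
  have hq := one_lt_card k
  have hball : ∀ l ≥ i + c₁, ∀ x ∈ filt b l, x ∈ ball k F K i := fun l hl x hx =>
    (hc₁ l x hx).trans (zpow_le_zpow_right₀ hq.le (by omega))
  have hball0 : (0 : KInfty k F K) ∈ ball k F K i := hball _ le_rfl 0 (Submodule.zero_mem _)
  have hg0 : (g ⟨0, hball0⟩ : KInfty k F K) = 0 := by
    have := hnear ⟨0, hball0⟩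
    rw [normInf_zero, mul_zero, sub_zero] at this
    exact normInf_eq_zero.1 (le_antisymm this (normInf_nonneg _))
  have hnorm : ∀ x : ball k F K i, normInf k F K (g x) = normInf k F K x := fun x => by
    have := hiso x ⟨0, hball0⟩
    rwa [hg0, sub_zero, sub_zero] at this
  have hclose : ∀ (l : ℤ) (x : ball k F K i),
      normInf k F K (x : KInfty k F K) ≤ (Nat.card k : ℝ) ^ (c₁ - l) →
      (g x : KInfty k F K) - x ∈ filt b (l + N) := fun l x hx => by
    refine filt_anti b (?_ : l + N ≤ N₀ - c₁ + l - c₂) (hc₂ _ _ ((hnear x).trans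
      ((mul_le_mul_of_nonneg_left hx (by positivity)).trans ?_)))
    · omega
    · rw [← zpow_add₀ (by positivity)]
      exact zpow_le_zpow_right₀ hq.le (by omega)
  refine ⟨i + c₁, fun l hl x hx => ?_, fun l hl y hy => ?_,
    fun x hx => h1 x (hball _ le_rfl x hx), fun x hx => h2 x (hball _ le_rfl x hx)⟩
  · exact ⟨g ⟨x, hball l hl x hx⟩, hclose l _ (hc₁ l x hx), hg ⟨x, hball l hl x hx⟩⟩
  · obtain ⟨x, hx⟩ := g.surjective ⟨y, hball l hl y hy⟩
    have hxy : (g x : KInfty k F K) = y := congrArg Subtype.val hx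
    refine ⟨x, ?_, ?_⟩
    · rw [← neg_mem_iff, neg_sub, ← hxy]
      refine hclose l x ?_
      rw [← hnorm, hxy]
      exact hc₁ l y hy
    · rw [← hxy]
      exact hg x

/-- The endomorphism `t` of `M'`, transported to `M`. -/
abbrev transport (γ : M ≃ₗ[GrpRing k G] M') : Module.End (GrpRing k G) M :=
  γ.symm.toLinearMap ∘ₗ tEnd k G M' ∘ₗ γ.toLinearMap

/-- On small elements `γ⁻¹ t γ` is the multiplication by `t` up to terms of relative order `t⁻ᴺ`. -/
lemma TangentAt.transport_toM {γ : M ≃ₗ[GrpRing k G] M'} {N : ℕ} {l₀ : ℤ}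
    (h : TangentAt b D D' γ N l₀) {l : ℤ} (hl : l₀ + 1 ≤ l) {x : KInfty k F K} (hx : x ∈ filt b l) :
    ∃ x', x' - (Polynomial.X : (GrpRing k G)[X]) • x ∈ filt b (l - 1 + N) ∧
      transport γ (D.toM x) = D.toM x' := by
  obtain ⟨y, hyx, hy⟩ := h.left l (by omega) x hx
  have hyl : y ∈ filt b l := by
    rw [← sub_add_cancel y x]
    exact Submodule.add_mem _ (filt_anti b (by omega) hyx) hx
  obtain ⟨x', hx'y, hx'⟩ := h.right (l - 1) (by omega) _ (X_smul_mem hyl)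
  refine ⟨x', ?_, ?_⟩
  · have h1 := Submodule.add_mem _ hx'y (filt_anti b (by omega : l - 1 + (N : ℤ) ≤ _)
      (X_smul_mem hyx))
    rwa [smul_sub, sub_add_sub_cancel] at h1
  · change γ.symm (tEnd k G M' (γ (D.toM x))) = _
    rw [hy, tEnd_toM, ← hx', LinearEquiv.symm_apply_apply]

lemma TangentAt.sub_transport_mem {γ : M ≃ₗ[GrpRing k G] M'} {N : ℕ} {l₀ : ℤ}
    (h : TangentAt b D D' γ N l₀) {l : ℤ} (hl : l₀ + 1 ≤ l) {x : KInfty k F K} (hx : x ∈ filt b l) :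
    (tEnd k G M - transport γ) (D.toM x) ∈ filtM b D (l - 1 + N) := by
  obtain ⟨x', hx', he⟩ := h.transport_toM hl hx
  refine ⟨(Polynomial.X : (GrpRing k G)[X]) • x - x', ?_, ?_⟩
  · rw [SetLike.mem_coe, ← neg_mem_iff, neg_sub]
    exact hx'
  · change D.toM _ = _
    rw [LinearMap.sub_apply, he, tEnd_toM, map_sub]

lemma X_pow_smul_mem {l : ℤ} {x : KInfty k F K} (hx : x ∈ filt b l) (n : ℕ) :
    (Polynomial.X ^ n : (GrpRing k G)[X]) • x ∈ filt b (l - n) := by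
  induction n with
  | zero => simpa using hx
  | succ n ih =>
    rw [pow_succ', mul_smul]
    convert X_smul_mem ih using 2
    push_cast
    ring

lemma tEnd_pow_toM (n : ℕ) (x : KInfty k F K) :
    (tEnd k G M ^ n) (D.toM x) = D.toM ((Polynomial.X ^ n : (GrpRing k G)[X]) • x) := by
  induction n with
  | zero => rw [pow_zero, pow_zero, one_smul]; rfl
  | succ n ih => rw [pow_succ', Module.End.mul_apply, ih, tEnd_toM, pow_succ', mul_smul]

/-- The endomorphism `δₙ = (t - γ⁻¹ t γ) tⁿ⁻¹` raises the index of the filtration by `N - n`. -/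
lemma TangentAt.delta_mem {γ : M ≃ₗ[GrpRing k G] M'} {N : ℕ} {l₀ : ℤ}
    (h : TangentAt b D D' γ N l₀) (n : ℕ) {l : ℤ} (hl : l₀ + n ≤ l) :
    (filtM b D l).map (delta γ n) ≤ filtM b D (l - n + N) := by
  rintro _ ⟨_, ⟨x, hx, rfl⟩, rfl⟩
  change delta γ n (D.toM x) ∈ _
  rw [delta]
  split_ifs with hn
  · exact Submodule.zero_mem _
  · obtain ⟨m, rfl⟩ := Nat.exists_eq_succ_of_ne_zero hn
    rw [Module.End.mul_apply, Nat.succ_eq_add_one, Nat.add_sub_cancel, tEnd_pow_toM]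
    convert h.sub_transport_mem (l := l - m) (by push_cast at hl; omega) (X_pow_smul_mem hx m)
      using 2
    push_cast
    ring

/-! ### Nuclearity -/

variable {W : Submodule (MonoidAlgebra (OF k F) G) (rhoK k F K G).asModule}

/-- If `c` and `c'` measure the difference of the filtration and of the neighbourhoods of zero
defined by a taming module, then the `δₙ` map the neighbourhood with index `i` into the step of
index `i - c - n + N` of the filtration. -/
lemma TangentAt.delta_nbhdM_le {γ : M ≃ₗ[GrpRing k G] M'} {N : ℕ} {l₀ : ℤ}
    (h : TangentAt b D D' γ N l₀) {c : ℤ} (hc : ∀ i : ℕ, nbhd W i ≤ filt b (i - c)) {n i : ℕ}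
    (hi : l₀ + n + c ≤ i) : (nbhdM W D i).map (delta γ n) ≤ filtM b D (i - c - n + N) :=
  (Submodule.map_mono (Submodule.map_mono (hc i))).trans (h.delta_mem n (by omega))

/-- All neighbourhoods with a sufficiently large index are nuclei of `δₙ`. -/
lemma exists_isNucleus [Finite ι] [Algebra.IsSeparable (RatFunc k) K] {γ : M ≃ₗ[GrpRing k G] M'}
    (h : IsInfTangent D D' γ) {c : ℤ} (hc : ∀ i : ℕ, nbhd W i ≤ filt b (i - c))
    {c' : ℕ} (hc' : ∀ i : ℕ, filt b (i + c') ≤ nbhd W i) (n : ℕ) :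
    ∃ i₀, ∀ i, i₀ ≤ i → IsNucleus W D (delta γ n) i := by
  obtain ⟨l₀, hl₀⟩ := exists_tangentAt (b := b) h (c + c' + n + 1).natAbs
  refine ⟨(l₀ + n + c).natAbs + (l₀ + c).natAbs, fun i hi => ⟨fun x hx => ?_, fun j hj => ?_⟩⟩
  · exact hl₀.inter_left x (filt_anti b (by omega) (hc i hx))
  · refine (hl₀.delta_nbhdM_le hc (by omega)).trans (Submodule.map_mono ?_)
    exact le_trans (filt_anti b (by omega)) (hc' (j + 1))

lemma projective_nbhdM [FiniteDimensional (RatFunc k) K] (hW : Finite (OK k F K ⧸ tamingSub W))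
    [Module.Projective (MonoidAlgebra (OF k F) G) W] {i : ℕ}
    (hi : ∀ x ∈ nbhd W i, x ∈ D.Λ → x = 0) : Module.Projective (GrpRing k G) (nbhdM W D i) := by
  have := projective_nbhd hW i
  let f : nbhd W i →ₗ[GrpRing k G] M :=
    (D.toM.restrictScalars (GrpRing k G)) ∘ₗ (nbhd W i).subtype
  have hf : Function.Injective f := by
    refine (injective_iff_map_eq_zero f).2 fun x hx => Subtype.ext ?_
    exact hi x x.2 (StructSeq.toM_eq_zero.1 hx)
  have hr : LinearMap.range f = nbhdM W D i := by
    rw [LinearMap.range_comp, Submodule.range_subtype]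
    rfl
  exact Module.Projective.of_equiv ((LinearEquiv.ofInjective f hf).trans (LinearEquiv.ofEq _ _ hr))

lemma finite_quotient_of_le {P Q : Submodule (GrpRing k G) M} (h : P ≤ Q) [Finite (M ⧸ P)] :
    Finite (M ⧸ Q) :=
  Finite.of_surjective _ (Submodule.factor_surjective h)

/-! ### Continuity -/

lemma continuous_tEnd [ContinuousConstSMul (GrpRing k G)[X] M] : Continuous (tEnd k G M) :=
  continuous_const_smul (Polynomial.X : (GrpRing k G)[X])

lemma continuous_X_smul :
    Continuous fun x : KInfty k F K => (Polynomial.X : (GrpRing k G)[X]) • x := by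
  have h : ∀ x : KInfty k F K, (Polynomial.X : (GrpRing k G)[X]) • x = tInf k • x := fun x => by
    have : (toBig k G Polynomial.X) = algebraMap (KInf k) (BigRing k G) (tInf k) := by
      rw [toBig, Polynomial.coe_eval₂RingHom, Polynomial.eval₂_X]
    rw [poly_smul_eq, this, algebraMap_smul]
  simp_rw [h]
  exact IsModuleTopology.continuous_of_linearMap (LinearMap.lsmul (KInf k) (KInfty k F K) (tInf k))

lemma continuous_tEnd_quotient (Λ : Submodule (GrpRing k G)[X] (KInfty k F K)) :
    Continuous (tEnd k G (KInfty k F K ⧸ Λ)) := by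
  refine (isQuotientMap_quotient_mk' (s := Λ.quotientRel)).continuous_iff.2 ?_
  exact (continuous_quotient_mk' (s := Λ.quotientRel)).comp (continuous_X_smul (G := G))

end Tangency

/-! ### Determinants on the quotients by small submodules -/

section QuotDet

variable {R : Type*} [CommRing R] {M : Type*} [AddCommGroup M] [Module R M]
variable (S : Type*) [CommRing S] [Algebra R S]

/-- The determinant of `1 + ∑_{n < N} φₙ yⁿ` on `S ⊗ M/Q`, for endomorphisms `φₙ` of `M` which
stabilise the submodule `Q`. -/
def quotDet (y : S) (φ : ℕ → Module.End R M) (N : ℕ) (Q : Submodule R M)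
    (h : ∀ n < N, Q ≤ Q.comap (φ n)) : S :=
  detProj (P := S ⊗[R] (M ⧸ Q)) (LinearMap.id + ∑ n : Fin N, y ^ (n : ℕ) •
    LinearMap.baseChange S (Q.mapQ Q (φ n) (h n n.2)))

/-- If the `φₙ` map `Q` into a smaller submodule `Q'`, the determinant is the same for `Q` and
`Q'`: the `φₙ` factor through maps from `M/Q` to `M/Q'`. -/
lemma quotDet_eq (y : S) (φ : ℕ → Module.End R M) (N : ℕ) {Q Q' : Submodule R M} (hle : Q' ≤ Q)
    (hφ : ∀ n < N, Q ≤ Q'.comap (φ n))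
    [Module.Finite R (M ⧸ Q)] [Module.Projective R (M ⧸ Q)]
    [Module.Finite R (M ⧸ Q')] [Module.Projective R (M ⧸ Q')] :
    quotDet S y φ N Q (fun n hn => (hφ n hn).trans (Submodule.comap_mono hle)) =
      quotDet S y φ N Q' (fun n hn => hle.trans (hφ n hn)) := by
  let X : S ⊗[R] (M ⧸ Q') →ₗ[S] S ⊗[R] (M ⧸ Q) := (Submodule.factor hle).baseChange S
  let Y : S ⊗[R] (M ⧸ Q) →ₗ[S] S ⊗[R] (M ⧸ Q') := ∑ n : Fin N, y ^ (n : ℕ) •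
    LinearMap.baseChange S (Q.mapQ Q' (φ n) (hφ n n.2))
  have h1 : (∑ n : Fin N, y ^ (n : ℕ) • LinearMap.baseChange S (Q.mapQ Q (φ n)
      ((hφ n n.2).trans (Submodule.comap_mono hle)))) = X ∘ₗ Y := by
    refine LinearMap.ext fun x => ?_
    rw [LinearMap.comp_apply, LinearMap.sum_apply, LinearMap.sum_apply, map_sum]
    refine Finset.sum_congr rfl fun n _ => ?_
    rw [LinearMap.smul_apply, LinearMap.smul_apply, map_smul]
    congr 1
    rw [← LinearMap.comp_apply, ← LinearMap.baseChange_comp]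
    exact congrArg (fun f => LinearMap.baseChange S f x) (Submodule.linearMap_qext _ rfl)
  have h2 : (∑ n : Fin N, y ^ (n : ℕ) • LinearMap.baseChange S (Q'.mapQ Q' (φ n)
      (hle.trans (hφ n n.2)))) = Y ∘ₗ X := by
    refine LinearMap.ext fun x => ?_
    rw [LinearMap.comp_apply, LinearMap.sum_apply, LinearMap.sum_apply]
    refine Finset.sum_congr rfl fun n _ => ?_
    rw [LinearMap.smul_apply, LinearMap.smul_apply]
    congr 1
    rw [← LinearMap.comp_apply, ← LinearMap.baseChange_comp]
    exact congrArg (fun f => LinearMap.baseChange S f x) (Submodule.linearMap_qext _ rfl)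
  rw [quotDet, quotDet, h1, h2]
  exact detProj_id_add_comp_comm X Y

end QuotDet

section DetMod

variable {k : Type u} [Field k] [Finite k]
variable {F : Type u} [Field F] [Algebra (RatFunc k) F]
variable {K : Type u} [Field K] [Algebra (RatFunc k) K] [Algebra F K]
  [IsScalarTower (RatFunc k) F K] [FiniteDimensional (RatFunc k) K]
variable {G : Type u} [CommGroup G] [MulSemiringAction G K] [IsGaloisGroup G F K] [Fintype G]
variable {M H : Type u} [AddCommGroup M] [Module (GrpRing k G)[X] M] [Module (GrpRing k G) M]
  [IsScalarTower (GrpRing k G) (GrpRing k G)[X] M] [TopologicalSpace M]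
  [AddCommGroup H] [Module (GrpRing k G)[X] H]
variable {ι : Type*} [Fintype ι] (b : Module.Basis ι (BigRing k G) (KInfty k F K))
  {D : StructSeq k F K G M H}
variable {W : Submodule (MonoidAlgebra (OF k F) G) (rhoK k F K G).asModule}

variable (k G) in
/-- The ring `R[[Z]]/Z^N`. -/
abbrev TruncRing (N : ℕ) : Type u :=
  (GrpRing k G)⟦X⟧ ⧸ Ideal.span {(PowerSeries.X : (GrpRing k G)⟦X⟧) ^ N}

variable (k G) in
/-- The class of the variable in `R[[Z]]/Z^N`. -/
abbrev truncX (N : ℕ) : TruncRing k G N := Ideal.Quotient.mk _ PowerSeries.X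

lemma nbhd_anti : Antitone (nbhd W) := fun i j hij _ hx =>
  nbhd_induction hx (Submodule.zero_mem _) (fun _ _ => Submodule.add_mem _) fun _ ha _ hw =>
    tmul_mem_nbhd (ha.trans (zpow_le_zpow_right₀ (one_lt_card k).le (by omega))) hw

variable [Module.Projective (GrpRing k G) M] [Module.Projective (MonoidAlgebra (OF k F) G) W]

/-- The nuclear determinant modulo `Z^N` may be computed with any smaller nucleus. -/
lemma detMod_add (hW : Finite (OK k F K ⧸ tamingSub W)) (hfin : ∀ i, Finite (M ⧸ nbhdM W D i))
    (φ : ℕ → Module.End (GrpRing k G) M) {N i : ℕ} (h0 : ∀ x ∈ nbhd W i, x ∈ D.Λ → x = 0)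
    (h : ∀ n < N, IsNucleus W D (φ n) i) (m : ℕ) :
    detMod W D φ N i h = quotDet (TruncRing k G N) (truncX k G N) φ N (nbhdM W D (i + m))
      fun n hn => Submodule.map_le_iff_le_comap.1
        (((h n hn).2 (i + m) (by omega)).trans (nbhdM_succ_le W D (i + m))) := by
  have hi : ∀ m, nbhd W (i + m) ≤ nbhd W i := fun m => nbhd_anti (Nat.le_add_right i m)
  have hp : ∀ m, Module.Projective (GrpRing k G) (M ⧸ nbhdM W D (i + m)) := fun m => by
    have := projective_nbhdM (D := D) hW fun x hx => h0 x (hi m hx)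
    exact projective_quotient _
  induction m with
  | zero => rfl
  | succ m ih =>
    rw [ih]
    have := hp m
    have := hp (m + 1)
    have := hfin (i + m)
    have := hfin (i + (m + 1))
    exact quotDet_eq _ _ φ N (nbhdM_succ_le W D (i + m)) fun n hn =>
      Submodule.map_le_iff_le_comap.1 ((h n hn).2 (i + m) (by omega))

variable {M' H' : Type u} [AddCommGroup M'] [Module (GrpRing k G)[X] M'] [Module (GrpRing k G) M']
  [IsScalarTower (GrpRing k G) (GrpRing k G)[X] M'] [TopologicalSpace M']
  [AddCommGroup H'] [Module (GrpRing k G)[X] H'] {D' : StructSeq k F K G M' H'}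

/-- The nuclear determinant modulo `Z^N` can be computed on the quotients by small steps of the
filtration. -/
lemma exists_detMod_eq [Algebra.IsSeparable (RatFunc k) K] (hW : Finite (OK k F K ⧸ tamingSub W))
    {γ : M ≃ₗ[GrpRing k G] M'} (hγ : IsInfTangent D D' γ) {c : ℤ}
    (hc : ∀ i : ℕ, nbhd W i ≤ filt b (i - c)) {c' : ℕ}
    (hc' : ∀ i : ℕ, filt b (i + c') ≤ nbhd W i) (hfin : ∀ j, Finite (M ⧸ filtM b D j))
    {N i : ℕ} (hN : N ≠ 0) (h : ∀ n < N, IsNucleus W D (delta γ n) i) :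
    ∃ j₀ : ℤ, ∀ j ≥ j₀, ∃ hj : ∀ n < N, filtM b D j ≤ (filtM b D j).comap (delta γ n),
      detMod W D (delta γ) N i h =
        quotDet (TruncRing k G N) (truncX k G N) (delta γ) N (filtM b D j) hj := by
  obtain ⟨l₀, hl₀⟩ := exists_tangentAt (b := b) hγ (c + c' + N).natAbs
  have hle : ∀ i : ℕ, filtM b D (i + c') ≤ nbhdM W D i := fun i => Submodule.map_mono (hc' i)
  have hfin' : ∀ i, Finite (M ⧸ nbhdM W D i) := fun i =>
    have := hfin (i + c')
    finite_quotient_of_le (hle i)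
  have h0 := (h 0 (by omega)).1
  refine ⟨i + c' + (l₀.natAbs + N + c.natAbs), fun j hj => ?_⟩
  obtain ⟨m, hm⟩ : ∃ m : ℕ, j = (i + m : ℕ) + c' := ⟨(j - i - c').toNat, by omega⟩
  have hi : nbhd W (i + m) ≤ nbhd W i := nbhd_anti (Nat.le_add_right i m)
  have hδ : ∀ n < N, nbhdM W D (i + m) ≤ (filtM b D j).comap (delta γ n) := fun n hn =>
    Submodule.map_le_iff_le_comap.1 ((hl₀.delta_nbhdM_le hc (by omega)).trans
      (filtM_anti b D (by omega)))
  have := projective_filtM (b := b) D (j := j) fun x hx => hl₀.inter_left x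
    (filt_anti b (by omega) hx)
  have := projective_quotient (filtM b D j)
  have := projective_nbhdM (D := D) hW fun x hx => h0 x (hi hx)
  have := projective_quotient (nbhdM W D (i + m))
  have := hfin j
  have := hfin' (i + m)
  have hjm : filtM b D j ≤ nbhdM W D (i + m) := hm ▸ hle (i + m)
  refine ⟨fun n hn => hjm.trans (hδ n hn), ?_⟩
  rw [detMod_add hW hfin' (delta γ) h0 h m]
  exact quotDet_eq _ _ _ N hjm hδ

end DetMod

/-! ### Comparison of characteristic polynomials on a quotient -/

section Compare

variable {R : Type*} [CommRing R] {M : Type*} [AddCommGroup M] [Module R M]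
variable (S : Type*) [CommRing S] [Algebra R S] {U : Submodule R M}

/-- The identity `(1 + ∑ δₙ yⁿ) (1 - t y) = 1 - t' y` for `δₙ = (t - t') tⁿ⁻¹`, on determinants on
`M/U`. The map `s` is the section of `M → M/U` defined by a complement of `U` stable under `t`. -/
lemma quotDet_mul [Module.Finite R (M ⧸ U)] [Module.Projective R (M ⧸ U)] {y : S} {N : ℕ}
    (hN : N ≠ 0) (hy : y ^ N = 0) {t t' : Module.End R M} {δ : ℕ → Module.End R M} (hδ0 : δ 0 = 0)
    (hδ : ∀ n, δ (n + 1) = (t - t') * t ^ n) (h : ∀ n < N, U ≤ U.comap (δ n))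
    {s : (M ⧸ U) →ₗ[R] M} (hs : ∀ x, U.mkQ (s x) = x)
    (hst : ∀ x, s (U.mkQ (t (s x))) = t (s x)) :
    quotDet S y δ N U h * detProj (LinearMap.id - y • (U.mkQ ∘ₗ t ∘ₗ s).baseChange S) =
      detProj (LinearMap.id - y • (U.mkQ ∘ₗ t' ∘ₗ s).baseChange S) := by
  set τ : Module.End R (M ⧸ U) := U.mkQ ∘ₗ t ∘ₗ s with hτ
  set σ : Module.End R (M ⧸ U) := U.mkQ ∘ₗ t' ∘ₗ s with hσ
  let T : Module.End S (S ⊗[R] (M ⧸ U)) := τ.baseChange S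
  let T' : Module.End S (S ⊗[R] (M ⧸ U)) := σ.baseChange S
  let B : ℕ → Module.End S (S ⊗[R] (M ⧸ U)) := fun n => if n = 0 then 0 else (T - T') * T ^ (n - 1)
  have hsτ : ∀ n x, s ((τ ^ n) x) = (t ^ n) (s x) := fun n => by
    induction n with
    | zero => intro x; rfl
    | succ n ih =>
      intro x
      rw [pow_succ, pow_succ', Module.End.mul_apply, ih, Module.End.mul_apply]
      change (t ^ n) (s (U.mkQ (t (s x)))) = _
      rw [hst, ← Module.End.mul_apply, ← Module.End.mul_apply, ← pow_succ, ← pow_succ']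
  -- on `M/U` the endomorphism `δₙ` becomes `(τ - σ) τⁿ⁻¹`, as `s` intertwines `τ` and `t`
  have hB : ∀ n (hn : n < N), (U.mapQ U (δ n) (h n hn)).baseChange S = B n := fun n hn => by
    obtain _ | n := n
    · have : U.mapQ U (δ 0) (h 0 hn) = 0 := Submodule.linearMap_qext _ (LinearMap.ext fun x => by
        change U.mkQ (δ 0 x) = 0
        rw [hδ0, LinearMap.zero_apply, map_zero])
      rw [this, LinearMap.baseChange_zero]
      rfl
    · have : U.mapQ U (δ (n + 1)) (h (n + 1) hn) = (τ - σ) * τ ^ n := LinearMap.ext fun x => by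
        conv_lhs => rw [← hs x]
        change U.mkQ (δ (n + 1) (s x)) = _
        rw [hδ, Module.End.mul_apply, ← hsτ, LinearMap.sub_apply, map_sub]
        rfl
      rw [this, LinearMap.baseChange_mul, LinearMap.baseChange_sub, LinearMap.baseChange_pow]
      rfl
  -- a telescoping sum
  have hsum : ∀ m, (∑ n ∈ Finset.range (m + 1), y ^ n • B n) * (1 - y • T) =
      (T - T') * (y • 1 - y ^ (m + 1) • T ^ m) := fun m => by
    induction m with
    | zero => simp [B]
    | succ m ih =>
      have : B (m + 1) = (T - T') * T ^ m := rfl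
      rw [Finset.sum_range_succ, add_mul, ih, this, smul_mul_assoc, mul_assoc (T - T'),
        ← mul_smul_comm, ← mul_add]
      congr 1
      rw [mul_sub, mul_one, mul_smul_comm, ← pow_succ, smul_sub, smul_smul, ← pow_succ]
      abel
  obtain ⟨m, rfl⟩ : ∃ m, N = m + 1 := ⟨N - 1, by omega⟩
  have h1 : (∑ n : Fin (m + 1), y ^ (n : ℕ) • (U.mapQ U (δ n) (h n n.2)).baseChange S) =
      ∑ n ∈ Finset.range (m + 1), y ^ n • B n := by
    rw [← Fin.sum_univ_eq_sum_range fun n => y ^ n • B n]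
    exact Finset.sum_congr rfl fun n _ => by rw [hB n n.2]
  rw [quotDet, h1, ← detProj_mul]
  congr 1
  change (1 + ∑ n ∈ Finset.range (m + 1), y ^ n • B n) * (1 - y • T) = 1 - y • T'
  rw [add_mul, hsum, hy, zero_smul, sub_zero, one_mul, mul_smul_comm, mul_one, smul_sub]
  abel

/-- Two sections `s` and `s'` of `M → M/U` define the same characteristic polynomial of `t'` modulo
`Z^N` if `s - s'` is small on the elements obtained from `U` by applying `t'` less than `N` times.
-/
lemma detProj_section_eq [Module.Finite R (M ⧸ U)] [Module.Projective R (M ⧸ U)]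
    {V : Submodule R M} [Module.Finite R (U ⧸ V.submoduleOf U)]
    [Module.Projective R (U ⧸ V.submoduleOf U)] {y : S} {N : ℕ} (hy : y ^ N = 0)
    {t' : Module.End R M} (hV : ∀ v ∈ V, t' v ∈ U) {s s' : (M ⧸ U) →ₗ[R] M}
    (hs : ∀ x, U.mkQ (s x) = x) (hs' : ∀ x, U.mkQ (s' x) = x)
    (hss : ∀ n, n + 2 ≤ N → ∀ u ∈ U,
      (s - s') (((U.mkQ ∘ₗ t' ∘ₗ s' : Module.End R (M ⧸ U)) ^ n) (U.mkQ (t' u))) ∈ V) :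
    detProj (LinearMap.id - y • (U.mkQ ∘ₗ t' ∘ₗ s).baseChange S) =
      detProj (LinearMap.id - y • (U.mkQ ∘ₗ t' ∘ₗ s').baseChange S) := by
  set τ : Module.End R (M ⧸ U) := U.mkQ ∘ₗ t' ∘ₗ s' with hτ
  have hmem : ∀ x, (s - s') x ∈ U := fun x => by
    rw [← Submodule.Quotient.mk_eq_zero, ← Submodule.mkQ_apply, LinearMap.sub_apply, map_sub, hs,
      hs', sub_self]
  -- the two endomorphisms differ by `a ∘ b`, which factors through `U/V`
  let b : (M ⧸ U) →ₗ[R] (U ⧸ V.submoduleOf U) :=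
    (V.submoduleOf U).mkQ ∘ₗ (s - s').codRestrict U hmem
  let a : (U ⧸ V.submoduleOf U) →ₗ[R] (M ⧸ U) :=
    (V.submoduleOf U).liftQ (U.mkQ ∘ₗ t' ∘ₗ U.subtype) fun v hv =>
      (Submodule.Quotient.mk_eq_zero U).2 (hV _ hv)
  have hab : U.mkQ ∘ₗ t' ∘ₗ s = τ + a ∘ₗ b := LinearMap.ext fun x => by
    change U.mkQ (t' (s x)) = U.mkQ (t' (s' x)) + U.mkQ (t' ((s - s') x))
    rw [← map_add, ← map_add, LinearMap.sub_apply, add_sub_cancel]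
  have hba : ∀ n, n + 2 ≤ N → b ∘ₗ (τ ^ n) ∘ₗ a = 0 := fun n hn =>
    Submodule.linearMap_qext _ (LinearMap.ext fun (u : U) =>
      (Submodule.Quotient.mk_eq_zero _).2 (hss n hn (u : M) u.2))
  let T : Module.End S (S ⊗[R] (M ⧸ U)) := τ.baseChange S
  let Z : Module.End S (S ⊗[R] (M ⧸ U)) := ∑ n ∈ Finset.range N, (y • T) ^ n
  have hZ : (1 - y • T) * Z = 1 := by
    rw [mul_neg_geom_sum, smul_pow, hy, zero_smul, sub_zero]
  let A := a.baseChange S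
  let B := b.baseChange S
  have h1 : LinearMap.id - y • (U.mkQ ∘ₗ t' ∘ₗ s).baseChange S =
      (1 - y • T) ∘ₗ (LinearMap.id + (-(y • Z ∘ₗ A)) ∘ₗ B) := by
    have hab' : (U.mkQ ∘ₗ t' ∘ₗ s).baseChange S = T + A ∘ₗ B := by
      rw [hab, LinearMap.baseChange_add, LinearMap.baseChange_comp (f := b) (g := a)]
    rw [hab']
    have h2 : (1 - y • T) ∘ₗ ((-(y • Z ∘ₗ A)) ∘ₗ B) = -(y • (A ∘ₗ B)) := by
      have : (-(y • Z ∘ₗ A)) ∘ₗ B = Z ∘ₗ (-(y • (A ∘ₗ B))) := by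
        rw [LinearMap.neg_comp, LinearMap.comp_neg, LinearMap.smul_comp, LinearMap.comp_smul]
        rfl
      rw [this, ← LinearMap.comp_assoc]
      change ((1 - y • T) * Z) ∘ₗ _ = _
      rw [hZ]
      rfl
    rw [LinearMap.comp_add, h2, LinearMap.comp_id]
    change 1 - y • (T + A ∘ₗ B) = _
    rw [smul_add, sub_add_eq_sub_sub, ← sub_eq_add_neg]
  -- the coefficient of `y ^ (n + 1)` is `b τⁿ a`, which vanishes for `n + 2 ≤ N`; `y ^ N = 0`
  have h3 : B ∘ₗ (-(y • Z ∘ₗ A)) = 0 := by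
    have h4 : ∀ n < N, ∀ x, y • B (((y • T) ^ n) (A x)) = 0 := fun n hn x => by
      rw [smul_pow, LinearMap.smul_apply, map_smul, smul_smul, ← pow_succ']
      rcases (show n + 1 ≤ N from hn).eq_or_lt with h | h
      · rw [h, hy, zero_smul]
      · have h5 : B ∘ₗ (T ^ n) ∘ₗ A = 0 := by
          rw [← LinearMap.baseChange_pow, ← LinearMap.baseChange_comp, ← LinearMap.baseChange_comp,
            hba n h, LinearMap.baseChange_zero]
        have h6 := LinearMap.congr_fun h5 x
        change B ((T ^ n) (A x)) = 0 at h6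
        rw [h6, smul_zero]
    refine LinearMap.ext fun x => ?_
    change B (-(y • Z (A x))) = 0
    rw [map_neg, map_smul, LinearMap.sum_apply, map_sum, Finset.smul_sum,
      Finset.sum_eq_zero fun n hn => h4 n (Finset.mem_range.1 hn) x, neg_zero]
  rw [h1, detProj_mul, detProj_id_add_comp_comm, h3, add_zero, detProj_id, mul_one]
  rfl

end Compare

/-! ### Truncated determinants of free lattices -/

section Truncated

variable {k : Type u} [Field k] [Finite k]
variable {F : Type u} [Field F] [Algebra (RatFunc k) F]
variable {K : Type u} [Field K] [Algebra (RatFunc k) K] [Algebra F K]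
  [IsScalarTower (RatFunc k) F K]
variable {G : Type u} [CommGroup G] [MulSemiringAction G K] [IsGaloisGroup G F K] [Fintype G]
variable {ι : Type*} [Fintype ι] [DecidableEq ι]
  {b e : Module.Basis ι (BigRing k G) (KInfty k F K)} {j : ℤ} {N N' : ℕ}

/-- The elements of small degree of a free lattice in good position have no term of order `t⁻ʲ`. -/
lemma IsGood.coeff_coord_eq_zero (he : IsGood b j N' e) (hN' : N' ≠ 0) (hN : N ≤ N')
    {a : KInfty k F K} (ha : a ∈ spanLattice e) (ha' : a ∈ filt b (j - N + 1)) (i : ι) :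
    (coord b a i).coeff j = 0 := by
  rw [he.filt_eq hN'] at ha'
  obtain ⟨p, rfl⟩ := mem_spanLattice_iff.1 ha
  obtain ⟨Y, hY⟩ := he
  have hp : ∀ m, ∀ l < 2 - (N : ℤ), (polyL (GrpRing k G) (p m)).coeff l = 0 := fun m l hl => by
    rw [← coord_sum_smul e p]
    exact ha' m l (by omega)
  rw [coord_eq_sum b e, HahnSeries.coeff_sum]
  refine Finset.sum_eq_zero fun m _ => ?_
  have h1 : coordMat b e m i = uPow (GrpRing k G) (j - 1) * (psL _ ((1 : Matrix ι ι _) m i) +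
      uPow (GrpRing k G) N' * psL _ (Y m i)) := by
    rw [hY, uPow_natCast, ← map_mul, ← map_add]
    rfl
  rw [coord_sum_smul, h1, mul_left_comm, coeff_uPow_mul, sub_sub_cancel, mul_add,
    HahnSeries.coeff_add, mul_left_comm, coeff_uPow_mul,
    coeff_mul_eq_zero (hp m) (fun l hl => coeff_psL_of_neg (Y m i) hl) _ (by omega), add_zero,
    Matrix.one_apply]
  split_ifs
  · rw [map_one, mul_one, coeff_polyL_of_pos _ one_pos]
  · rw [map_zero, mul_zero, HahnSeries.coeff_zero]

/-- The determinant of a basis in good position is `t^{n(1-j)}` modulo relative order `t⁻ᴺ`. -/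
lemma IsGood.det_mod (he : IsGood b j N' e) (hN' : N' ≠ 0) (hN : N ≤ N') :
    ∃ p : (GrpRing k G)⟦X⟧, PowerSeries.constantCoeff p = 1 ∧
      (Ideal.Quotient.mk _ p : TruncRing k G N) = 1 ∧
      (coordMat b e).det = uPow (GrpRing k G) (Fintype.card ι * (j - 1)) * psL _ p := by
  have h0 : ∀ N : ℕ, N ≤ N' → ∀ Y : Matrix ι ι (GrpRing k G)⟦X⟧,
      (Ideal.Quotient.mk _ (1 + (PowerSeries.X : (GrpRing k G)⟦X⟧) ^ N' • Y).det :
        TruncRing k G N) = 1 := fun N hN Y => by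
    have hX : (Ideal.Quotient.mk _ ((PowerSeries.X : (GrpRing k G)⟦X⟧) ^ N') :
        TruncRing k G N) = 0 := Ideal.Quotient.eq_zero_iff_mem.2
      (Ideal.mem_span_singleton.2 (pow_dvd_pow _ hN))
    rw [RingHom.map_det]
    refine (congrArg Matrix.det ?_).trans Matrix.det_one
    ext1 i l
    rw [RingHom.mapMatrix_apply, Matrix.map_apply, Matrix.add_apply, Matrix.smul_apply, map_add,
      smul_eq_mul, map_mul, hX, zero_mul, add_zero, Matrix.one_apply, Matrix.one_apply]
    split_ifs
    exacts [map_one _, map_zero _]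
  obtain ⟨Y, hY⟩ := he
  refine ⟨_, ?_, h0 N hN Y, ?_⟩
  · have h1 := h0 1 (by omega) Y
    rw [← map_one (Ideal.Quotient.mk _), Ideal.Quotient.eq, Ideal.mem_span_singleton, pow_one,
      PowerSeries.X_dvd_iff, map_sub, map_one, sub_eq_zero] at h1
    exact h1
  · rw [hY, Matrix.det_smul, uPow_pow, RingHom.map_det]
    rfl

/-- The characteristic polynomial `det (1 - y φ)` on a direct summand of a free module. -/
lemma detProj_id_sub_smul {P : Type*} [AddCommGroup P] [Module (GrpRing k G) P] {m : ℕ}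
    {i : P →ₗ[GrpRing k G] (Fin m → GrpRing k G)} {r : (Fin m → GrpRing k G) →ₗ[GrpRing k G] P}
    (h : r ∘ₗ i = LinearMap.id) (φ : Module.End (GrpRing k G) P) :
    detProj (LinearMap.id - truncX k G N • φ.baseChange (TruncRing k G N)) =
      Ideal.Quotient.mk _ ((LinearMap.toMatrix' (i ∘ₗ φ ∘ₗ r)).charpolyRev :
        (GrpRing k G)⟦X⟧) := by
  rw [detProj_baseChange h, sub_sub_cancel_left, map_neg, map_smul, presMatrix_baseChange]
  have h1 : (Ideal.Quotient.mk _ ((LinearMap.toMatrix' (i ∘ₗ φ ∘ₗ r)).charpolyRev :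
        (GrpRing k G)⟦X⟧) : TruncRing k G N) =
      ((Ideal.Quotient.mk (Ideal.span {(PowerSeries.X : (GrpRing k G)⟦X⟧) ^ N})).comp
        Polynomial.coeToPowerSeries.ringHom) (LinearMap.toMatrix' (i ∘ₗ φ ∘ₗ r)).charpolyRev := rfl
  rw [h1, Matrix.charpolyRev, RingHom.map_det, ← sub_eq_add_neg]
  congr 1
  ext1 c d
  rw [RingHom.mapMatrix_apply, Matrix.map_apply, Matrix.sub_apply, Matrix.sub_apply,
    Matrix.smul_apply, Matrix.smul_apply, map_sub, smul_eq_mul, smul_eq_mul, map_mul,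
    Matrix.map_apply, Matrix.map_apply, Matrix.one_apply, Matrix.one_apply]
  congr 1
  · split_ifs
    exacts [(map_one _).symm, (map_zero _).symm]
  · congr 1
    · rw [RingHom.comp_apply, Polynomial.coeToPowerSeries.ringHom_apply, Polynomial.coe_X]
    · rw [RingHom.comp_apply, Polynomial.coeToPowerSeries.ringHom_apply, Polynomial.coe_C]
      rfl

/-- The size of a finite module isomorphic to `P` as an `R`-module, in terms of a presentation of
`P` as a direct summand of a free module. -/
lemma polyL_gsize_equiv {P : Type*} [AddCommGroup P] [Module (GrpRing k G) P] {m : ℕ}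
    {i : P →ₗ[GrpRing k G] (Fin m → GrpRing k G)} {r : (Fin m → GrpRing k G) →ₗ[GrpRing k G] P}
    (h : r ∘ₗ i = LinearMap.id) {Q : Type u} [AddCommGroup Q] [Module (GrpRing k G)[X] Q]
    [Module (GrpRing k G) Q] [IsScalarTower (GrpRing k G) (GrpRing k G)[X] Q]
    (e : P ≃ₗ[GrpRing k G] Q) {τ : Module.End (GrpRing k G) P}
    (hτ : ∀ x, e (τ x) = tEnd k G Q (e x)) :
    polyL _ (gsize (k := k) (G := G) Q) = polyL _ (rankPoly (LinearMap.toMatrix' (i ∘ₗ r))) *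
      psL _ ((LinearMap.toMatrix' (i ∘ₗ τ ∘ₗ r)).charpolyRev : (GrpRing k G)[X]) := by
  have h1 : (e.toLinearMap ∘ₗ r) ∘ₗ (i ∘ₗ e.symm.toLinearMap) = LinearMap.id := by
    refine LinearMap.ext fun x => ?_
    change e (r (i (e.symm x))) = x
    rw [← LinearMap.comp_apply r i, h, LinearMap.id_apply, e.apply_symm_apply]
  have h2 : (i ∘ₗ e.symm.toLinearMap) ∘ₗ (e.toLinearMap ∘ₗ r) = i ∘ₗ r := by
    refine LinearMap.ext fun x => ?_
    change i (e.symm (e (r x))) = i (r x)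
    rw [e.symm_apply_apply]
  have h3 : (i ∘ₗ e.symm.toLinearMap) ∘ₗ tEnd k G Q ∘ₗ (e.toLinearMap ∘ₗ r) = i ∘ₗ τ ∘ₗ r := by
    refine LinearMap.ext fun x => ?_
    change i (e.symm (tEnd k G Q (e (r x)))) = i (τ (r x))
    rw [← hτ, e.symm_apply_apply]
  rw [polyL_gsize h1, h2, h3]

end Truncated

/-! ### The determinant on a quotient by a small submodule -/

section Main

variable {k : Type u} [Field k] [Finite k]
variable {F : Type u} [Field F] [Algebra (RatFunc k) F]
variable {K : Type u} [Field K] [Algebra (RatFunc k) K] [Algebra F K]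
  [IsScalarTower (RatFunc k) F K]
variable {G : Type u} [CommGroup G] [MulSemiringAction G K] [IsGaloisGroup G F K] [Fintype G]
variable {M H : Type u} [AddCommGroup M] [Module (GrpRing k G)[X] M] [Module (GrpRing k G) M]
  [IsScalarTower (GrpRing k G) (GrpRing k G)[X] M] [TopologicalSpace M]
  [AddCommGroup H] [Module (GrpRing k G)[X] H]
variable {M' H' : Type u} [AddCommGroup M'] [Module (GrpRing k G)[X] M'] [Module (GrpRing k G) M']
  [IsScalarTower (GrpRing k G) (GrpRing k G)[X] M'] [TopologicalSpace M']
  [AddCommGroup H'] [Module (GrpRing k G)[X] H']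
variable {ι : Type*} [Fintype ι] [DecidableEq ι]
  {b e₁ e₂ : Module.Basis ι (BigRing k G) (KInfty k F K)}
  {D : StructSeq k F K G M H} {D' : StructSeq k F K G M' H'}
  {γ : M ≃ₗ[GrpRing k G] M'} {N N' : ℕ} {l₀ j : ℤ}

lemma TangentAt.map_filtM (h : TangentAt b D D' γ N' l₀) (hj : l₀ ≤ j) :
    (filtM b D j).map γ.toLinearMap = filtM b D' j := by
  apply le_antisymm
  · rintro _ ⟨_, ⟨x, hx, rfl⟩, rfl⟩
    obtain ⟨y, hyx, hy⟩ := h.left j hj x hx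
    refine ⟨y, ?_, hy.symm⟩
    rw [SetLike.mem_coe, ← sub_add_cancel y x]
    exact Submodule.add_mem _ (filt_anti b (by omega) hyx) hx
  · rintro _ ⟨y, hy, rfl⟩
    obtain ⟨x, hxy, hx⟩ := h.right j hj y hy
    refine ⟨D.toM x, ⟨x, ?_, rfl⟩, hx⟩
    rw [SetLike.mem_coe, ← sub_add_cancel x y]
    exact Submodule.add_mem _ (filt_anti b (by omega) hxy) hy

lemma TangentAt.transport_mem (h : TangentAt b D D' γ N' l₀) {l : ℤ} (hl : l₀ + 1 ≤ l) {m : M}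
    (hm : m ∈ filtM b D l) : transport γ m ∈ filtM b D (l - 1) := by
  obtain ⟨x, hx, rfl⟩ := hm
  obtain ⟨x', hx', he⟩ := h.transport_toM hl hx
  refine ⟨x', ?_, he.symm⟩
  rw [SetLike.mem_coe, ← sub_add_cancel x' ((Polynomial.X : (GrpRing k G)[X]) • x)]
  exact Submodule.add_mem _ (filt_anti b (by omega) hx') (X_smul_mem hx)

/-- The heart of the comparison: the components of the image of `z` in the complements of
`filtM b D j` defined by free lattices in good position agree up to terms of order `t⁻ʲ⁻¹`. -/
lemma TangentAt.sub_mem (h : TangentAt b D D' γ N' l₀) (hN : N ≠ 0) (hNN' : N ≤ N')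
    (hj : l₀ + N ≤ j) (he₁ : IsGood b j N' e₁) (he₂ : IsGood b j N' e₂)
    {s₁ : M → M} {s₂ : M' → M'}
    (hs₁ : ∀ x ∈ spanLattice e₁, ∀ u ∈ filtM b D j, s₁ (D.toM x + u) = D.toM x)
    (hs₂ : ∀ x ∈ spanLattice e₂, ∀ u ∈ filtM b D' j, s₂ (D'.toM x + u) = D'.toM x)
    {m : M} (hm : m ∈ filtM b D (j - N + 1)) :
    s₁ m - γ.symm (s₂ (γ m)) ∈ filtM b D (j + 1) := by
  obtain ⟨z, hz, rfl⟩ := hm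
  have hN' : N' ≠ 0 := by omega
  obtain ⟨a₁, ha₁, hza₁⟩ := he₁.exists_sub_mem hN' z
  obtain ⟨z', hz'z, hz'⟩ := h.left (j - N + 1) (by omega) z hz
  obtain ⟨a₂, ha₂, hza₂⟩ := he₂.exists_sub_mem hN' z'
  have hjl : filt b j ≤ filt b (j - N + 1) := filt_anti b (by omega)
  have hz'l : z' ∈ filt b (j - N + 1) := by
    rw [← sub_add_cancel z' z]
    exact Submodule.add_mem _ (filt_anti b (by omega) hz'z) hz
  have ha₁l : a₁ ∈ filt b (j - N + 1) := by
    rw [← sub_sub_cancel z a₁]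
    exact Submodule.sub_mem _ hz (hjl hza₁)
  have ha₂l : a₂ ∈ filt b (j - N + 1) := by
    rw [← sub_sub_cancel z' a₂]
    exact Submodule.sub_mem _ hz'l (hjl hza₂)
  obtain ⟨a₃, ha₃, haγ⟩ := h.right (j - N + 1) (by omega) a₂ ha₂l
  have h1 : s₁ (D.toM z) = D.toM a₁ := by
    rw [← hs₁ a₁ ha₁ _ ⟨_, hza₁, rfl⟩]
    congr 1
    change _ = _ + D.toM (z - a₁)
    rw [← map_add, add_sub_cancel]
  have h2 : γ.symm (s₂ (γ (D.toM z))) = D.toM a₃ := by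
    rw [LinearEquiv.symm_apply_eq, hz', haγ, ← hs₂ a₂ ha₂ _ ⟨_, hza₂, rfl⟩]
    congr 1
    change _ = _ + D'.toM (z' - a₂)
    rw [← map_add, add_sub_cancel]
  have h3 : a₁ - a₂ ∈ filt b j := by
    convert Submodule.sub_mem _ (Submodule.sub_mem _ hza₂ hza₁)
      (filt_anti b (by omega : j ≤ j - N + 1 + N') hz'z) using 1
    abel
  -- neither `a₁` nor `a₂` has a term of order `t⁻ʲ`, which improves the estimate by one step
  have h4 : a₁ - a₂ ∈ filt b (j + 1) := by
    rw [mem_filt]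
    intro i l hl
    rcases (Int.lt_add_one_iff.1 hl).lt_or_eq with h5 | rfl
    · exact h3 i l h5
    · rw [coord_sub, HahnSeries.coeff_sub, he₁.coeff_coord_eq_zero hN' hNN' ha₁ ha₁l,
        he₂.coeff_coord_eq_zero hN' hNN' ha₂ ha₂l, sub_zero]
  change s₁ (D.toM z) - γ.symm (s₂ (γ (D.toM z))) ∈ _
  rw [h1, h2, ← map_sub]
  refine ⟨_, ?_, rfl⟩
  rw [SetLike.mem_coe, ← sub_sub_sub_cancel_right a₁ a₃ a₂]
  exact Submodule.sub_mem _ h4 (filt_anti b (by omega) ha₃)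

/-- The isomorphism of `M/U` with a complement of `U` that is a submodule over `R[t]`. -/
def complEquiv {U : Submodule (GrpRing k G) M} {P : Submodule (GrpRing k G)[X] M}
    (h : IsCompl (P.restrictScalars (GrpRing k G)) U) : (M ⧸ U) ≃ₗ[GrpRing k G] P :=
  Submodule.quotientEquivOfIsCompl U (P.restrictScalars (GrpRing k G)) h.symm

lemma mkQ_complEquiv {U : Submodule (GrpRing k G) M} {P : Submodule (GrpRing k G)[X] M}
    (h : IsCompl (P.restrictScalars (GrpRing k G)) U) (x : M ⧸ U) :
    U.mkQ (complEquiv h x : M) = x :=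
  Submodule.mk_quotientEquivOfIsCompl_apply h.symm x

lemma complEquiv_mk_add {U : Submodule (GrpRing k G) M} {P : Submodule (GrpRing k G)[X] M}
    (h : IsCompl (P.restrictScalars (GrpRing k G)) U) {m u : M} (hm : m ∈ P) (hu : u ∈ U) :
    (complEquiv h (U.mkQ (m + u)) : M) = m := by
  have h1 : U.mkQ (m + u) = U.mkQ m := by
    rw [map_add, Submodule.mkQ_apply U u, (Submodule.Quotient.mk_eq_zero U).2 hu, add_zero]
  rw [h1]
  exact congrArg Subtype.val (Submodule.quotientEquivOfIsCompl_apply_mk_right h.symm ⟨m, hm⟩)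

lemma finite_filtM_quotient {j j' : ℤ} [Finite (M ⧸ filtM b D j')] :
    Finite (filtM b D j ⧸ (filtM b D j').submoduleOf (filtM b D j)) := by
  refine Finite.of_injective (Submodule.mapQ ((filtM b D j').submoduleOf (filtM b D j))
    (filtM b D j') (filtM b D j).subtype le_rfl) ((injective_iff_map_eq_zero _).2 fun x hx => ?_)
  obtain ⟨u, rfl⟩ := Submodule.mkQ_surjective _ x
  exact (Submodule.Quotient.mk_eq_zero _).2
    ((Submodule.Quotient.mk_eq_zero (filtM b D j') (x := (u : M))).1 hx)

/-- Compatible descriptions of the sizes of the complements of `filtM b D j` and `filtM b D' j`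
and of the determinant on the quotient by `filtM b D j`. -/
lemma TangentAt.exists_det_eq [Module.Projective (GrpRing k G) M]
    (hfin : ∀ j, Finite (M ⧸ filtM b D j)) (h : TangentAt b D D' γ N' l₀) (hN : N ≠ 0)
    (hNN' : N ≤ N') (hj : l₀ + N ≤ j) (he₁ : IsGood b j N' e₁) (he₂ : IsGood b j N' e₂)
    {P₁ : Submodule (GrpRing k G)[X] M}
    (hP₁ : IsCompl (P₁.restrictScalars (GrpRing k G)) (filtM b D j))
    (heP₁ : ∀ x ∈ spanLattice e₁, D.toM x ∈ P₁) {P₂ : Submodule (GrpRing k G)[X] M'}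
    (hP₂ : IsCompl (P₂.restrictScalars (GrpRing k G)) (filtM b D' j))
    (heP₂ : ∀ x ∈ spanLattice e₂, D'.toM x ∈ P₂)
    (hδ : ∀ n < N, filtM b D j ≤ (filtM b D j).comap (delta γ n)) :
    ∃ (c₁ c₂ : (GrpRing k G)⟦X⟧) (d : LRing k G), IsUnit d ∧
      PowerSeries.constantCoeff c₁ = 1 ∧ PowerSeries.constantCoeff c₂ = 1 ∧
      polyL _ (gsize (k := k) (G := G) P₁) = d * psL _ c₁ ∧
      polyL _ (gsize (k := k) (G := G) P₂) = d * psL _ c₂ ∧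
      quotDet (TruncRing k G N) (truncX k G N) (delta γ) N (filtM b D j) hδ *
        Ideal.Quotient.mk _ c₁ = Ideal.Quotient.mk _ c₂ := by
  have hinter : ∀ l ≥ l₀, ∀ x ∈ filt b l, x ∈ D.Λ → x = 0 := fun l hl x hx =>
    h.inter_left x (filt_anti b hl hx)
  set U := filtM b D j with hU
  set V := filtM b D (j + 1) with hV
  have hVU : V ≤ U := filtM_anti b D (by omega)
  have := projective_filtM (b := b) D (hinter j (by omega))
  have hVp := projective_filtM (b := b) D (hinter (j + 1) (by omega))
  have hVp' : Module.Projective (GrpRing k G) (V.submoduleOf U) :=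
    Module.Projective.of_equiv (Submodule.submoduleOfEquivOfLe hVU).symm
  have := projective_quotient (V.submoduleOf U)
  have := projective_quotient U
  have := hfin j
  have := hfin (j + 1)
  have : Finite (U ⧸ V.submoduleOf U) := finite_filtM_quotient
  -- the two complements as `R`-modules isomorphic to `M/U`
  let γ' : (M ⧸ U) ≃ₗ[GrpRing k G] (M' ⧸ filtM b D' j) :=
    Submodule.Quotient.equiv U (filtM b D' j) γ (h.map_filtM (by omega))
  let E₁ : (M ⧸ U) ≃ₗ[GrpRing k G] P₁ := complEquiv hP₁
  let E₂ : (M ⧸ U) ≃ₗ[GrpRing k G] P₂ := γ'.trans (complEquiv hP₂)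
  let s₁ : (M ⧸ U) →ₗ[GrpRing k G] M := (P₁.restrictScalars (GrpRing k G)).subtype ∘ₗ E₁.toLinearMap
  let s₂ : (M ⧸ U) →ₗ[GrpRing k G] M := γ.symm.toLinearMap ∘ₗ
    (P₂.restrictScalars (GrpRing k G)).subtype ∘ₗ E₂.toLinearMap
  have hs₁ : ∀ x, U.mkQ (s₁ x) = x := mkQ_complEquiv hP₁
  have hs₂ : ∀ x, U.mkQ (s₂ x) = x := fun x => by
    apply γ'.injective
    refine Eq.trans ?_ (mkQ_complEquiv hP₂ (γ' x))
    change (filtM b D' j).mkQ (γ (γ.symm _)) = _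
    rw [γ.apply_symm_apply]
    rfl
  have hmk₁ : ∀ m ∈ P₁, s₁ (U.mkQ m) = m := fun m hm => by
    have := complEquiv_mk_add hP₁ hm (Submodule.zero_mem U)
    rwa [add_zero] at this
  -- the elements `t'ⁿ u` belong to the steps of index at least `j - N + 1` of the filtration
  have hmem : ∀ n : ℕ, n + 2 ≤ N → ∀ u ∈ U, ∃ m ∈ filtM b D (j - 1 - n),
      U.mkQ m = ((U.mkQ ∘ₗ transport γ ∘ₗ s₂ : Module.End _ (M ⧸ U)) ^ n)
        (U.mkQ (transport γ u)) := fun n => by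
    induction n with
    | zero =>
      intro _ u hu
      exact ⟨_, by simpa using h.transport_mem (by omega) hu, rfl⟩
    | succ n ih =>
      intro hn u hu
      obtain ⟨m, hm, hmu⟩ := ih (by omega) u hu
      have h1 : s₂ (U.mkQ m) ∈ filtM b D (j - 1 - n) := by
        rw [← sub_add_cancel (s₂ (U.mkQ m)) m]
        refine Submodule.add_mem _ (filtM_anti b D (by omega : j - 1 - (n : ℤ) ≤ j) ?_) hm
        rw [← hU, ← Submodule.Quotient.mk_eq_zero, ← Submodule.mkQ_apply, map_sub, hs₂, sub_self]
      refine ⟨transport γ (s₂ (U.mkQ m)), ?_, ?_⟩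
      · have := h.transport_mem (by omega) h1
        rwa [Nat.cast_succ, ← sub_sub]
      · rw [pow_succ', Module.End.mul_apply, ← hmu]
        rfl
  have hyN : truncX k G N ^ N = 0 := by
    rw [← map_pow]
    exact Ideal.Quotient.eq_zero_iff_mem.2 (Ideal.mem_span_singleton_self _)
  -- `t` acts on `P₁`: compare the determinants of `1 - t Z` and `1 - t' Z` on the section `s₁`
  have hA := quotDet_mul (TruncRing k G N) hN hyN (t := tEnd k G M) (t' := transport γ)
    (δ := delta γ) rfl (fun n => rfl) hδ hs₁
    fun x => hmk₁ _ (P₁.smul_mem Polynomial.X (E₁ x).2)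
  -- then pass from the section `s₁` to the section `s₂`
  have hB := detProj_section_eq (TruncRing k G N) (U := U) (V := V) hyN (t' := transport γ)
    (fun v hv => by simpa using h.transport_mem (by omega) hv) hs₁ hs₂ fun n hn u hu => by
      obtain ⟨m, hm, hmu⟩ := hmem n hn u hu
      rw [← hmu, LinearMap.sub_apply]
      exact h.sub_mem (s₁ := fun m => s₁ (U.mkQ m))
        (s₂ := fun m => (complEquiv hP₂ ((filtM b D' j).mkQ m) : M')) hN hNN' hj he₁ he₂
        (fun x hx u hu => complEquiv_mk_add hP₁ (heP₁ x hx) hu)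
        (fun x hx u hu => complEquiv_mk_add hP₂ (heP₂ x hx) hu)
        (filtM_anti b D (by omega) hm)
  obtain ⟨m, i, r, hri⟩ := exists_presentation (GrpRing k G) (M ⧸ U)
  refine ⟨_, _, _, isUnit_polyL_rankPoly (presentation_matrix_idem hri),
    constantCoeff_charpolyRev _, constantCoeff_charpolyRev _,
    polyL_gsize_equiv hri E₁ (τ := U.mkQ ∘ₗ tEnd k G M ∘ₗ s₁) fun x => ?_,
    polyL_gsize_equiv hri E₂ (τ := U.mkQ ∘ₗ transport γ ∘ₗ s₂) fun x => ?_, ?_⟩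
  · exact Subtype.ext (hmk₁ _ (P₁.smul_mem Polynomial.X (E₁ x).2))
  · have h1 := complEquiv_mk_add hP₂ (P₂.smul_mem Polynomial.X (E₂ x).2) (Submodule.zero_mem _)
    refine Subtype.ext (Eq.trans ?_ h1)
    rw [add_zero]
    change (complEquiv hP₂ ((filtM b D' j).mkQ
      (γ (γ.symm (tEnd k G M' (γ (γ.symm (E₂ x))))))) : M') = _
    rw [γ.apply_symm_apply, γ.apply_symm_apply]
    rfl
  · rw [← detProj_id_sub_smul hri, ← detProj_id_sub_smul hri, hA, hB]

end Main

/-! ### The nuclear determinant and the volumes -/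

lemma isUnit_uPow {R : Type*} [CommRing R] (m : ℤ) : IsUnit (uPow R m) :=
  IsUnit.of_mul_eq_one _ (uPow_mul_neg m)

section Final

variable {k : Type u} [Field k] [Finite k]
variable {F : Type u} [Field F] [Algebra (RatFunc k) F] [FiniteDimensional (RatFunc k) F]
variable {K : Type u} [Field K] [Algebra (RatFunc k) K] [Algebra F K]
  [IsScalarTower (RatFunc k) F K] [FiniteDimensional (RatFunc k) K]
  [Algebra.IsSeparable (RatFunc k) K]
variable {G : Type u} [CommGroup G] [MulSemiringAction G K] [IsGaloisGroup G F K] [Fintype G]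
variable {M H : Type u} [AddCommGroup M] [Module (GrpRing k G)[X] M] [Module (GrpRing k G) M]
  [IsScalarTower (GrpRing k G) (GrpRing k G)[X] M] [TopologicalSpace M]
  [AddCommGroup H] [Module (GrpRing k G)[X] H]
variable {M' H' : Type u} [AddCommGroup M'] [Module (GrpRing k G)[X] M'] [Module (GrpRing k G) M']
  [IsScalarTower (GrpRing k G) (GrpRing k G)[X] M'] [TopologicalSpace M']
  [AddCommGroup H'] [Module (GrpRing k G)[X] H']
variable {D : StructSeq k F K G M H} {D' : StructSeq k F K G M' H'} {γ : M ≃ₗ[GrpRing k G] M'}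
variable {W : Submodule (MonoidAlgebra (OF k F) G) (rhoK k F K G).asModule}
variable {Λ₀ : Submodule (GrpRing k G)[X] (KInfty k F K)}

variable (k F K G) in
/-- The volumes of `M` and `M'` and the nuclear determinant modulo `Z^N` in terms of two power
series. -/
lemma exists_det_vol [Module.Projective (GrpRing k G) M] [Module.Projective (GrpRing k G) M']
    [Finite H] [Finite H'] (hΛ₀ : IsProjLattice Λ₀) (hW : IsInftyTaming W)
    (hγ : IsInfTangent D D' γ) : ∃ y : LRing k G, IsUnit y ∧ ∀ N i : ℕ, N ≠ 0 →
      ∀ h : ∀ n < N, IsNucleus W D (delta γ n) i,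
      ∃ (a₁ a₂ : (GrpRing k G)⟦X⟧) (z : LRing k G), IsUnit z ∧
        PowerSeries.constantCoeff a₁ = 1 ∧ PowerSeries.constantCoeff a₂ = 1 ∧
        bigToL k G (vol Λ₀ D) * y = z * psL _ a₁ ∧ bigToL k G (vol Λ₀ D') * y = z * psL _ a₂ ∧
        detMod W D (delta γ) N i h * Ideal.Quotient.mk _ a₁ = Ideal.Quotient.mk _ a₂ := by
  obtain ⟨x, b, hb⟩ := exists_bigBasis k F K G
  obtain ⟨c, hc⟩ := exists_nbhd_le b hW.le
  obtain ⟨c', hc'⟩ := exists_le_nbhd b hW.finite hb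
  have := hW.projective
  obtain ⟨j₀, hj₀⟩ := exists_isGood b hΛ₀.1 one_ne_zero
  obtain ⟨e₀, he₀, hΛe₀⟩ := hj₀ j₀ le_rfl
  obtain ⟨hym, hyu⟩ := monic_covol_of_isGood hΛ₀ one_ne_zero he₀ hΛe₀
  have hy := isCovol_of_isGood (b := b) hΛe₀
  refine ⟨_, hyu, fun N i hN h => ?_⟩
  obtain ⟨l₀, hl₀⟩ := exists_tangentAt (b := b) hγ N
  obtain ⟨j₁, hj₁⟩ := (isVol_vol b Λ₀ D).exists_isCompl hΛ₀ hy hym hN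
  obtain ⟨j₂, hj₂⟩ := (isVol_vol b Λ₀ D').exists_isCompl hΛ₀ hy hym hN
  have hfin : ∀ j, Finite (M ⧸ filtM b D j) := fun j => by
    obtain ⟨e, P, -, -, hP, -, hc, -⟩ := hj₁ (max j j₁) (le_max_right _ _)
    have := Finite.of_equiv _ (complEquiv hc).symm.toEquiv
    exact finite_quotient_of_le (filtM_anti b D (le_max_left j j₁))
  obtain ⟨j₃, hj₃⟩ := exists_detMod_eq b hW.finite hγ hc hc' hfin hN h
  obtain ⟨j, hj⟩ : ∃ j, l₀ + N ≤ j ∧ j₁ ≤ j ∧ j₂ ≤ j ∧ j₃ ≤ j :=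
    ⟨max (max (l₀ + N) j₁) (max j₂ j₃), by omega⟩
  obtain ⟨e₁, P₁, he₁, -, -, -, hP₁, heP₁, hv₁⟩ := hj₁ j hj.2.1
  obtain ⟨e₂, P₂, he₂, -, -, -, hP₂, heP₂, hv₂⟩ := hj₂ j hj.2.2.1
  obtain ⟨hδ, hdet⟩ := hj₃ j hj.2.2.2
  obtain ⟨c₁, c₂, d, hd, hc₁, hc₂, hg₁, hg₂, hcc⟩ :=
    hl₀.exists_det_eq hfin hN le_rfl hj.1 he₁ he₂ hP₁ heP₁ hP₂ heP₂ hδ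
  obtain ⟨p₁, hp₁, hp₁N, hZ₁⟩ := he₁.det_mod hN le_rfl
  obtain ⟨p₂, hp₂, hp₂N, hZ₂⟩ := he₂.det_mod hN le_rfl
  refine ⟨c₁ * p₁, c₂ * p₂, _,
    hd.mul (isUnit_uPow (Fintype.card (Fin (Module.finrank (RatFunc k) F)) * (j - 1))),
    ?_, ?_, ?_, ?_, ?_⟩
  · rw [map_mul, hc₁, hp₁, one_mul]
  · rw [map_mul, hc₂, hp₂, one_mul]
  · rw [hv₁, hg₁, hZ₁, map_mul]
    ring
  · rw [hv₂, hg₂, hZ₂, map_mul]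
    ring
  · rw [hdet, map_mul, map_mul, hp₁N, hp₂N, mul_one, mul_one, hcc]

lemma projective_kInfty_quotient {Λ : Submodule (GrpRing k G)[X] (KInfty k F K)}
    (hΛ : IsProjLattice Λ) : Module.Projective (GrpRing k G) (KInfty k F K ⧸ Λ) := by
  obtain ⟨x, b, hb⟩ := exists_bigBasis k F K G
  have := projective_kInfty b
  have h1 : Module.Projective (GrpRing k G) (Λ.restrictScalars (GrpRing k G)) := hΛ.projective
  have h2 := projective_quotient (Λ.restrictScalars (GrpRing k G))
  exact Module.Projective.of_equiv (Submodule.Quotient.restrictScalarsEquiv _ _)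

/-- Finitely many of the `δₙ` have a common nucleus. -/
lemma exists_common_nucleus (hW : IsInftyTaming W) (hγ : IsInfTangent D D' γ) (N : ℕ) :
    ∃ i, ∀ n < N, IsNucleus W D (delta γ n) i := by
  obtain ⟨x, b, hb⟩ := exists_bigBasis k F K G
  obtain ⟨c, hc⟩ := exists_nbhd_le b hW.le
  obtain ⟨c', hc'⟩ := exists_le_nbhd b hW.finite hb
  obtain ⟨i, hi⟩ := exists_bound (fun (n : Fin N) i => IsNucleus W D (delta γ n) i)
    fun n => exists_isNucleus hγ hc hc' n
  exact ⟨i, fun n hn => hi i le_rfl ⟨n, hn⟩⟩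

lemma psL_injective {R : Type*} [CommRing R] : Function.Injective (psL R) :=
  HahnSeries.ofPowerSeries_injective

lemma isUnit_psL {R : Type*} [CommRing R] {a : R⟦X⟧} (h : PowerSeries.constantCoeff a = 1) :
    IsUnit (psL R a) := (isUnit_of_constantCoeff_eq_one h).map _

/-- The nuclear determinant of `1 + Δ_γ` is the quotient of the volumes. -/
lemma nuclearDet_eq_vol [Module.Projective (GrpRing k G) M] [Module.Projective (GrpRing k G) M']
    [Finite H] [Finite H'] (hΛ₀ : IsProjLattice Λ₀) (hW : IsInftyTaming W)
    (hγ : IsInfTangent D D' γ) : IsUnit (vol Λ₀ D) ∧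
      evalT (nuclearDet W D (delta γ)) = vol Λ₀ D' * Ring.inverse (vol Λ₀ D) := by
  obtain ⟨y, hy, hdet⟩ := exists_det_vol k F K G hΛ₀ hW hγ
  have hnuc := exists_common_nucleus hW hγ
  -- the case `N = 1` yields the volumes; the power series `f` represents their quotient
  obtain ⟨i, hi⟩ := hnuc 1
  obtain ⟨a₁, a₂, z, hz, ha₁, ha₂, hv₁, hv₂, -⟩ := hdet 1 i one_ne_zero hi
  have hu : IsUnit (bigToL k G (vol Λ₀ D)) :=
    isUnit_of_mul_isUnit_left (hv₁ ▸ hz.mul (isUnit_psL ha₁))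
  refine ⟨isUnit_of_bigToL hu, ?_⟩
  obtain ⟨a₁', ha₁'⟩ := (isUnit_of_constantCoeff_eq_one ha₁).exists_right_inv
  set f := a₂ * a₁' with hf
  have hfv : psL _ f * bigToL k G (vol Λ₀ D) = bigToL k G (vol Λ₀ D') := by
    refine hy.mul_right_cancel ?_
    have h1 : psL (GrpRing k G) a₁ * psL _ a₁' = 1 := by rw [← map_mul, ha₁', map_one]
    rw [mul_assoc, hv₁, hv₂, hf, map_mul]
    linear_combination (z * psL _ a₂) * h1
  -- the power series found for other `N` have the same quotient
  have hfdet : ∀ (N i : ℕ) (h : ∀ n < N, IsNucleus W D (delta γ n) i),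
      Ideal.Quotient.mk _ f = detMod W D (delta γ) N i h := by
    intro N i h
    rcases eq_or_ne N 0 with rfl | hN
    · have : Subsingleton ((GrpRing k G)⟦X⟧ ⧸
          Ideal.span {(PowerSeries.X : (GrpRing k G)⟦X⟧) ^ 0}) :=
        Ideal.Quotient.subsingleton_iff.2 (by rw [pow_zero, Ideal.span_singleton_one])
      exact Subsingleton.elim _ _
    · obtain ⟨b₁, b₂, w, hw, hb₁, hb₂, hw₁, hw₂, hb⟩ := hdet N i hN h
      have h2 : f * b₁ = b₂ := by
        refine psL_injective (hw.mul_left_cancel ?_)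
        rw [map_mul, mul_left_comm, ← hw₁, ← hw₂, ← hfv, mul_assoc]
      refine ((isUnit_of_constantCoeff_eq_one hb₁).map _).mul_right_cancel (Eq.trans ?_ hb.symm)
      rw [← map_mul, h2]
  have hnd : IsNuclearDet W D (delta γ) (nuclearDet W D (delta γ)) :=
    Classical.epsilon_spec (p := IsNuclearDet W D (delta γ)) ⟨f, hfdet⟩
  have hfn : nuclearDet W D (delta γ) = f := by
    rw [← sub_eq_zero]
    ext n
    obtain ⟨i, hi⟩ := hnuc (n + 1)
    have h3 := (hnd (n + 1) i hi).trans (hfdet (n + 1) i hi).symm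
    rw [Ideal.Quotient.eq, Ideal.mem_span_singleton, PowerSeries.X_pow_dvd_iff] at h3
    rw [h3 n n.lt_succ_self, map_zero]
  refine (bigToL k G).injective (hu.mul_right_cancel ?_)
  have h4 := bigToL_mul_inverse hu
  rw [hfn, bigToL_evalT, map_mul (bigToL k G)]
  refine hfv.trans ?_
  linear_combination -(bigToL k G (vol Λ₀ D')) * h4

end Final

section Nuclear

variable {k : Type u} [Field k] [Finite k]
variable {F : Type u} [Field F] [Algebra (RatFunc k) F] [FiniteDimensional (RatFunc k) F]
variable {K : Type u} [Field K] [Algebra (RatFunc k) K] [Algebra F K]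
  [IsScalarTower (RatFunc k) F K] [FiniteDimensional (RatFunc k) K]
  [Algebra.IsSeparable (RatFunc k) K]
variable {G : Type u} [CommGroup G] [MulSemiringAction G K] [IsGaloisGroup G F K] [Fintype G]
variable {M H : Type u} [AddCommGroup M] [Module (GrpRing k G)[X] M] [Module (GrpRing k G) M]
  [IsScalarTower (GrpRing k G) (GrpRing k G)[X] M] [TopologicalSpace M]
  [AddCommGroup H] [Module (GrpRing k G)[X] H]
variable {W : Submodule (MonoidAlgebra (OF k F) G) (rhoK k F K G).asModule}

/-- The endomorphism `Δ_γ` is nuclear: `γ` is a homeomorphism from a compact module to a Hausdorff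
one. -/
lemma isNuclear_delta [IsTopologicalAddGroup M] [ContinuousConstSMul (GrpRing k G)[X] M]
    [CompactSpace M] {D : StructSeq k F K G M H}
    {Λ : Submodule (GrpRing k G)[X] (KInfty k F K)} (hΛ : IsProjLattice Λ) (hW : IsInftyTaming W)
    {γ : M ≃ₗ[GrpRing k G] (KInfty k F K ⧸ Λ)} (hγc : Continuous γ)
    (hγ : IsInfTangent D (StructSeq.ofLattice k F K G Λ hΛ.1) γ) : IsNuclear W D (delta γ) := by
  obtain ⟨x, b, hb⟩ := exists_bigBasis k F K G
  obtain ⟨l₀, hl₀⟩ := exists_tangentAt (b := b) hγ 0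
  have : T2Space (KInfty k F K ⧸ Λ) := t2Space_quotient b hl₀.inter_right
  have hsymm : Continuous γ.symm := (hγc.homeoOfEquivCompactToT2 (f := γ.toEquiv)).continuous_symm
  have htr : Continuous (transport γ) := hsymm.comp ((continuous_tEnd_quotient Λ).comp hγc)
  have hpow : ∀ n : ℕ, Continuous (⇑(tEnd k G M ^ n)) := fun n => by
    rw [Module.End.coe_pow]
    exact continuous_tEnd.iterate n
  intro n
  obtain ⟨i, hi⟩ := exists_common_nucleus hW hγ (n + 1)
  refine ⟨?_, i, hi n n.lt_succ_self⟩
  rw [delta]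
  split_ifs
  · exact continuous_const
  · exact (continuous_tEnd.sub htr).comp (hpow (n - 1))

end Nuclear

end EqVol

end

theorem theoremT {k F K G M₁ H₁ : Type u}
    -- the constant field, the extension `K/F` of function fields, its abelian Galois group
    [Field k] [Finite k]
    [Field F] [Algebra (RatFunc k) F] [FiniteDimensional (RatFunc k) F]
    [Algebra.IsSeparable (RatFunc k) F]
    [Field K] [Algebra (RatFunc k) K] [Algebra F K] [IsScalarTower (RatFunc k) F K]
    [FiniteDimensional F K]
    [CommGroup G] [Fintype G] [MulSemiringAction G K] [IsGaloisGroup G F K]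
    (hconst : ∀ x : K, ((algebraMap (RatFunc k) K).comp RatFunc.C).IsIntegralElem x →
      ∃ c : k, algebraMap (RatFunc k) K (RatFunc.C c) = x)
    -- the `∞`-taming module used to compute nuclear determinants
    (W : Submodule (MonoidAlgebra (EqVol.OF k F) G) (EqVol.rhoK k F K G).asModule)
    (hW : EqVol.IsInftyTaming W)
    -- the lattice used to normalise volumes
    (Λ₀ : Submodule (EqVol.GrpRing k G)[X] (EqVol.KInfty k F K)) (hΛ₀ : EqVol.IsProjLattice Λ₀)
    -- the module `M₁` in the class `𝒞`
    [AddCommGroup M₁] [Module (EqVol.GrpRing k G)[X] M₁] [Module (EqVol.GrpRing k G) M₁]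
    [IsScalarTower (EqVol.GrpRing k G) (EqVol.GrpRing k G)[X] M₁]
    [TopologicalSpace M₁] [IsTopologicalAddGroup M₁]
    [ContinuousConstSMul (EqVol.GrpRing k G)[X] M₁] [CompactSpace M₁] [T2Space M₁]
    [AddCommGroup H₁] [Module (EqVol.GrpRing k G)[X] H₁] [Finite H₁]
    (D₁ : EqVol.StructSeq k F K G M₁ H₁) (hct : EqVol.IsCohTrivial k G M₁)
    -- the module `M₂ = K_∞/Λ₂`
    (Λ₂ : Submodule (EqVol.GrpRing k G)[X] (EqVol.KInfty k F K)) (hΛ₂ : EqVol.IsProjLattice Λ₂)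
    -- the isomorphism `γ`
    (γ : M₁ ≃ₗ[EqVol.GrpRing k G] (EqVol.KInfty k F K ⧸ Λ₂)) (hγ : Continuous γ)
    (htan : EqVol.IsInfTangent D₁ (EqVol.StructSeq.ofLattice k F K G Λ₂ hΛ₂.1) γ) :
    EqVol.IsNuclear W D₁ (EqVol.delta γ) ∧
    IsUnit (EqVol.vol Λ₀ D₁) ∧
    EqVol.evalT (EqVol.nuclearDet W D₁ (EqVol.delta γ)) =
      EqVol.vol Λ₀ (EqVol.StructSeq.ofLattice k F K G Λ₂ hΛ₂.1) *
        Ring.inverse (EqVol.vol Λ₀ D₁) := by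
  have : IsGalois F K := IsGaloisGroup.isGalois G F K
  have : FiniteDimensional (RatFunc k) K := FiniteDimensional.trans (RatFunc k) F K
  have : Algebra.IsSeparable (RatFunc k) K := Algebra.IsSeparable.trans (RatFunc k) F K
  have := EqVol.projective_kInfty_quotient hΛ₂
  have : Module.Projective (EqVol.GrpRing k G) M₁ := Module.Projective.of_equiv γ.symm
  exact ⟨EqVol.isNuclear_delta hΛ₂ hW hγ htan, EqVol.nuclearDet_eq_vol hΛ₀ hW htan⟩
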